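/- **Setting.** Let $V=\{1,\dots,n\}$ be a set of spins with local Hilbert spaces of dimension $d$, and let $S$ be a set of subsets of $V$ with $|S|\ge 1$ and $|X|\le k$ for all $X\in S$. Let $$H=\sum_{X\in S}\lambda_X h_X,$$ where $\lambda_X\in[-1,1]$ and $h_X$ is a Hermitian operator acting on the spins in $X$ (and trivially on the others) with operator norm $\|h_X\|\le 1$. The interaction graph of $H$ has vertex set $S$, and two different $X,Y\in S$ are adjacent if and only if $X\cap Y\ne\emptyset$. Let $\mathfrak d\ge 1$ be an integer such that the maximum degree of the interaction graph is at most $\mathfrak d$. Let $\rho=\bigotimes_{v\in V}\rho_v$ be a product of density matrices. Put $$L(z)=\operatorname{tr}\bigl(e^{-iHz}\rho\bigr)\quad (z\in\mathbb C),\qquad t_L^*=\frac{1}{2e^2\,\mathfrak d(\mathfrak d+1)} .$$ **Computational model.** Algorithms are deterministic programs for a unit-cost random access machine with exact arithmetic. It has natural-number registers and arrays (addition, truncated subtraction, comparison, indirect addressing) and complex registers and arrays (field operations, conjugation, modulus, the constants $i$ and $e$, conversion of naturals to complex numbers, comparison of real parts). The input, consisting of $n,d,k,\mathfrak d$, the list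 of the subsystems in $S$ (in any order), the coefficients $\lambda_X$, the matrix entries of the $h_X$ and the $\rho_v$, the time $t$ and the accuracy $\varepsilon$, is given in read-only random access arrays. Each instruction and each test counts as one step. **Theorem.** There is a single deterministic program such that for all $d,k$ and all $\mathfrak d\ge 1$ there is a polynomial $p$, depending only on $d,k,\mathfrak d$, with the following property. For all $n$, $S$, $H$ and $\rho$ as above, there is an analytic function $\log L$ on the disc $\{|z|<t_L^*\}$ with $\log L(0)=0$ and $e^{\log L(z)}=L(z)$ there (so $L$ has no zeros in the disc). Moreover, for every time $t\in\mathbb C$ with $|t|<t_L^*$ (in particular for real $t$) and every $\varepsilon>0$, the program halts with an output $\hat f_L(t)\in\mathbb C$ such that $$\bigl|\log L(t)-\hat f_L(t)\bigr|\le\varepsilon$$ after at most $$|S|\cdot p\!\left(\left(\frac{|S|}{1-|t|/t_L^*}\cdot\frac1\varepsilon\right)^{1/\log(t_L^*/|t|)}\right)$$ steps, where the exponent $1/\log(t_L^*/|t|)$ is read as $0$ when $t=0$. -/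

import Mathlib

open scoped ComplexOrder

/-! ### Spin systems: local Hamiltonians, product states, Loschmidt echo -/

/-- The operator `A ⊗ 1` on `(ℂ^d)^{⊗ n}` for an operator `A` on the spins in `X`.
The basis of `(ℂ^d)^{⊗ n}` is indexed by the configurations `Fin n → Fin d`. -/
def embedOperator {n d : ℕ} (X : Finset (Fin n))
    (A : Matrix (X → Fin d) (X → Fin d) ℂ) :
    Matrix (Fin n → Fin d) (Fin n → Fin d) ℂ :=
  fun σ τ => if ∀ v, v ∉ X → σ v = τ v then A (fun v => σ v) (fun v => τ v) else 0

/-- A `k`-local Hamiltonian `H = ∑_{X ∈ S} λ_X h_X` on `n` spins of local dimension `d`.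
The set `S` of subsystems is presented as a list without repetition (in arbitrary order), which is
how an algorithm receives it; in particular `|S| = numTerms`. -/
structure LocalHamiltonian (n d k : ℕ) where
  /-- the number `|S|` of terms -/
  numTerms : ℕ
  /-- the subsystems `X ∈ S` -/
  subsystem : Fin numTerms → Finset (Fin n)
  subsystem_injective : Function.Injective subsystem
  card_subsystem_le : ∀ j, (subsystem j).card ≤ k
  /-- the coefficients `λ_X` -/
  coeff : Fin numTerms → ℝ
  abs_coeff_le : ∀ j, |coeff j| ≤ 1
  /-- the operators `h_X`, acting on the spins in `X` -/
  term : (j : Fin numTerms) →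
    Matrix (subsystem j → Fin d) (subsystem j → Fin d) ℂ
  term_isHermitian : ∀ j, (term j).IsHermitian
  /-- the operator norm (on the Euclidean space) of every `h_X` is at most one -/
  norm_term_le : ∀ j,
    ‖Matrix.toEuclideanCLM (n := subsystem j → Fin d) (𝕜 := ℂ) (term j)‖ ≤ 1

namespace LocalHamiltonian

variable {n d k : ℕ}

/-- The Hamiltonian as an operator on the total Hilbert space. -/
noncomputable def toMatrix (H : LocalHamiltonian n d k) :
    Matrix (Fin n → Fin d) (Fin n → Fin d) ℂ :=
  ∑ j, (H.coeff j : ℂ) • embedOperator (H.subsystem j) (H.term j)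

/-- The interaction graph: its vertices are the subsystems in `S` (through their positions in the
list), and two different ones are adjacent if they overlap. -/
def interactionGraph (H : LocalHamiltonian n d k) : SimpleGraph (Fin H.numTerms) where
  Adj i j := i ≠ j ∧ ¬ Disjoint (H.subsystem i) (H.subsystem j)
  symm := ⟨fun _ _ h => ⟨h.1.symm, fun h' => h.2 h'.symm⟩⟩
  loopless := ⟨fun _ h => h.1 rfl⟩

instance (H : LocalHamiltonian n d k) : DecidableRel H.interactionGraph.Adj :=
  fun i j => inferInstanceAs
    (Decidable (i ≠ j ∧ ¬ Disjoint (H.subsystem i) (H.subsystem j)))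

end LocalHamiltonian

/-- A product state: one density matrix for every spin. -/
structure ProductState (n d : ℕ) where
  /-- the states of the individual spins -/
  site : Fin n → Matrix (Fin d) (Fin d) ℂ
  site_posSemidef : ∀ v, (site v).PosSemidef
  site_trace : ∀ v, (site v).trace = 1

/-- The density matrix `⨂_v ρ_v` on the total Hilbert space. -/
noncomputable def ProductState.toMatrix {n d : ℕ} (ρ : ProductState n d) :
    Matrix (Fin n → Fin d) (Fin n → Fin d) ℂ :=
  fun σ τ => ∏ v, ρ.site v (σ v) (τ v)

/-- The Loschmidt echo `L(t) = tr (exp (-i H t) ρ)`. -/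
noncomputable def loschmidtEcho {n d k : ℕ} (H : LocalHamiltonian n d k) (ρ : ProductState n d)
    (t : ℂ) : ℂ :=
  (NormedSpace.exp ((-(Complex.I * t)) • H.toMatrix) * ρ.toMatrix).trace

/-- The threshold time `t_L^* = 1 / (2 e² 𝔡 (𝔡 + 1))`. -/
noncomputable def thresholdTime (deg : ℕ) : ℝ :=
  1 / (2 * Real.exp 1 ^ 2 * deg * (deg + 1))

/-! ### Deterministic algorithms with exact arithmetic and unit costs

A random access machine with natural-number registers and arrays (used for counting and
addressing) and complex registers and arrays (exact arithmetic). There is no way to turn a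
complex number into a natural number other than by comparisons. A program is a fixed finite text,
independent of the input. -/

/-- The memory. Registers and arrays are named by natural numbers; the index of an array entry may
be computed at run time. -/
structure Store where
  natReg : ℕ → ℕ
  cpxReg : ℕ → ℂ
  natArr : ℕ → ℕ → ℕ
  cpxArr : ℕ → ℕ → ℂ

/-- The memory at the start of every computation. -/
noncomputable def Store.blank : Store where
  natReg := fun _ => 0
  cpxReg := fun _ => 0
  natArr := fun _ _ => 0
  cpxArr := fun _ _ => 0

/-- A random access read-only input: arrays of natural numbers with two indices and arrays of
complex numbers with three indices. -/
structure Input where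
  nat : ℕ → ℕ → ℕ → ℕ
  cpx : ℕ → ℕ → ℕ → ℕ → ℂ

/-- The instructions. All arguments are names of registers or arrays, except for the literal in
`natConst`. The first argument is the target (for the `Store` instructions, the first two are).
Subtraction of natural numbers is truncated at zero; division by zero returns zero. -/
inductive Instr where
  | natConst (x c : ℕ)
  | natAdd (x y z : ℕ)
  | natSub (x y z : ℕ)
  | natLoad (x a i : ℕ)
  | natStore (a i x : ℕ)
  | natInput (x a i j : ℕ)
  | cpxOfNat (u x : ℕ)
  | cpxI (u : ℕ)
  | cpxEuler (u : ℕ)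
  | cpxAdd (u v w : ℕ)
  | cpxSub (u v w : ℕ)
  | cpxMul (u v w : ℕ)
  | cpxDiv (u v w : ℕ)
  | cpxConj (u v : ℕ)
  | cpxAbs (u v : ℕ)
  | cpxLoad (u a i : ℕ)
  | cpxStore (a i u : ℕ)
  | cpxInput (u a i j l : ℕ)

namespace Store

/-- Assignment to a natural-number register. -/
def setNat (s : Store) (x v : ℕ) : Store :=
  { s with natReg := Function.update s.natReg x v }

/-- Assignment to a complex register. -/
def setCpx (s : Store) (u : ℕ) (v : ℂ) : Store :=
  { s with cpxReg := Function.update s.cpxReg u v }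

/-- Assignment to an entry of an array of natural numbers. -/
def setNatArr (s : Store) (a i v : ℕ) : Store :=
  { s with natArr := Function.update s.natArr a (Function.update (s.natArr a) i v) }

/-- Assignment to an entry of an array of complex numbers. -/
def setCpxArr (s : Store) (a i : ℕ) (v : ℂ) : Store :=
  { s with cpxArr := Function.update s.cpxArr a (Function.update (s.cpxArr a) i v) }

end Store

/-- The effect of an instruction. -/
noncomputable def Instr.apply (inp : Input) (s : Store) : Instr → Store
  | natConst x c => s.setNat x c
  | natAdd x y z => s.setNat x (s.natReg y + s.natReg z)
  | natSub x y z => s.setNat x (s.natReg y - s.natReg z)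
  | natLoad x a i => s.setNat x (s.natArr a (s.natReg i))
  | natStore a i x => s.setNatArr a (s.natReg i) (s.natReg x)
  | natInput x a i j => s.setNat x (inp.nat a (s.natReg i) (s.natReg j))
  | cpxOfNat u x => s.setCpx u (s.natReg x : ℂ)
  | cpxI u => s.setCpx u Complex.I
  | cpxEuler u => s.setCpx u (Real.exp 1 : ℂ)
  | cpxAdd u v w => s.setCpx u (s.cpxReg v + s.cpxReg w)
  | cpxSub u v w => s.setCpx u (s.cpxReg v - s.cpxReg w)
  | cpxMul u v w => s.setCpx u (s.cpxReg v * s.cpxReg w)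
  | cpxDiv u v w => s.setCpx u (s.cpxReg v / s.cpxReg w)
  | cpxConj u v => s.setCpx u (starRingEnd ℂ (s.cpxReg v))
  | cpxAbs u v => s.setCpx u (‖s.cpxReg v‖ : ℂ)
  | cpxLoad u a i => s.setCpx u (s.cpxArr a (s.natReg i))
  | cpxStore a i u => s.setCpxArr a (s.natReg i) (s.cpxReg u)
  | cpxInput u a i j l =>
      s.setCpx u (inp.cpx a (s.natReg i) (s.natReg j) (s.natReg l))

/-- The tests: comparisons of natural numbers, and of the real parts of complex numbers. -/
inductive Test where
  | natLt (x y : ℕ)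
  | natLe (x y : ℕ)
  | reLt (u v : ℕ)
  | reLe (u v : ℕ)

/-- The condition expressed by a test. -/
def Test.Holds (s : Store) : Test → Prop
  | natLt x y => s.natReg x < s.natReg y
  | natLe x y => s.natReg x ≤ s.natReg y
  | reLt u v => (s.cpxReg u).re < (s.cpxReg v).re
  | reLe u v => (s.cpxReg u).re ≤ (s.cpxReg v).re

/-- The programs. -/
inductive Program where
  | instr (i : Instr)
  | seq (p q : Program)
  | cond (b : Test) (p q : Program)
  | loop (b : Test) (p : Program)

/-- `Runs inp p s s' T`: on the input `inp` and the memory `s`, the program `p` halts after exactly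
`T` steps with the memory `s'`. Every instruction and every evaluation of a test is one step. -/
inductive Runs (inp : Input) : Program → Store → Store → ℕ → Prop where
  | instr (i : Instr) (s : Store) : Runs inp (.instr i) s (i.apply inp s) 1
  | seq {p q : Program} {s s' s'' : Store} {T T' : ℕ}
      (hp : Runs inp p s s' T) (hq : Runs inp q s' s'' T') :
      Runs inp (.seq p q) s s'' (T + T')
  | condTrue {b : Test} {p q : Program} {s s' : Store} {T : ℕ}
      (hb : b.Holds s) (hp : Runs inp p s s' T) : Runs inp (.cond b p q) s s' (T + 1)
  | condFalse {b : Test} {p q : Program} {s s' : Store} {T : ℕ}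
      (hb : ¬ b.Holds s) (hq : Runs inp q s s' T) : Runs inp (.cond b p q) s s' (T + 1)
  | loopTrue {b : Test} {p : Program} {s s' s'' : Store} {T T' : ℕ}
      (hb : b.Holds s) (hp : Runs inp p s s' T) (hl : Runs inp (.loop b p) s' s'' T') :
      Runs inp (.loop b p) s s'' (T + T' + 1)
  | loopFalse {b : Test} {p : Program} {s : Store}
      (hb : ¬ b.Holds s) : Runs inp (.loop b p) s s 1

/-- Programs are deterministic: the result and the number of steps are unique. -/
theorem Runs.deterministic {inp : Input} {p : Program} {s s₁ s₂ : Store} {T₁ T₂ : ℕ}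
    (h₁ : Runs inp p s s₁ T₁) (h₂ : Runs inp p s s₂ T₂) : s₁ = s₂ ∧ T₁ = T₂ := by
  induction h₁ generalizing s₂ T₂ with
  | instr i s => cases h₂; exact ⟨rfl, rfl⟩
  | seq hp hq ihp ihq =>
    cases h₂ with
    | seq hp' hq' =>
      obtain ⟨rfl, rfl⟩ := ihp hp'
      obtain ⟨rfl, rfl⟩ := ihq hq'
      exact ⟨rfl, rfl⟩
  | condTrue hb hp ih =>
    cases h₂ with
    | condTrue hb' hp' => obtain ⟨rfl, rfl⟩ := ih hp'; exact ⟨rfl, rfl⟩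
    | condFalse hb' hq' => exact absurd hb hb'
  | condFalse hb hq ih =>
    cases h₂ with
    | condTrue hb' hp' => exact absurd hb' hb
    | condFalse hb' hq' => obtain ⟨rfl, rfl⟩ := ih hq'; exact ⟨rfl, rfl⟩
  | loopTrue hb hp hl ihp ihl =>
    cases h₂ with
    | loopTrue hb' hp' hl' =>
      obtain ⟨rfl, rfl⟩ := ihp hp'
      obtain ⟨rfl, rfl⟩ := ihl hl'
      exact ⟨rfl, rfl⟩
    | loopFalse hb' => exact absurd hb hb'
  | loopFalse hb =>
    cases h₂ with
    | loopTrue hb' hp' hl' => exact absurd hb' hb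
    | loopFalse hb' => exact ⟨rfl, rfl⟩

/-! ### The input of the algorithm -/

/-- The configuration of the spins in `X` with number `a`: listing the spins of `X` in increasing
order as `v_0 < v_1 < …`, spin `v_i` is in the basis state given by the `i`-th digit of `a` in
base `d`, starting from the least significant one. -/
def localConfig {n d : ℕ} (X : Finset (Fin n)) (a : Fin (d ^ X.card)) : X → Fin d :=
  fun v => finFunctionFinEquiv.symm a ((X.orderIsoOfFin rfl).symm v)

/-- The input for given data. Arrays of natural numbers: `0`: the number `n` of spins;
`1`: the local dimension `d`; `2`: the locality `k`; `3`: the bound `deg` on the degree;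
`4`: the number `|S|` of terms; `5`: the size of the `i`-th subsystem; `6`: the `j`-th spin, in
increasing order, of the `i`-th subsystem. Arrays of complex numbers: `0`: the time; `1`: the
accuracy; `2`: the coefficient of the `i`-th term; `3`: the entry `(a, b)` of the matrix of the
`i`-th term; `4`: the entry `(a, b)` of the state of the `i`-th spin. Everything else is zero. -/
noncomputable def encodeInput {n d k : ℕ} (deg : ℕ) (H : LocalHamiltonian n d k)
    (ρ : ProductState n d) (t : ℂ) (ε : ℝ) : Input where
  nat
    | 0, _, _ => n
    | 1, _, _ => d
    | 2, _, _ => k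
    | 3, _, _ => deg
    | 4, _, _ => H.numTerms
    | 5, i, _ => if hi : i < H.numTerms then (H.subsystem ⟨i, hi⟩).card else 0
    | 6, i, j =>
        if hi : i < H.numTerms then
          if hj : j < (H.subsystem ⟨i, hi⟩).card then
            ((H.subsystem ⟨i, hi⟩).orderEmbOfFin rfl ⟨j, hj⟩ : Fin n) else 0
        else 0
    | _, _, _ => 0
  cpx
    | 0, _, _, _ => t
    | 1, _, _, _ => ε
    | 2, i, _, _ => if hi : i < H.numTerms then (H.coeff ⟨i, hi⟩ : ℂ) else 0
    | 3, i, a, b =>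
        if hi : i < H.numTerms then
          if hab : a < d ^ (H.subsystem ⟨i, hi⟩).card ∧ b < d ^ (H.subsystem ⟨i, hi⟩).card then
            H.term ⟨i, hi⟩ (localConfig _ ⟨a, hab.1⟩) (localConfig _ ⟨b, hab.2⟩) else 0
        else 0
    | 4, i, a, b =>
        if hi : i < n then
          if hab : a < d ∧ b < d then ρ.site ⟨i, hi⟩ ⟨a, hab.1⟩ ⟨b, hab.2⟩ else 0
        else 0
    | _, _, _, _ => 0

/-!
The argument has an analytic part, which bounds the error of a truncated Taylor expansion of the
logarithm, and an algorithmic part, which evaluates the truncation quickly.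

For a set `B` of terms, let `L_B z` be the Loschmidt echo of the sum of the terms in `B`, and let
`w_A z` be the Möbius coefficients: `L_B = ∑ w_A` over all `A ⊆ B`. Expanding the exponential in
words in the terms, `w_A` collects the words in which exactly the terms in `A` occur, so that
`‖w_A z‖ ≤ (exp ‖z‖ - 1) ^ |A|` (`IsClusterSeries.norm_altSum_seriesSum_le`). Since the state is a
product, `w` and `L` are multiplicative on sets of terms with no edges between them. From these two
facts alone it follows, by an induction in which the neighbors of a given term are removed or
absorbed one after the other (`norm_containing_le`, `norm_sub_erase_le`), that for
`‖z‖ < thresholdTime` adding one term to `B` changes `L_B z` by a factor at distance at most `1 / 3`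
from `1`. Hence `L_B` has no zeros in the disc, and the sum of the logarithms of these factors is a
logarithm of `L_B` bounded by `|B| / 2` (`IsClusterSeries.exists_log`). By the Cauchy estimates its
Taylor polynomial of order `M` has an error of at most `|B| / (1 - r) * r ^ M`, where
`r = ‖t‖ / thresholdTime` (`IsClusterSeries.exists_log_taylor`); the order required for the accuracy
`ε` is logarithmic in `|B| / ((1 - r) ε)`, with the constant `1 / log (1 / r)` (`pow_order_le`).

The coefficients of the logarithm are polynomials in the coefficients of `L_B` (`dlogCoeff`). As
functions of `B`, those of degree at most `M` are sums of functions of at most `M` terms at a time,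
and they are additive on sets with no edges between them. Therefore the Taylor polynomial is the sum
of its Möbius coefficients over the connected sets of at most `M` terms
(`IsClusterSeries.logTaylor_eq_sum`). Every such set is visited by a walk of length `2 M` in the
interaction graph, and a walk is described by its first term and a word over an alphabet whose size
depends on the locality and the degree only. So there are at most `|S|` times an exponential in `M`
many walks, and the program sums over those that are the least description of the set they visit
(`Setup.Canonical`, `output_eq_logTaylor`). The contribution of such a set is computed by brute
force on the spins of its terms, a space whose dimension is exponential in `M` (`Setup.weight`,
`Setup.Encodes.echoCoeff_eq`). Exponentials in `M` are polynomials in the quantity in the theorem.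

The program is assembled from the definitions of the functions it evaluates: `CompN`, `CompC` and
`CompP` say that a function of the current data can be computed in time polynomial in
`Setup.bound`, and these classes are closed under arithmetic, bounded sums and quantifiers, and the
tabulation of recursively defined sequences.
-/

/-! ### Cost-bounded execution of programs -/

/-- From the memory `s`, the program `P` halts within `c` steps in a memory satisfying `Q`. -/
def Exec (inp : Input) (P : Program) (s : Store) (c : ℕ) (Q : Store → Prop) : Prop :=
  ∃ s' T, Runs inp P s s' T ∧ T ≤ c ∧ Q s'

namespace Exec

variable {inp : Input} {P P' : Program} {s : Store} {c c' : ℕ} {Q Q' : Store → Prop}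

theorem mono (h : Exec inp P s c Q) (hc : c ≤ c') (hQ : ∀ s, Q s → Q' s) :
    Exec inp P s c' Q' := by
  obtain ⟨s', T, h1, h2, h3⟩ := h
  exact ⟨s', T, h1, h2.trans hc, hQ _ h3⟩

theorem instr (i : Instr) (h : Q (i.apply inp s)) : Exec inp (.instr i) s 1 Q :=
  ⟨_, _, .instr i s, le_rfl, h⟩

theorem seq (h : Exec inp P s c Q) (h' : ∀ s, Q s → Exec inp P' s c' Q') :
    Exec inp (.seq P P') s (c + c') Q' := by
  obtain ⟨s', T, h1, h2, h3⟩ := h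
  obtain ⟨s'', T', h1', h2', h3'⟩ := h' s' h3
  exact ⟨s'', T + T', .seq h1 h1', by omega, h3'⟩

theorem cond {b : Test} (h1 : b.Holds s → Exec inp P s c Q)
    (h2 : ¬ b.Holds s → Exec inp P' s c Q) : Exec inp (.cond b P P') s (c + 1) Q := by
  by_cases hb : b.Holds s
  · obtain ⟨s', T, h1, h2, h3⟩ := h1 hb
    exact ⟨s', T + 1, .condTrue hb h1, by omega, h3⟩
  · obtain ⟨s', T, h1, h2, h3⟩ := h2 hb
    exact ⟨s', T + 1, .condFalse hb h1, by omega, h3⟩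

/-- A loop whose test holds in exactly the first `n` rounds. -/
theorem loop {b : Test} (n c : ℕ) (Inv : ℕ → Store → Prop)
    (hbody : ∀ i < n, ∀ s, Inv i s → Exec inp P s c (Inv (i + 1)))
    (htest : ∀ i ≤ n, ∀ s, Inv i s → (b.Holds s ↔ i < n)) (hs : Inv 0 s) :
    Exec inp (.loop b P) s (n * (c + 1) + 1) (Inv n) := by
  suffices H : ∀ m i, i + m = n → ∀ s, Inv i s →
      Exec inp (.loop b P) s (m * (c + 1) + 1) (Inv n) from H n 0 (by omega) s hs
  intro m
  induction m with
  | zero =>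
    intro i hi s hs
    have hi' : i = n := by omega
    subst hi'
    exact ⟨s, 1, .loopFalse (fun h => by simpa using (htest i le_rfl s hs).1 h), by omega, hs⟩
  | succ m ih =>
    intro i hi s hs
    obtain ⟨s', T, h1, h2, h3⟩ := hbody i (by omega) s hs
    obtain ⟨s'', T', h1', h2', h3'⟩ := ih (i + 1) (by omega) s' h3
    refine ⟨s'', T + T' + 1, .loopTrue ((htest i (by omega) s hs).2 (by omega)) h1 h1', ?_, h3'⟩
    rw [Nat.succ_mul]
    omega

end Exec

/-- Two memories have the same registers and arrays with names below `b`. -/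
structure Agree (b : ℕ) (s s' : Store) : Prop where
  natReg : ∀ i < b, s'.natReg i = s.natReg i
  cpxReg : ∀ i < b, s'.cpxReg i = s.cpxReg i
  natArr : ∀ i < b, s'.natArr i = s.natArr i
  cpxArr : ∀ i < b, s'.cpxArr i = s.cpxArr i

namespace Agree

variable {b b' : ℕ} {s s' s'' : Store}

theorem refl (b : ℕ) (s : Store) : Agree b s s :=
  ⟨fun _ _ => rfl, fun _ _ => rfl, fun _ _ => rfl, fun _ _ => rfl⟩

theorem trans (h : Agree b s s') (h' : Agree b s' s'') : Agree b s s'' :=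
  ⟨fun i hi => (h'.1 i hi).trans (h.1 i hi), fun i hi => (h'.2 i hi).trans (h.2 i hi),
    fun i hi => (h'.3 i hi).trans (h.3 i hi), fun i hi => (h'.4 i hi).trans (h.4 i hi)⟩

theorem mono (h : Agree b' s s') (hb : b ≤ b') : Agree b s s' :=
  ⟨fun i hi => h.1 i (hi.trans_le hb), fun i hi => h.2 i (hi.trans_le hb),
    fun i hi => h.3 i (hi.trans_le hb), fun i hi => h.4 i (hi.trans_le hb)⟩

theorem setNat (h : Agree b s s') {x : ℕ} (hx : b ≤ x) (v : ℕ) : Agree b s (s'.setNat x v) :=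
  ⟨fun i hi => by
      simp only [Store.setNat, Function.update_apply]
      rw [if_neg (by omega), h.1 i hi], h.2, h.3, h.4⟩

theorem setCpx (h : Agree b s s') {x : ℕ} (hx : b ≤ x) (v : ℂ) : Agree b s (s'.setCpx x v) :=
  ⟨h.1, fun i hi => by
      simp only [Store.setCpx, Function.update_apply]
      rw [if_neg (by omega), h.2 i hi], h.3, h.4⟩

theorem setCpxArr (h : Agree b s s') {a : ℕ} (ha : b ≤ a) (i : ℕ) (v : ℂ) :
    Agree b s (s'.setCpxArr a i v) :=
  ⟨h.1, h.2, h.3, fun j hj => by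
      simp only [Store.setCpxArr, Function.update_apply]
      rw [if_neg (by omega), h.4 j hj]⟩

end Agree

@[simp] theorem Store.setNat_natReg (s : Store) (x v i : ℕ) :
    (s.setNat x v).natReg i = if i = x then v else s.natReg i := by
  simp [Store.setNat, Function.update_apply]

@[simp] theorem Store.setNat_cpxReg (s : Store) (x v i : ℕ) :
    (s.setNat x v).cpxReg i = s.cpxReg i := rfl

@[simp] theorem Store.setNat_natArr (s : Store) (x v i : ℕ) :
    (s.setNat x v).natArr i = s.natArr i := rfl

@[simp] theorem Store.setNat_cpxArr (s : Store) (x v i : ℕ) :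
    (s.setNat x v).cpxArr i = s.cpxArr i := rfl

@[simp] theorem Store.setCpx_natReg (s : Store) (x : ℕ) (v : ℂ) (i : ℕ) :
    (s.setCpx x v).natReg i = s.natReg i := rfl

@[simp] theorem Store.setCpx_cpxReg (s : Store) (x : ℕ) (v : ℂ) (i : ℕ) :
    (s.setCpx x v).cpxReg i = if i = x then v else s.cpxReg i := by
  simp [Store.setCpx, Function.update_apply]

@[simp] theorem Store.setCpx_natArr (s : Store) (x : ℕ) (v : ℂ) (i : ℕ) :
    (s.setCpx x v).natArr i = s.natArr i := rfl

@[simp] theorem Store.setCpx_cpxArr (s : Store) (x : ℕ) (v : ℂ) (i : ℕ) :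
    (s.setCpx x v).cpxArr i = s.cpxArr i := rfl

@[simp] theorem Store.setCpxArr_natReg (s : Store) (a i : ℕ) (v : ℂ) (j : ℕ) :
    (s.setCpxArr a i v).natReg j = s.natReg j := rfl

@[simp] theorem Store.setCpxArr_cpxArr (s : Store) (a i : ℕ) (v : ℂ) (x y : ℕ) :
    (s.setCpxArr a i v).cpxArr x y = if x = a ∧ y = i then v else s.cpxArr x y := by
  by_cases h : x = a <;> by_cases h' : y = i <;>
    simp [Store.setCpxArr, h, h']

@[simp] theorem Store.setNatArr_natReg (s : Store) (a i v j : ℕ) :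
    (s.setNatArr a i v).natReg j = s.natReg j := rfl

@[simp] theorem Store.setNatArr_cpxReg (s : Store) (a i v j : ℕ) :
    (s.setNatArr a i v).cpxReg j = s.cpxReg j := rfl

@[simp] theorem Store.setNatArr_natArr (s : Store) (a i v x y : ℕ) :
    (s.setNatArr a i v).natArr x y = if x = a ∧ y = i then v else s.natArr x y := by
  by_cases h : x = a <;> by_cases h' : y = i <;>
    simp [Store.setNatArr, h, h']

/-! ### Functions computable at polynomially bounded cost -/

/-- The data that the main part of the algorithm works on: the input, the order `order` of the
Taylor expansion, and the array `slot` listing, for every spin, the terms that contain it. -/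
structure Setup where
  inp : Input
  order : ℕ
  slot : ℕ → ℕ
  size_le : ∀ i, inp.nat 5 i 0 ≤ inp.nat 2 0 0

namespace Setup

variable (S : Setup)

/-- The number of terms. -/
def numTerms : ℕ := S.inp.nat 4 0 0

/-- The local dimension, replaced by `1` if it is `0` (then there are no spins). -/
def dim : ℕ := max (S.inp.nat 1 0 0) 1

/-- The locality. -/
def loc : ℕ := S.inp.nat 2 0 0

/-- The degree bound. -/
def deg : ℕ := S.inp.nat 3 0 0

/-- The number of letters of which the instructions for a walk on the interaction graph consist. -/
def letters : ℕ := S.loc * (S.deg + 1) + 1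

/-- The number of positions of a walk. -/
def len : ℕ := 2 * S.order + 1

/-- The number of words that describe a walk. -/
def words : ℕ := S.letters ^ (2 * S.order)

/-- The number of pairs of a position on a walk and a position inside a subsystem. -/
def slots : ℕ := S.len * S.loc

/-- The number of configurations of `slots` many spins. -/
def dimTot : ℕ := S.dim ^ S.slots

/-- The size parameter: the cost of computations is measured by polynomials in it. -/
def bound : ℕ := (S.dim + S.letters + S.loc + S.deg + 2) ^ ((S.len + 1) * (S.loc + 1))

theorem one_le_bound : 1 ≤ S.bound := Nat.one_le_pow _ _ (by omega)

end Setup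

/-- A context for computations: a type of points `Ω`, and the relation `Rep ω s` that the memory
`s` represents the point `ω` by its registers and arrays with names below `base`. -/
structure Ctx where
  Ω : Type
  setup : Ω → Setup
  base : ℕ
  Rep : Ω → Store → Prop
  base_pos : 0 < base
  rep_congr : ∀ {ω s s'}, Rep ω s → Agree base s s' → Rep ω s'
  rep_order : ∀ {ω s}, Rep ω s → s.natReg 0 = (setup ω).order
  rep_slot : ∀ {ω s}, Rep ω s → s.natArr 0 = (setup ω).slot

namespace Ctx

/-- The context extended by a variable with values in the set `P ω`, held in register `b`. -/
abbrev ext (Γ : Ctx) (b : ℕ) (hb : Γ.base ≤ b) (P : Γ.Ω → ℕ → Prop) : Ctx where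
  Ω := (ω : Γ.Ω) × {x : ℕ // P ω x}
  setup p := Γ.setup p.1
  base := b + 1
  Rep p s := Γ.Rep p.1 s ∧ s.natReg b = p.2.1
  base_pos := by omega
  rep_congr h h' := ⟨Γ.rep_congr h.1 (h'.mono (by omega)),
    (h'.natReg b (by omega)).trans h.2⟩
  rep_order h := Γ.rep_order h.1
  rep_slot h := Γ.rep_slot h.1

/-- The context in which the value `f ω` is available in register `b`. -/
abbrev withVar (Γ : Ctx) (b : ℕ) (hb : Γ.base ≤ b) (f : Γ.Ω → ℕ) : Ctx where
  Ω := Γ.Ω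
  setup := Γ.setup
  base := b + 1
  Rep ω s := Γ.Rep ω s ∧ s.natReg b = f ω
  base_pos := by omega
  rep_congr h h' := ⟨Γ.rep_congr h.1 (h'.mono (by omega)),
    (h'.natReg b (by omega)).trans h.2⟩
  rep_order h := Γ.rep_order h.1
  rep_slot h := Γ.rep_slot h.1

/-- The context in which the first `m ω` values of the sequence `A ω` are available in array
`b`. -/
abbrev withArr (Γ : Ctx) (b : ℕ) (hb : Γ.base ≤ b) (A : Γ.Ω → ℕ → ℂ) (m : Γ.Ω → ℕ) : Ctx where
  Ω := Γ.Ω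
  setup := Γ.setup
  base := b + 1
  Rep ω s := Γ.Rep ω s ∧ ∀ x < m ω, s.cpxArr b x = A ω x
  base_pos := by omega
  rep_congr h h' := ⟨Γ.rep_congr h.1 (h'.mono (by omega)),
    fun x hx => by rw [h'.cpxArr b (by omega), h.2 x hx]⟩
  rep_order h := Γ.rep_order h.1
  rep_slot h := Γ.rep_slot h.1

end Ctx

/-- The function `f` is bounded by a polynomial in the size parameter. -/
def PolyBdd (Γ : Ctx) (f : Γ.Ω → ℕ) : Prop :=
  ∃ C D, ∀ ω, f ω ≤ C * (Γ.setup ω).bound ^ D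

namespace PolyBdd

variable {Γ : Ctx} {f g : Γ.Ω → ℕ}

theorem of_le (hg : PolyBdd Γ g) (h : ∀ ω, f ω ≤ g ω) : PolyBdd Γ f := by
  obtain ⟨C, D, hC⟩ := hg
  exact ⟨C, D, fun ω => (h ω).trans (hC ω)⟩

theorem const (c : ℕ) : PolyBdd Γ (fun _ => c) := ⟨c, 0, fun _ => by simp⟩

theorem bound : PolyBdd Γ (fun ω => (Γ.setup ω).bound) := ⟨1, 1, fun _ => by simp⟩

theorem add (hf : PolyBdd Γ f) (hg : PolyBdd Γ g) : PolyBdd Γ (fun ω => f ω + g ω) := by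
  obtain ⟨C, D, hC⟩ := hf
  obtain ⟨C', D', hC'⟩ := hg
  refine ⟨C + C', D + D', fun ω => ?_⟩
  have h1 := (Γ.setup ω).one_le_bound
  calc f ω + g ω ≤ C * (Γ.setup ω).bound ^ D + C' * (Γ.setup ω).bound ^ D' :=
        add_le_add (hC ω) (hC' ω)
    _ ≤ C * (Γ.setup ω).bound ^ (D + D') + C' * (Γ.setup ω).bound ^ (D + D') := by
        gcongr <;> omega
    _ = _ := by ring

theorem mul (hf : PolyBdd Γ f) (hg : PolyBdd Γ g) : PolyBdd Γ (fun ω => f ω * g ω) := by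
  obtain ⟨C, D, hC⟩ := hf
  obtain ⟨C', D', hC'⟩ := hg
  refine ⟨C * C', D + D', fun ω => ?_⟩
  calc f ω * g ω ≤ (C * (Γ.setup ω).bound ^ D) * (C' * (Γ.setup ω).bound ^ D') :=
        Nat.mul_le_mul (hC ω) (hC' ω)
    _ = _ := by ring

theorem up (hf : PolyBdd Γ f) {b hb P} : PolyBdd (Γ.ext b hb P) (fun p => f p.1) := by
  obtain ⟨C, D, hC⟩ := hf
  exact ⟨C, D, fun p => hC p.1⟩

theorem upVar (hf : PolyBdd Γ f) {b hb v} : PolyBdd (Γ.withVar b hb v) f := hf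

theorem upArr (hf : PolyBdd Γ f) {b hb A m} : PolyBdd (Γ.withArr b hb A m) f := hf

theorem last (hf : PolyBdd Γ f) {b hb} :
    PolyBdd (Γ.ext b hb (fun ω x => x < f ω)) (fun p => p.2.1) :=
  hf.up.of_le fun p => p.2.2.le

end PolyBdd

/-- The natural number `f ω` can be computed from any memory representing `ω`, at a polynomially
bounded cost, with the result in register `b` and with the names below `b` left alone. The
program may depend on `b`, which is arbitrary. -/
def CompN (Γ : Ctx) (f : Γ.Ω → ℕ) : Prop :=
  ∀ b ≥ Γ.base, ∃ (P : Program) (c : Γ.Ω → ℕ), PolyBdd Γ c ∧ ∀ ω s, Γ.Rep ω s →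
    Exec (Γ.setup ω).inp P s (c ω) (fun s' => Agree b s s' ∧ s'.natReg b = f ω)

/-- The analogue of `CompN` for complex numbers. -/
def CompC (Γ : Ctx) (f : Γ.Ω → ℂ) : Prop :=
  ∀ b ≥ Γ.base, ∃ (P : Program) (c : Γ.Ω → ℕ), PolyBdd Γ c ∧ ∀ ω s, Γ.Rep ω s →
    Exec (Γ.setup ω).inp P s (c ω) (fun s' => Agree b s s' ∧ s'.cpxReg b = f ω)

open Classical in
/-- The predicate `p` can be decided: its indicator function is computable. -/
def CompP (Γ : Ctx) (p : Γ.Ω → Prop) : Prop :=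
  CompN Γ (fun ω => if p ω then 1 else 0)

/-- The first `m ω` values of the sequence `A ω` are available in some array. -/
def HasArr (Γ : Ctx) (A : Γ.Ω → ℕ → ℂ) (m : Γ.Ω → ℕ) : Prop :=
  ∃ a < Γ.base, ∀ ω s, Γ.Rep ω s → ∀ x < m ω, s.cpxArr a x = A ω x

section Rules

variable {Γ : Ctx}

theorem CompN.congr {f g : Γ.Ω → ℕ} (hf : CompN Γ f) (h : ∀ ω, f ω = g ω) : CompN Γ g := by
  rwa [← funext h]

theorem CompC.congr {f g : Γ.Ω → ℂ} (hf : CompC Γ f) (h : ∀ ω, f ω = g ω) : CompC Γ g := by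
  rwa [← funext h]

theorem CompP.congr {p q : Γ.Ω → Prop} (hf : CompP Γ p) (h : ∀ ω, p ω ↔ q ω) : CompP Γ q := by
  rwa [← funext fun ω => propext (h ω)]

theorem CompN.up {f : Γ.Ω → ℕ} (hf : CompN Γ f) {b hb P} :
    CompN (Γ.ext b hb P) (fun p => f p.1) := by
  intro b' hb'
  obtain ⟨Q, c, hc, h⟩ := hf b' (by simp at hb'; omega)
  exact ⟨Q, _, hc.up, fun p s hs => h p.1 s hs.1⟩

theorem CompC.up {f : Γ.Ω → ℂ} (hf : CompC Γ f) {b hb P} :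
    CompC (Γ.ext b hb P) (fun p => f p.1) := by
  intro b' hb'
  obtain ⟨Q, c, hc, h⟩ := hf b' (by simp at hb'; omega)
  exact ⟨Q, _, hc.up, fun p s hs => h p.1 s hs.1⟩

theorem CompN.upVar {f : Γ.Ω → ℕ} (hf : CompN Γ f) {b hb g} : CompN (Γ.withVar b hb g) f := by
  intro b' hb'
  obtain ⟨Q, c, hc, h⟩ := hf b' (by simp at hb'; omega)
  exact ⟨Q, c, hc, fun p s hs => h p s hs.1⟩

theorem CompN.upArr {f : Γ.Ω → ℕ} (hf : CompN Γ f) {b hb A m} :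
    CompN (Γ.withArr b hb A m) f := by
  intro b' hb'
  obtain ⟨Q, c, hc, h⟩ := hf b' (by simp at hb'; omega)
  exact ⟨Q, c, hc, fun p s hs => h p s hs.1⟩

/-- A value held in a register with a name below the base can be copied. -/
theorem CompN.of_reg {f : Γ.Ω → ℕ} (r : ℕ) (hr : r < Γ.base)
    (h : ∀ ω s, Γ.Rep ω s → s.natReg r = f ω) : CompN Γ f := by
  intro b hb
  refine ⟨.seq (.instr (.natConst b 0)) (.instr (.natAdd b r b)), fun _ => 2, .const 2, ?_⟩
  intro ω s hs
  refine Exec.seq (c := 1) (c' := 1) (Exec.instr (Q := fun s' => s' = s.setNat b 0) _ rfl) ?_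
  rintro _ rfl
  refine Exec.instr _ ⟨((Agree.refl b s).setNat le_rfl _).setNat le_rfl _, ?_⟩
  have : r ≠ b := by omega
  simp [Instr.apply, this, h ω s hs]

theorem CompN.last {b hb P} : CompN (Γ.ext b hb P) (fun p => p.2.1) :=
  .of_reg b (by simp) fun _ _ hs => hs.2

theorem CompN.var {b hb f} : CompN (Γ.withVar b hb f) f :=
  .of_reg b (by simp) fun _ _ hs => hs.2

theorem CompN.order : CompN Γ (fun ω => (Γ.setup ω).order) :=
  .of_reg 0 Γ.base_pos fun _ _ hs => Γ.rep_order hs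

theorem CompN.const (n : ℕ) : CompN Γ (fun _ => n) := by
  intro b hb
  refine ⟨.instr (.natConst b n), fun _ => 1, .const 1, fun ω s hs => Exec.instr _ ⟨?_, ?_⟩⟩
  · exact (Agree.refl b s).setNat le_rfl _
  · simp [Instr.apply]

theorem CompC.I : CompC Γ (fun _ => Complex.I) := by
  intro b hb
  refine ⟨.instr (.cpxI b), fun _ => 1, .const 1, fun ω s hs => Exec.instr _ ⟨?_, ?_⟩⟩
  · exact (Agree.refl b s).setCpx le_rfl _
  · simp [Instr.apply]

/-- Running two computations one after the other, with adjacent result registers. -/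
theorem CompN.exec_two {f g : Γ.Ω → ℕ} (hf : CompN Γ f) (hg : CompN Γ g) {b : ℕ}
    (hb : Γ.base ≤ b) : ∃ (P : Program) (c : Γ.Ω → ℕ), PolyBdd Γ c ∧ ∀ ω s, Γ.Rep ω s →
    Exec (Γ.setup ω).inp P s (c ω)
      (fun s' => Agree b s s' ∧ s'.natReg b = f ω ∧ s'.natReg (b + 1) = g ω) := by
  obtain ⟨P, c, hc, h⟩ := hf b hb
  obtain ⟨P', c', hc', h'⟩ := hg (b + 1) (by omega)
  refine ⟨.seq P P', _, hc.add hc', fun ω s hs => (h ω s hs).seq ?_⟩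
  rintro s1 ⟨h1, h2⟩
  refine (h' ω s1 (Γ.rep_congr hs (h1.mono hb))).mono le_rfl ?_
  rintro s2 ⟨h3, h4⟩
  exact ⟨h1.trans (h3.mono (by omega)), by rw [h3.natReg b (by omega), h2], h4⟩

theorem CompN.binop {f g : Γ.Ω → ℕ} (hf : CompN Γ f) (hg : CompN Γ g) (op : ℕ → ℕ → ℕ)
    (i : ℕ → Instr) (hi : ∀ b inp s, (i b).apply inp s =
      s.setNat b (op (s.natReg b) (s.natReg (b + 1)))) :
    CompN Γ (fun ω => op (f ω) (g ω)) := by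
  intro b hb
  obtain ⟨P, c, hc, h⟩ := hf.exec_two hg hb
  refine ⟨.seq P (.instr (i b)), _, hc.add (.const 1), fun ω s hs => (h ω s hs).seq ?_⟩
  rintro s1 ⟨h1, h2, h3⟩
  refine Exec.instr _ ?_
  rw [hi, h2, h3]
  exact ⟨h1.setNat le_rfl _, by simp⟩

theorem CompN.add {f g : Γ.Ω → ℕ} (hf : CompN Γ f) (hg : CompN Γ g) :
    CompN Γ (fun ω => f ω + g ω) :=
  hf.binop hg _ (fun b => .natAdd b b (b + 1)) fun _ _ _ => rfl

theorem CompN.sub {f g : Γ.Ω → ℕ} (hf : CompN Γ f) (hg : CompN Γ g) :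
    CompN Γ (fun ω => f ω - g ω) :=
  hf.binop hg _ (fun b => .natSub b b (b + 1)) fun _ _ _ => rfl

theorem CompN.input (a : ℕ) {f g : Γ.Ω → ℕ} (hf : CompN Γ f) (hg : CompN Γ g) :
    CompN Γ (fun ω => (Γ.setup ω).inp.nat a (f ω) (g ω)) := by
  intro b hb
  obtain ⟨P, c, hc, h⟩ := hf.exec_two hg hb
  refine ⟨.seq P (.instr (.natInput b a b (b + 1))), _, hc.add (.const 1),
    fun ω s hs => (h ω s hs).seq ?_⟩
  rintro s1 ⟨h1, h2, h3⟩
  refine Exec.instr _ ⟨h1.setNat le_rfl _, ?_⟩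
  simp [Instr.apply, h2, h3]

theorem CompN.slot {f : Γ.Ω → ℕ} (hf : CompN Γ f) :
    CompN Γ (fun ω => (Γ.setup ω).slot (f ω)) := by
  intro b hb
  obtain ⟨P, c, hc, h⟩ := hf b hb
  refine ⟨.seq P (.instr (.natLoad b 0 b)), _, hc.add (.const 1),
    fun ω s hs => (h ω s hs).seq ?_⟩
  rintro s1 ⟨h1, h2⟩
  refine Exec.instr _ ⟨h1.setNat le_rfl _, ?_⟩
  simp [Instr.apply, h2, h1.natArr 0 (Γ.base_pos.trans_le hb), Γ.rep_slot hs]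

theorem CompC.ofNat {f : Γ.Ω → ℕ} (hf : CompN Γ f) : CompC Γ (fun ω => (f ω : ℂ)) := by
  intro b hb
  obtain ⟨P, c, hc, h⟩ := hf b hb
  refine ⟨.seq P (.instr (.cpxOfNat b b)), _, hc.add (.const 1),
    fun ω s hs => (h ω s hs).seq ?_⟩
  rintro s1 ⟨h1, h2⟩
  refine Exec.instr _ ⟨h1.setCpx le_rfl _, ?_⟩
  simp [Instr.apply, h2]

theorem CompC.input (a : ℕ) {f g k : Γ.Ω → ℕ} (hf : CompN Γ f) (hg : CompN Γ g)
    (hk : CompN Γ k) : CompC Γ (fun ω => (Γ.setup ω).inp.cpx a (f ω) (g ω) (k ω)) := by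
  intro b hb
  obtain ⟨P, c, hc, h⟩ := hf.exec_two hg hb
  obtain ⟨P', c', hc', h'⟩ := hk (b + 2) (by omega)
  refine ⟨.seq P (.seq P' (.instr (.cpxInput b a b (b + 1) (b + 2)))), _,
    hc.add (hc'.add (.const 1)), fun ω s hs => (h ω s hs).seq ?_⟩
  rintro s1 ⟨h1, h2, h3⟩
  refine (h' ω s1 (Γ.rep_congr hs (h1.mono hb))).seq ?_
  rintro s2 ⟨h4, h5⟩
  refine Exec.instr _ ⟨(h1.trans (h4.mono (by omega))).setCpx le_rfl _, ?_⟩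
  simp [Instr.apply, h4.natReg b (by omega), h4.natReg (b + 1) (by omega), h2, h3, h5]

theorem CompC.binop {f g : Γ.Ω → ℂ} (hf : CompC Γ f) (hg : CompC Γ g) (op : ℂ → ℂ → ℂ)
    (i : ℕ → Instr) (hi : ∀ b inp s, (i b).apply inp s =
      s.setCpx b (op (s.cpxReg b) (s.cpxReg (b + 1)))) :
    CompC Γ (fun ω => op (f ω) (g ω)) := by
  intro b hb
  obtain ⟨P, c, hc, h⟩ := hf b hb
  obtain ⟨P', c', hc', h'⟩ := hg (b + 1) (by omega)
  refine ⟨.seq P (.seq P' (.instr (i b))), _, hc.add (hc'.add (.const 1)),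
    fun ω s hs => (h ω s hs).seq ?_⟩
  rintro s1 ⟨h1, h2⟩
  refine (h' ω s1 (Γ.rep_congr hs (h1.mono hb))).seq ?_
  rintro s2 ⟨h3, h4⟩
  refine Exec.instr _ ?_
  rw [hi, h4, h3.cpxReg b (by omega), h2]
  exact ⟨(h1.trans (h3.mono (by omega))).setCpx le_rfl _, by simp⟩

theorem CompC.add {f g : Γ.Ω → ℂ} (hf : CompC Γ f) (hg : CompC Γ g) :
    CompC Γ (fun ω => f ω + g ω) :=
  hf.binop hg _ (fun b => .cpxAdd b b (b + 1)) fun _ _ _ => rfl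

theorem CompC.sub {f g : Γ.Ω → ℂ} (hf : CompC Γ f) (hg : CompC Γ g) :
    CompC Γ (fun ω => f ω - g ω) :=
  hf.binop hg _ (fun b => .cpxSub b b (b + 1)) fun _ _ _ => rfl

theorem CompC.mul {f g : Γ.Ω → ℂ} (hf : CompC Γ f) (hg : CompC Γ g) :
    CompC Γ (fun ω => f ω * g ω) :=
  hf.binop hg _ (fun b => .cpxMul b b (b + 1)) fun _ _ _ => rfl

theorem CompC.div {f g : Γ.Ω → ℂ} (hf : CompC Γ f) (hg : CompC Γ g) :
    CompC Γ (fun ω => f ω / g ω) :=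
  hf.binop hg _ (fun b => .cpxDiv b b (b + 1)) fun _ _ _ => rfl

/-- The common form of conditional programs. -/
theorem CompP.exec_cond {p : Γ.Ω → Prop} (hp : CompP Γ p) {b : ℕ} (hb : Γ.base ≤ b)
    {P P' : Program} {c c' : Γ.Ω → ℕ} (hc : PolyBdd Γ c) (hc' : PolyBdd Γ c')
    {Q : Γ.Ω → Store → Prop}
    (h : ∀ ω s, Γ.Rep ω s → p ω →
      Exec (Γ.setup ω).inp P s (c ω) (fun s' => Agree b s s' ∧ Q ω s'))
    (h' : ∀ ω s, Γ.Rep ω s → ¬ p ω →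
      Exec (Γ.setup ω).inp P' s (c' ω) (fun s' => Agree b s s' ∧ Q ω s')) :
    ∃ (R : Program) (e : Γ.Ω → ℕ), PolyBdd Γ e ∧ ∀ ω s, Γ.Rep ω s →
      Exec (Γ.setup ω).inp R s (e ω) (fun s' => Agree b s s' ∧ Q ω s') := by
  classical
  obtain ⟨R, e, he, hR⟩ := hp.exec_two (CompN.const 0) hb
  refine ⟨.seq R (.cond (.natLt (b + 1) b) P P'), _, he.add ((hc.add hc').add (.const 1)),
    fun ω s hs => (hR ω s hs).seq ?_⟩
  rintro s1 ⟨h1, h2, h3⟩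
  have hs1 := Γ.rep_congr hs (h1.mono hb)
  refine Exec.cond (fun ht => ?_) (fun ht => ?_)
  · simp only [Test.Holds, h2, h3] at ht
    have hpω : p ω := by by_contra hn; simp [hn] at ht
    exact (h ω s1 hs1 hpω).mono (by omega) fun s' hs' => ⟨h1.trans hs'.1, hs'.2⟩
  · simp only [Test.Holds, h2, h3] at ht
    have hpω : ¬ p ω := by intro hn; simp [hn] at ht
    exact (h' ω s1 hs1 hpω).mono (by omega) fun s' hs' => ⟨h1.trans hs'.1, hs'.2⟩

theorem CompN.ite {p : Γ.Ω → Prop} [∀ ω, Decidable (p ω)] {f g : Γ.Ω → ℕ} (hp : CompP Γ p)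
    (hf : CompN Γ f) (hg : CompN Γ g) : CompN Γ (fun ω => if p ω then f ω else g ω) := by
  intro b hb
  obtain ⟨P, c, hc, h⟩ := hf b hb
  obtain ⟨P', c', hc', h'⟩ := hg b hb
  refine hp.exec_cond hb hc hc' (Q := fun ω s' => s'.natReg b = if p ω then f ω else g ω)
    (P := P) (P' := P') ?_ ?_
  · intro ω s hs hω
    simpa only [if_pos hω] using h ω s hs
  · intro ω s hs hω
    simpa only [if_neg hω] using h' ω s hs

theorem CompC.ite {p : Γ.Ω → Prop} [∀ ω, Decidable (p ω)] {f g : Γ.Ω → ℂ} (hp : CompP Γ p)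
    (hf : CompC Γ f) (hg : CompC Γ g) : CompC Γ (fun ω => if p ω then f ω else g ω) := by
  intro b hb
  obtain ⟨P, c, hc, h⟩ := hf b hb
  obtain ⟨P', c', hc', h'⟩ := hg b hb
  refine hp.exec_cond hb hc hc' (Q := fun ω s' => s'.cpxReg b = if p ω then f ω else g ω)
    (P := P) (P' := P') ?_ ?_
  · intro ω s hs hω
    simpa only [if_pos hω] using h ω s hs
  · intro ω s hs hω
    simpa only [if_neg hω] using h' ω s hs

theorem CompP.lt {f g : Γ.Ω → ℕ} (hf : CompN Γ f) (hg : CompN Γ g) :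
    CompP Γ (fun ω => f ω < g ω) := by
  intro b hb
  obtain ⟨P, c, hc, h⟩ := hf.exec_two hg hb
  refine ⟨.seq P (.cond (.natLt b (b + 1)) (.instr (.natConst b 1)) (.instr (.natConst b 0))), _,
    hc.add (.const 2), fun ω s hs => (h ω s hs).seq ?_⟩
  rintro s1 ⟨h1, h2, h3⟩
  refine Exec.cond (c := 1) (fun ht => ?_) (fun ht => ?_)
  · simp only [Test.Holds, h2, h3] at ht
    exact Exec.instr _ ⟨h1.setNat le_rfl _, by simp [Instr.apply, ht]⟩
  · simp only [Test.Holds, h2, h3] at ht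
    exact Exec.instr _ ⟨h1.setNat le_rfl _, by simp [Instr.apply, ht]⟩

theorem CompP.and {p q : Γ.Ω → Prop} (hp : CompP Γ p) (hq : CompP Γ q) :
    CompP Γ (fun ω => p ω ∧ q ω) := by
  classical
  refine CompN.congr (CompN.ite hp hq (CompN.const 0)) fun ω => ?_
  by_cases h : p ω <;> simp [h]

theorem CompP.not {p : Γ.Ω → Prop} (hp : CompP Γ p) : CompP Γ (fun ω => ¬ p ω) := by
  classical
  refine CompN.congr (CompN.ite hp (CompN.const 0) (CompN.const 1)) fun ω => ?_
  by_cases h : p ω <;> simp [h]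

theorem CompP.imp {p q : Γ.Ω → Prop} (hp : CompP Γ p) (hq : CompP Γ q) :
    CompP Γ (fun ω => p ω → q ω) :=
  (hp.and hq.not).not.congr fun ω => by tauto

theorem CompP.le {f g : Γ.Ω → ℕ} (hf : CompN Γ f) (hg : CompN Γ g) :
    CompP Γ (fun ω => f ω ≤ g ω) :=
  (CompP.lt hg hf).not.congr fun ω => by simp

theorem CompP.eq {f g : Γ.Ω → ℕ} (hf : CompN Γ f) (hg : CompN Γ g) :
    CompP Γ (fun ω => f ω = g ω) :=
  ((CompP.le hf hg).and (CompP.le hg hf)).congr fun ω => by omega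

theorem CompP.indicator {p : Γ.Ω → Prop} [∀ ω, Decidable (p ω)] (hp : CompP Γ p) :
    CompN Γ (fun ω => if p ω then 1 else 0) :=
  CompN.ite hp (CompN.const 1) (CompN.const 0)

/-- Primitive recursion: the value after `n ω` steps of the recursion `R`. -/
theorem CompN.iterate (R : Γ.Ω → ℕ → ℕ) {n : Γ.Ω → ℕ} (hn : CompN Γ n) (hn' : PolyBdd Γ n)
    (h0 : CompN Γ (fun ω => R ω 0))
    (hstep : ∀ b hb b' hb', CompN ((Γ.ext b hb (fun ω x => x < n ω)).withVar b' hb'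
      (fun p => R p.1 p.2.1)) (fun p => R p.1 (p.2.1 + 1))) :
    CompN Γ (fun ω => R ω (n ω)) := by
  intro b hb
  obtain ⟨Pn, cn, hcn, hPn⟩ := hn.exec_two (CompN.const 0) hb
  obtain ⟨P0, c0, hc0, hP0⟩ := h0 (b + 2) (by omega)
  obtain ⟨P, c, ⟨C, D, hc⟩, hP⟩ := hstep (b + 1) (by omega) (b + 2) (by simp) (b + 3) (by simp)
  have hcost : PolyBdd Γ (fun ω => C * (Γ.setup ω).bound ^ D) := ⟨C, D, fun _ => le_rfl⟩
  refine ⟨.seq Pn (.seq P0 (.seq (.loop (.natLt (b + 1) b)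
    (.seq P (.seq (.instr (.natConst (b + 4) 0)) (.seq (.instr (.natAdd (b + 2) (b + 3) (b + 4)))
      (.seq (.instr (.natConst (b + 4) 1)) (.instr (.natAdd (b + 1) (b + 1) (b + 4))))))))
    (.seq (.instr (.natConst (b + 3) 0)) (.instr (.natAdd b (b + 2) (b + 3)))))), _,
    hcn.add (hc0.add (((hn'.mul ((hcost.add (.const 4)).add (.const 1))).add (.const 1)).add
      (.const 2))), fun ω s hs => (hPn ω s hs).seq ?_⟩
  rintro s1 ⟨a1, v1, v2⟩
  refine (hP0 ω s1 (Γ.rep_congr hs (a1.mono hb))).seq ?_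
  rintro s2 ⟨a2, v3⟩
  refine Exec.seq (Exec.loop (n ω) _ (fun i s' => Agree b s s' ∧ s'.natReg b = n ω ∧
    s'.natReg (b + 1) = i ∧ s'.natReg (b + 2) = R ω i) ?_ ?_ ?_) ?_
  · rintro i hi t ⟨ht, t1, t2, t3⟩
    refine Exec.seq ((hP ⟨ω, i, hi⟩ t ⟨⟨Γ.rep_congr hs (ht.mono hb), t2⟩, t3⟩).mono
      (hc _) (fun _ h => h)) ?_
    rintro t' ⟨ht', t4⟩
    refine Exec.seq (c := 1) (c' := 3) (Exec.instr (Q := fun x => x = _) _ rfl) ?_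
    rintro _ rfl
    refine Exec.seq (c := 1) (c' := 2) (Exec.instr (Q := fun x => x = _) _ rfl) ?_
    rintro _ rfl
    refine Exec.seq (c := 1) (c' := 1) (Exec.instr (Q := fun x => x = _) _ rfl) ?_
    rintro _ rfl
    refine Exec.instr _ ⟨?_, ?_, ?_, ?_⟩
    · exact ((((ht.trans (ht'.mono (by omega))).setNat (by omega) _).setNat (by omega) _).setNat
        (by omega) _).setNat (by omega) _
    · simp [Instr.apply, ht'.natReg b (by omega), t1]
    · simp [Instr.apply, ht'.natReg (b + 1) (by omega), t2]
    · simp [Instr.apply, t4]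
  · rintro i hi t ⟨ht, t1, t2, t3⟩
    simp [Test.Holds, t1, t2]
  · exact ⟨a1.trans (a2.mono (by omega)), by rw [a2.natReg b (by omega), v1],
      by rw [a2.natReg (b + 1) (by omega), v2], v3⟩
  · rintro t ⟨ht, t1, t2, t3⟩
    refine Exec.seq (c := 1) (c' := 1) (Exec.instr (Q := fun x => x = _) _ rfl) ?_
    rintro _ rfl
    refine Exec.instr _ ⟨(ht.setNat (by omega) _).setNat le_rfl _, ?_⟩
    simp [Instr.apply, t3]

theorem CompN.sum {g : Γ.Ω → ℕ} {F : Γ.Ω → ℕ → ℕ} (hg : CompN Γ g) (hg' : PolyBdd Γ g)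
    (hF : ∀ b hb, CompN (Γ.ext b hb (fun ω x => x < g ω)) (fun p => F p.1 p.2.1)) :
    CompN Γ (fun ω => ∑ x ∈ Finset.range (g ω), F ω x) := by
  refine CompN.iterate (fun ω i => ∑ x ∈ Finset.range i, F ω x) hg hg'
    ((CompN.const 0).congr fun ω => by simp) fun b hb b' hb' => ?_
  exact (CompN.var.add (hF b hb).upVar).congr fun p => (Finset.sum_range_succ _ _).symm

/-- Bounded quantification. -/
theorem CompP.ball {g : Γ.Ω → ℕ} {q : Γ.Ω → ℕ → Prop} (hg : CompN Γ g) (hg' : PolyBdd Γ g)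
    (hq : ∀ b hb, CompP (Γ.ext b hb (fun ω x => x < g ω)) (fun p => q p.1 p.2.1)) :
    CompP Γ (fun ω => ∀ x < g ω, q ω x) := by
  classical
  refine ((CompP.lt (CompN.const 0) (CompN.sum hg hg'
    (F := fun ω x => if ¬ q ω x then 1 else 0) fun b hb => (hq b hb).not.indicator)).not).congr
      fun ω => ?_
  simp

theorem CompP.bex {g : Γ.Ω → ℕ} {q : Γ.Ω → ℕ → Prop} (hg : CompN Γ g) (hg' : PolyBdd Γ g)
    (hq : ∀ b hb, CompP (Γ.ext b hb (fun ω x => x < g ω)) (fun p => q p.1 p.2.1)) :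
    CompP Γ (fun ω => ∃ x < g ω, q ω x) :=
  (CompP.ball hg hg' (q := fun ω x => ¬ q ω x) fun b hb => (hq b hb).not).not.congr fun ω => by simp

theorem CompN.mul {f g : Γ.Ω → ℕ} (hf : CompN Γ f) (hf' : PolyBdd Γ f) (hg : CompN Γ g) :
    CompN Γ (fun ω => f ω * g ω) :=
  (CompN.sum hf hf' (F := fun ω _ => g ω) fun _ _ => hg.up).congr fun ω => by simp

theorem CompN.pow {f g : Γ.Ω → ℕ} (hf : CompN Γ f) (hf' : PolyBdd Γ f) (hg : CompN Γ g)
    (hg' : PolyBdd Γ g) : CompN Γ (fun ω => f ω ^ g ω) := by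
  refine CompN.iterate (fun ω i => f ω ^ i) hg hg' ((CompN.const 1).congr fun ω => by simp)
    fun b hb b' hb' => ?_
  exact (CompN.mul hf.up.upVar hf'.up.upVar CompN.var).congr fun p => (pow_succ' _ _).symm

theorem CompN.div {f g : Γ.Ω → ℕ} (hf : CompN Γ f) (hf' : PolyBdd Γ f) (hg : CompN Γ g) :
    CompN Γ (fun ω => f ω / g ω) := by
  classical
  refine (CompN.sum hf hf' (F := fun ω x => if 0 < g ω ∧ (x + 1) * g ω ≤ f ω then 1 else 0)
    fun b hb => ((CompP.lt (CompN.const 0) hg.up).and (CompP.le (CompN.mul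
      (CompN.last.add (CompN.const 1)) (hf'.last.add (.const 1)) hg.up) hf.up)).indicator).congr
        fun ω => ?_
  rcases Nat.eq_zero_or_pos (g ω) with h | h
  · simp [h]
  · rw [← Finset.card_filter]
    have : (Finset.range (f ω)).filter (fun x => 0 < g ω ∧ (x + 1) * g ω ≤ f ω) =
        Finset.range (f ω / g ω) := by
      ext x
      simp only [Finset.mem_filter, Finset.mem_range, h, true_and, ← Nat.le_div_iff_mul_le h]
      have := Nat.div_le_self (f ω) (g ω)
      omega
    rw [this, Finset.card_range]

theorem CompN.mod {f g : Γ.Ω → ℕ} (hf : CompN Γ f) (hf' : PolyBdd Γ f) (hg : CompN Γ g) :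
    CompN Γ (fun ω => f ω % g ω) := by
  refine (hf.sub (CompN.mul (CompN.div hf hf' hg)
    (hf'.of_le fun ω => Nat.div_le_self _ _) hg)).congr fun ω => ?_
  have := Nat.div_add_mod' (f ω) (g ω)
  omega

/-- A fold with a binary operation over `x < g ω`, where the number of rounds `g ω` is accounted
for separately: the cost is `g ω + 1` times a polynomially bounded quantity. -/
theorem CompC.exec_fold {g : Γ.Ω → ℕ} {F : Γ.Ω → ℕ → ℂ} (hg : CompN Γ g)
    (hF : ∀ b hb, CompC (Γ.ext b hb (fun ω x => x < g ω)) (fun p => F p.1 p.2.1))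
    (op : ℂ → ℂ → ℂ) (i : ℕ → ℕ → Instr) (hi : ∀ b b' inp s, (i b b').apply inp s =
      s.setCpx b (op (s.cpxReg b) (s.cpxReg b'))) (z : ℕ) (R : Γ.Ω → ℕ → ℂ)
    (hR0 : ∀ ω, R ω 0 = z) (hR : ∀ ω x, x < g ω → R ω (x + 1) = op (R ω x) (F ω x)) (b : ℕ)
    (hb : Γ.base ≤ b) :
    ∃ (P : Program) (c : Γ.Ω → ℕ), PolyBdd Γ c ∧ ∀ ω s, Γ.Rep ω s →
      Exec (Γ.setup ω).inp P s ((g ω + 1) * c ω)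
        (fun s' => Agree b s s' ∧ s'.cpxReg b = R ω (g ω)) := by
  obtain ⟨Pn, cn, hcn, hPn⟩ := hg.exec_two (CompN.const z) hb
  obtain ⟨P, c, ⟨C, D, hc⟩, hP⟩ := hF (b + 1) (by omega) (b + 2) (by simp)
  have hcost : PolyBdd Γ (fun ω => C * (Γ.setup ω).bound ^ D) := ⟨C, D, fun _ => le_rfl⟩
  refine ⟨.seq Pn (.seq (.instr (.cpxOfNat b (b + 1))) (.seq (.instr (.natConst (b + 1) 0))
    (.loop (.natLt (b + 1) b)
    (.seq P (.seq (.instr (i b (b + 2)))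
      (.seq (.instr (.natConst (b + 2) 1)) (.instr (.natAdd (b + 1) (b + 1) (b + 2)))))))))
      , _, (hcn.add (hcost.add (.const 7))), fun ω s hs => ?_⟩
  refine Exec.mono (c := cn ω + (1 + (1 + (g ω * (C * (Γ.setup ω).bound ^ D + 3 + 1) + 1))))
    (Q := fun s' => Agree b s s' ∧ s'.cpxReg b = R ω (g ω)) ((hPn ω s hs).seq ?_)
    (by generalize C * (Γ.setup ω).bound ^ D = X; nlinarith [Nat.zero_le (g ω * cn ω)])
    (fun _ h => h)
  rintro s1 ⟨a1, v1, v2⟩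
  refine Exec.seq (Exec.instr (Q := fun x => x = _) _ rfl) ?_
  rintro _ rfl
  refine Exec.seq (Exec.instr (Q := fun x => x = _) _ rfl) ?_
  rintro _ rfl
  refine (Exec.loop (g ω) _ (fun i s' => Agree b s s' ∧ s'.natReg b = g ω ∧
    s'.natReg (b + 1) = i ∧ s'.cpxReg b = R ω i) ?_ ?_ ?_).mono le_rfl ?_
  · rintro x hx t ⟨ht, t1, t2, t3⟩
    refine Exec.seq (c' := 3) ((hP ⟨ω, x, hx⟩ t ⟨Γ.rep_congr hs (ht.mono hb), t2⟩).mono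
      (hc _) (fun _ h => h)) ?_
    rintro t' ⟨ht', t4⟩
    refine Exec.seq (c := 1) (c' := 2) (Exec.instr (Q := fun x => x = _) _ rfl) ?_
    rintro _ rfl
    refine Exec.seq (c := 1) (c' := 1) (Exec.instr (Q := fun x => x = _) _ rfl) ?_
    rintro _ rfl
    refine Exec.instr _ ?_
    rw [hi]
    refine ⟨?_, ?_, ?_, ?_⟩
    · exact (((ht.trans (ht'.mono (by omega))).setCpx le_rfl _).setNat (by omega) _).setNat
        (by omega) _
    · simp [Instr.apply, ht'.natReg b (by omega), t1]
    · simp [Instr.apply, ht'.natReg (b + 1) (by omega), t2]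
    · simp [Instr.apply, t4, ht'.cpxReg b (by omega), t3, hR ω x hx]
  · rintro x hx t ⟨ht, t1, t2, t3⟩
    simp [Test.Holds, t1, t2]
  · refine ⟨(a1.setCpx le_rfl _).setNat (by omega) _, ?_, ?_, ?_⟩
    · simp [Instr.apply, v1]
    · simp [Instr.apply]
    · simp [Instr.apply, hR0, v2]
  · rintro t ⟨ht, t1, t2, t3⟩
    exact ⟨ht, t3⟩

theorem CompC.sum {g : Γ.Ω → ℕ} {F : Γ.Ω → ℕ → ℂ} (hg : CompN Γ g) (hg' : PolyBdd Γ g)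
    (hF : ∀ b hb, CompC (Γ.ext b hb (fun ω x => x < g ω)) (fun p => F p.1 p.2.1)) :
    CompC Γ (fun ω => ∑ x ∈ Finset.range (g ω), F ω x) := by
  intro b hb
  obtain ⟨P, c, hc, h⟩ := CompC.exec_fold hg hF (· + ·) (fun b b' => .cpxAdd b b b')
    (fun _ _ _ _ => rfl) 0 (fun ω i => ∑ x ∈ Finset.range i, F ω x) (by simp)
    (fun ω x _ => Finset.sum_range_succ _ _) b hb
  exact ⟨P, _, (hg'.add (.const 1)).mul hc, h⟩

theorem CompC.prod {g : Γ.Ω → ℕ} {F : Γ.Ω → ℕ → ℂ} (hg : CompN Γ g) (hg' : PolyBdd Γ g)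
    (hF : ∀ b hb, CompC (Γ.ext b hb (fun ω x => x < g ω)) (fun p => F p.1 p.2.1)) :
    CompC Γ (fun ω => ∏ x ∈ Finset.range (g ω), F ω x) := by
  intro b hb
  obtain ⟨P, c, hc, h⟩ := CompC.exec_fold hg hF (· * ·) (fun b b' => .cpxMul b b b')
    (fun _ _ _ _ => rfl) 1 (fun ω i => ∏ x ∈ Finset.range i, F ω x) (by simp)
    (fun ω x _ => Finset.prod_range_succ _ _) b hb
  exact ⟨P, _, (hg'.add (.const 1)).mul hc, h⟩

theorem CompC.const (n : ℕ) : CompC Γ (fun _ => (n : ℂ)) := CompC.ofNat (CompN.const n)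

theorem CompC.pow {f : Γ.Ω → ℂ} {g : Γ.Ω → ℕ} (hf : CompC Γ f) (hg : CompN Γ g)
    (hg' : PolyBdd Γ g) : CompC Γ (fun ω => f ω ^ g ω) :=
  (CompC.prod hg hg' (F := fun ω _ => f ω) fun _ _ => hf.up).congr fun ω => by simp

theorem CompC.zero : CompC Γ (fun _ => 0) := (CompC.const 0).congr fun _ => Nat.cast_zero

theorem CompC.one : CompC Γ (fun _ => 1) := (CompC.const 1).congr fun _ => Nat.cast_one

theorem CompC.neg {f : Γ.Ω → ℂ} (hf : CompC Γ f) : CompC Γ (fun ω => - f ω) :=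
  (CompC.zero.sub hf).congr fun _ => zero_sub _

theorem HasArr.withArr {b hb A m} : HasArr (Γ.withArr b hb A m) A m :=
  ⟨b, Nat.lt_succ_self b, fun _ _ hs => hs.2⟩

theorem HasArr.up {A : Γ.Ω → ℕ → ℂ} {m : Γ.Ω → ℕ} (h : HasArr Γ A m) {b hb P} :
    HasArr (Γ.ext b hb P) (fun p => A p.1) (fun p => m p.1) := by
  obtain ⟨a, ha, h⟩ := h
  exact ⟨a, by simp only; omega, fun p s hs => h p.1 s hs.1⟩

theorem HasArr.upArr {A : Γ.Ω → ℕ → ℂ} {m : Γ.Ω → ℕ} (h : HasArr Γ A m) {b hb A' m'} :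
    HasArr (Γ.withArr b hb A' m') A m := by
  obtain ⟨a, ha, h⟩ := h
  exact ⟨a, by simp only; omega, fun p s hs => h p s hs.1⟩

/-- Reading an array that holds a sequence; outside of the part that is available the result is
`0`. -/
theorem CompC.arr {A : Γ.Ω → ℕ → ℂ} {m f : Γ.Ω → ℕ} (hA : HasArr Γ A m) (hf : CompN Γ f)
    (hm : CompN Γ m) : CompC Γ (fun ω => if f ω < m ω then A ω (f ω) else 0) := by
  intro b hb
  obtain ⟨a, ha, hA⟩ := hA
  obtain ⟨P, c, hc, hP⟩ := hf b hb
  obtain ⟨P', c', hc', hP'⟩ := CompC.zero (Γ := Γ) b hb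
  refine (CompP.lt hf hm).exec_cond hb (hc.add (.const 1)) hc' (P' := P')
    (P := .seq P (.instr (.cpxLoad b a b)))
    (Q := fun ω s' => s'.cpxReg b = if f ω < m ω then A ω (f ω) else 0) ?_ ?_
  · intro ω s hs hω
    refine (hP ω s hs).seq ?_
    rintro s1 ⟨h1, h2⟩
    refine Exec.instr _ ⟨h1.setCpx le_rfl _, ?_⟩
    simp [Instr.apply, h2, h1.cpxArr a (by omega), hA ω s hs _ hω, hω]
  · intro ω s hs hω
    simpa only [if_neg hω] using hP' ω s hs

/-- Course-of-values recursion with an array: if every value of the sequence `A ω` can be computed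
from the earlier ones, then a computation may use the first `n ω` values. -/
theorem CompC.memo (A : Γ.Ω → ℕ → ℂ) {n : Γ.Ω → ℕ} {f : Γ.Ω → ℂ} (hn : CompN Γ n)
    (hn' : PolyBdd Γ n)
    (hA : ∀ b hb b' hb', CompC ((Γ.ext b hb (fun ω x => x < n ω)).withArr b' hb'
      (fun p => A p.1) (fun p => p.2.1)) (fun p => A p.1 p.2.1))
    (hf : ∀ b hb, CompC (Γ.withArr b hb A n) f) : CompC Γ f := by
  intro b hb
  obtain ⟨Pn, cn, hcn, hPn⟩ := hn.exec_two (CompN.const 0) hb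
  obtain ⟨P, c, ⟨C, D, hc⟩, hP⟩ := hA (b + 1) (by omega) (b + 2) (by simp) (b + 3) (by simp)
  obtain ⟨P', c', hc', hP'⟩ := hf (b + 2) (by omega) (b + 3) (by simp)
  have hcost : PolyBdd Γ (fun ω => C * (Γ.setup ω).bound ^ D) := ⟨C, D, fun _ => le_rfl⟩
  have hc'' : PolyBdd Γ c' := hc'
  refine ⟨.seq Pn (.seq (.loop (.natLt (b + 1) b)
    (.seq P (.seq (.instr (.cpxStore (b + 2) (b + 1) (b + 3)))
      (.seq (.instr (.natConst (b + 2) 1)) (.instr (.natAdd (b + 1) (b + 1) (b + 2)))))))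
    (.seq P' (.seq (.instr (.natConst b 0)) (.seq (.instr (.cpxOfNat b b))
      (.instr (.cpxAdd b b (b + 3))))))), _,
    hcn.add (((hn'.mul ((hcost.add (.const 3)).add (.const 1))).add (.const 1)).add
      (hc''.add (.const 3))), fun ω s hs => (hPn ω s hs).seq ?_⟩
  rintro s1 ⟨a1, v1, v2⟩
  refine Exec.seq (Exec.loop (n ω) _ (fun i s' => Agree b s s' ∧ s'.natReg b = n ω ∧
    s'.natReg (b + 1) = i ∧ ∀ x < i, s'.cpxArr (b + 2) x = A ω x) ?_ ?_ ?_) ?_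
  · rintro x hx t ⟨ht, t1, t2, t3⟩
    refine Exec.seq (c' := 3) ((hP ⟨ω, x, hx⟩ t ⟨⟨Γ.rep_congr hs (ht.mono hb), t2⟩, t3⟩).mono
      (hc _) (fun _ h => h)) ?_
    rintro t' ⟨ht', t4⟩
    refine Exec.seq (c := 1) (c' := 2) (Exec.instr (Q := fun x => x = _) _ rfl) ?_
    rintro _ rfl
    refine Exec.seq (c := 1) (c' := 1) (Exec.instr (Q := fun x => x = _) _ rfl) ?_
    rintro _ rfl
    refine Exec.instr _ ⟨?_, ?_, ?_, ?_⟩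
    · exact (((ht.trans (ht'.mono (by omega))).setCpxArr (by omega) _ _).setNat (by omega) _).setNat
        (by omega) _
    · simp [Instr.apply, ht'.natReg b (by omega), t1]
    · simp [Instr.apply, ht'.natReg (b + 1) (by omega), t2]
    · intro y hy
      simp only [Instr.apply, Store.setNat_cpxArr, Store.setCpxArr_cpxArr,
        ht'.natReg (b + 1) (by omega), t2, t4, true_and, ht'.cpxArr (b + 2) (by omega)]
      split_ifs with h
      · rw [h]
      · exact t3 y (by omega)
  · rintro x hx t ⟨ht, t1, t2, t3⟩
    simp [Test.Holds, t1, t2]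
  · exact ⟨a1, v1, v2, by simp⟩
  · rintro t ⟨ht, t1, t2, t3⟩
    refine Exec.seq (hP' ω t ⟨Γ.rep_congr hs (ht.mono hb), t3⟩) ?_
    rintro t' ⟨ht', t4⟩
    refine Exec.seq (c := 1) (c' := 2) (Exec.instr (Q := fun x => x = _) _ rfl) ?_
    rintro _ rfl
    refine Exec.seq (c := 1) (c' := 1) (Exec.instr (Q := fun x => x = _) _ rfl) ?_
    rintro _ rfl
    refine Exec.instr _ ⟨?_, ?_⟩
    · exact (((ht.trans (ht'.mono (by omega))).setNat le_rfl _).setCpx le_rfl _).setCpx le_rfl _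
    · simp [Instr.apply, t4]

end Rules


/-! ### The functions that the algorithm evaluates -/

/-- The coefficients of the logarithmic derivative `f' / f` of a power series `f` with coefficients
`l` and constant coefficient `1`. -/
noncomputable def dlogCoeff (l : ℕ → ℂ) : ℕ → ℂ
  | m => (m + 1) * l (m + 1) - ∑ j : Fin m, dlogCoeff l j * l (m - j)
decreasing_by exact j.2

theorem dlogCoeff_eq (l : ℕ → ℂ) (m : ℕ) : dlogCoeff l m =
    (m + 1) * l (m + 1) - ∑ j ∈ Finset.range m, dlogCoeff l j * l (m - j) := by
  rw [dlogCoeff, Fin.sum_univ_eq_sum_range (fun j => dlogCoeff l j * l (m - j))]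

namespace Setup

variable (S : Setup)

/-- One step of a walk on the terms, from the term `v`, as prescribed by the letter `c`: a letter
consists of a position in the subsystem of `v` and a place in the list of the terms that contain
the spin at that position; the last letter stands for not moving. -/
def step (v c : ℕ) : ℕ :=
  if c < S.loc * (S.deg + 1) then
    S.slot ((S.deg + 1) * S.inp.nat 6 v (c / (S.deg + 1)) + c % (S.deg + 1)) else v

/-- The position after `i` steps of the walk from `v` described by the word `w`, whose letters are
the digits of `w` in base `letters`. -/
def pos (v w : ℕ) : ℕ → ℕ
  | 0 => v
  | i + 1 => S.step (pos v w i) (w / S.letters ^ i % S.letters)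

/-- Every position of the walk `p` is one of the walk `p'`. -/
def Covers (p p' : ℕ → ℕ) : Prop := ∀ i < S.len, ∃ j < S.len, p i = p' j

/-- The walk from `v` described by `w` is the distinguished one among the walks that visit the same
set of terms: it starts at the least term of the set, and `w` is as small as possible. -/
def Canonical (v w : ℕ) : Prop :=
  (∀ i < S.len, v ≤ S.pos v w i) ∧
    ∀ w' < w, ¬ (S.Covers (S.pos v w) (S.pos v w') ∧ S.Covers (S.pos v w') (S.pos v w))

/-- The number of the terms visited by the walk `p`. -/
def visited (p : ℕ → ℕ) : ℕ := ∑ i ∈ Finset.range S.len, if ∀ j < i, p j ≠ p i then 1 else 0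

/-- The size of the subset of the positions of a walk that is encoded by the number `b`. -/
def maskCard (b : ℕ) : ℕ := ∑ i ∈ Finset.range S.len, b / 2 ^ i % 2

/-- The spin in the slot `s`. A slot stands for a position of the walk `p`, `s / loc`, together with
a position in the subsystem of the term visited there, `s % loc`. -/
def slotSpin (p : ℕ → ℕ) (s : ℕ) : ℕ := S.inp.nat 6 (p (s / S.loc)) (s % S.loc)

/-- The slot `s` contains a spin: the subsystem is large enough. -/
def Valid (p : ℕ → ℕ) (s : ℕ) : Prop := s % S.loc < S.inp.nat 5 (p (s / S.loc)) 0

/-- The slot `s` is the first one to contain its spin. -/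
def IsFirst (p : ℕ → ℕ) (s : ℕ) : Prop :=
  S.Valid p s ∧ ∀ s' < s, S.Valid p s' → S.slotSpin p s' ≠ S.slotSpin p s

/-- The `s`-th digit of the configuration `c` of all the slots. -/
def digit (c s : ℕ) : ℕ := c / S.dim ^ s % S.dim

/-- The configuration `c` of the slots comes from one of the spins: slots with the same spin have
the same state, and slots without a spin are in the state `0`. -/
def Consistent (p : ℕ → ℕ) (c : ℕ) : Prop :=
  ∀ s < S.slots, (¬ S.Valid p s → S.digit c s = 0) ∧ (S.Valid p s → ∀ s' < s, S.Valid p s' →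
    S.slotSpin p s' = S.slotSpin p s → S.digit c s' = S.digit c s)

/-- The number of the configuration of the subsystem at the `i`-th position of the walk. -/
def localIndex (p : ℕ → ℕ) (i c : ℕ) : ℕ :=
  ∑ j ∈ Finset.range (S.inp.nat 5 (p i) 0), S.digit c (i * S.loc + j) * S.dim ^ j

open Classical in
/-- The matrix entries of the term at the `i`-th position of the walk, as an operator on all the
spins of the walk. -/
noncomputable def termEntry (p : ℕ → ℕ) (i c c' : ℕ) : ℂ :=
  if ∀ s < S.slots, S.Valid p s →
      (∀ j < S.inp.nat 5 (p i) 0, S.inp.nat 6 (p i) j ≠ S.slotSpin p s) →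
      S.digit c s = S.digit c' s then
    S.inp.cpx 3 (p i) (S.localIndex p i c) (S.localIndex p i c') else 0

open Classical in
/-- The matrix entries of the Hamiltonian consisting of the terms at the positions in the set
encoded by `b`, each counted once. -/
noncomputable def hamEntry (p : ℕ → ℕ) (b c c' : ℕ) : ℂ :=
  ∑ i ∈ Finset.range S.len,
    if b / 2 ^ i % 2 = 1 ∧ ∀ j < i, b / 2 ^ j % 2 = 1 → p j ≠ p i then
      S.inp.cpx 2 (p i) 0 0 * S.termEntry p i c c' else 0

open Classical in
/-- The matrix entries of the product state of the spins of the walk. -/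
noncomputable def stateEntry (p : ℕ → ℕ) (c c' : ℕ) : ℂ :=
  ∏ s ∈ Finset.range S.slots,
    if S.IsFirst p s then S.inp.cpx 4 (S.slotSpin p s) (S.digit c s) (S.digit c' s) else 1

open Classical in
/-- The matrix entries of the Taylor coefficients of `e^{-iHz} ρ`, for the Hamiltonian of
`hamEntry`. -/
noncomputable def evolEntry (p : ℕ → ℕ) (b : ℕ) : ℕ → ℕ → ℕ → ℂ
  | 0, c, c' => S.stateEntry p c c'
  | m + 1, c, c' => -Complex.I / (m + 1) * ∑ c'' ∈ Finset.range S.dimTot,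
      if S.Consistent p c'' then S.hamEntry p b c c'' * evolEntry p b m c'' c' else 0

/-- The values of `evolEntry`, arranged as a sequence. -/
noncomputable def evolTable (p : ℕ → ℕ) (b y : ℕ) : ℂ :=
  S.evolEntry p b (y / (S.dimTot * S.dimTot)) (y / S.dimTot % S.dimTot) (y % S.dimTot)

open Classical in
/-- The Taylor coefficients of `tr (e^{-iHz} ρ)`, for the Hamiltonian of `hamEntry`. -/
noncomputable def echoCoeff (p : ℕ → ℕ) (b m : ℕ) : ℂ :=
  ∑ c ∈ Finset.range S.dimTot, if S.Consistent p c then S.evolEntry p b m c c else 0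

/-- The Taylor polynomial of the logarithm of `tr (e^{-iHz} ρ)`, for the Hamiltonian of
`hamEntry`, at the time given in the input. -/
noncomputable def logPoly (p : ℕ → ℕ) (b : ℕ) : ℂ :=
  ∑ m ∈ Finset.range S.order,
    dlogCoeff (S.echoCoeff p b) m / (m + 1) * S.inp.cpx 0 0 0 0 ^ (m + 1)

/-- The contribution of the set of terms visited by the walk `p`: the alternating sum of `logPoly`
over its subsets. -/
noncomputable def weight (p : ℕ → ℕ) : ℂ :=
  (-1) ^ S.visited p * ∑ b ∈ Finset.range (2 ^ S.len), (-1) ^ S.maskCard b * S.logPoly p b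

open Classical in
/-- The output of the algorithm. -/
noncomputable def output : ℂ :=
  ∑ v ∈ Finset.range S.numTerms, ∑ w ∈ Finset.range S.words,
    if S.Canonical v w then S.weight (S.pos v w) else 0

/-! ### The cost of these functions -/

theorem base_pow_le_bound {m e : ℕ} (hm : m ≤ S.dim + S.letters + S.loc + S.deg + 2)
    (he : e ≤ (S.len + 1) * (S.loc + 1)) : m ^ e ≤ S.bound :=
  (Nat.pow_le_pow_left hm _).trans (Nat.pow_le_pow_right (by omega) he)

theorem base_le_bound : S.dim + S.letters + S.loc + S.deg + 2 ≤ S.bound := by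
  simpa using S.base_pow_le_bound (e := 1) le_rfl (by nlinarith)

end Setup

section

variable {Γ : Ctx}

namespace PolyBdd

theorem dim : PolyBdd Γ (fun ω => (Γ.setup ω).dim) :=
  bound.of_le fun ω => by have := (Γ.setup ω).base_le_bound; omega

theorem letters : PolyBdd Γ (fun ω => (Γ.setup ω).letters) :=
  bound.of_le fun ω => by have := (Γ.setup ω).base_le_bound; omega

theorem loc : PolyBdd Γ (fun ω => (Γ.setup ω).loc) :=
  bound.of_le fun ω => by have := (Γ.setup ω).base_le_bound; omega

theorem deg : PolyBdd Γ (fun ω => (Γ.setup ω).deg) :=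
  bound.of_le fun ω => by have := (Γ.setup ω).base_le_bound; omega

theorem masks : PolyBdd Γ (fun ω => 2 ^ (Γ.setup ω).len) :=
  bound.of_le fun ω => (Γ.setup ω).base_pow_le_bound (by omega) (by nlinarith)

theorem len : PolyBdd Γ (fun ω => (Γ.setup ω).len) :=
  masks.of_le fun _ => Nat.lt_two_pow_self.le

theorem order : PolyBdd Γ (fun ω => (Γ.setup ω).order) :=
  len.of_le fun ω => by simp only [Setup.len]; omega

theorem words : PolyBdd Γ (fun ω => (Γ.setup ω).words) :=
  bound.of_le fun ω => (Γ.setup ω).base_pow_le_bound (by omega)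
    (by simp only [Setup.len]; nlinarith)

theorem slots : PolyBdd Γ (fun ω => (Γ.setup ω).slots) := len.mul loc

theorem dimTot : PolyBdd Γ (fun ω => (Γ.setup ω).dimTot) :=
  bound.of_le fun ω => (Γ.setup ω).base_pow_le_bound (by omega)
    (by simp only [Setup.slots]; nlinarith)

theorem size {v : Γ.Ω → ℕ} : PolyBdd Γ (fun ω => (Γ.setup ω).inp.nat 5 (v ω) 0) :=
  loc.of_le fun ω => (Γ.setup ω).size_le _

end PolyBdd

namespace CompN

theorem dim : CompN Γ (fun ω => (Γ.setup ω).dim) := by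
  have h : CompN Γ (fun ω => (Γ.setup ω).inp.nat 1 0 0) := .input 1 (.const 0) (.const 0)
  refine (ite (CompP.le h (.const 1)) (.const 1) h).congr fun ω => ?_
  simp only [Setup.dim]
  split_ifs <;> omega

theorem numTerms : CompN Γ (fun ω => (Γ.setup ω).numTerms) := .input 4 (.const 0) (.const 0)

theorem loc : CompN Γ (fun ω => (Γ.setup ω).loc) := .input 2 (.const 0) (.const 0)

theorem deg : CompN Γ (fun ω => (Γ.setup ω).deg) := .input 3 (.const 0) (.const 0)

theorem letters : CompN Γ (fun ω => (Γ.setup ω).letters) :=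
  (mul loc .loc (deg.add (.const 1))).add (.const 1)

theorem len : CompN Γ (fun ω => (Γ.setup ω).len) :=
  (mul (.const 2) (.const 2) order).add (.const 1)

theorem words : CompN Γ (fun ω => (Γ.setup ω).words) :=
  pow letters .letters (mul (.const 2) (.const 2) order) ((PolyBdd.const 2).mul .order)

theorem slots : CompN Γ (fun ω => (Γ.setup ω).slots) := mul len .len loc

theorem dimTot : CompN Γ (fun ω => (Γ.setup ω).dimTot) := pow dim .dim slots .slots

theorem size {v : Γ.Ω → ℕ} (hv : CompN Γ v) :
    CompN Γ (fun ω => (Γ.setup ω).inp.nat 5 (v ω) 0) :=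
  .input 5 hv (.const 0)

theorem step {v c : Γ.Ω → ℕ} (hv : CompN Γ v) (hc : CompN Γ c) (hc' : PolyBdd Γ c) :
    CompN Γ (fun ω => (Γ.setup ω).step (v ω) (c ω)) := by
  have h : CompN Γ (fun ω => (Γ.setup ω).deg + 1) := deg.add (.const 1)
  have h' : PolyBdd Γ (fun ω => (Γ.setup ω).deg + 1) := PolyBdd.deg.add (.const 1)
  exact ite (CompP.lt hc (mul loc .loc h))
    (slot ((mul h h' (.input 6 hv (div hc hc' h))).add (mod hc hc' h))) hv

theorem pos {v w i : Γ.Ω → ℕ} (hv : CompN Γ v) (hw : CompN Γ w) (hw' : PolyBdd Γ w)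
    (hi : CompN Γ i) (hi' : PolyBdd Γ i) :
    CompN Γ (fun ω => (Γ.setup ω).pos (v ω) (w ω) (i ω)) := by
  refine iterate (fun ω i => (Γ.setup ω).pos (v ω) (w ω) i) hi hi' hv fun b hb b' hb' => ?_
  exact step (Γ := (Γ.ext b hb (fun ω x => x < i ω)).withVar b' hb'
    (fun p => (Γ.setup p.1).pos (v p.1) (w p.1) p.2.1)) CompN.var
    (CompN.upVar (mod (div hw.up hw'.up (pow letters .letters .last hi'.last))
      (hw'.up.of_le fun _ => Nat.div_le_self _ _) letters))
    (PolyBdd.upVar (hw'.up.of_le fun _ => (Nat.mod_le _ _).trans (Nat.div_le_self _ _)))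

end CompN

theorem CompP.covers {v w v' w' : Γ.Ω → ℕ} (hv : CompN Γ v) (hw : CompN Γ w)
    (hw0 : PolyBdd Γ w) (hv' : CompN Γ v') (hw' : CompN Γ w') (hw0' : PolyBdd Γ w') :
    CompP Γ (fun ω => (Γ.setup ω).Covers ((Γ.setup ω).pos (v ω) (w ω))
      ((Γ.setup ω).pos (v' ω) (w' ω))) :=
  .ball .len .len fun _ _ => .bex .len .len fun _ _ =>
    .eq (CompN.pos hv.up.up hw.up.up hw0.up.up CompN.last.up PolyBdd.len.last.up)
      (CompN.pos hv'.up.up hw'.up.up hw0'.up.up CompN.last PolyBdd.len.last)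

theorem CompP.canonical {v w : Γ.Ω → ℕ} (hv : CompN Γ v) (hw : CompN Γ w)
    (hw' : PolyBdd Γ w) : CompP Γ (fun ω => (Γ.setup ω).Canonical (v ω) (w ω)) :=
  .and (.ball .len .len fun _ _ => .le hv.up (CompN.pos hv.up hw.up hw'.up .last PolyBdd.len.last))
    (.ball hw hw' fun _ _ => .not (.and (.covers hv.up hw.up hw'.up hv.up .last hw'.last)
      (.covers hv.up .last hw'.last hv.up hw.up hw'.up)))

theorem CompN.visited {v w : Γ.Ω → ℕ} (hv : CompN Γ v) (hw : CompN Γ w) (hw' : PolyBdd Γ w) :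
    CompN Γ (fun ω => (Γ.setup ω).visited ((Γ.setup ω).pos (v ω) (w ω))) :=
  .sum .len .len fun _ _ => CompP.indicator (.ball .last PolyBdd.len.last fun _ _ => .not (.eq
    (.pos hv.up.up hw.up.up hw'.up.up .last PolyBdd.len.last.last)
    (.pos hv.up.up hw.up.up hw'.up.up CompN.last.up PolyBdd.len.last.up)))

theorem CompN.digit' {m c s : Γ.Ω → ℕ} (hm : CompN Γ m) (hm' : PolyBdd Γ m) (hc : CompN Γ c)
    (hc' : PolyBdd Γ c) (hs : CompN Γ s) (hs' : PolyBdd Γ s) :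
    CompN Γ (fun ω => c ω / m ω ^ s ω % m ω) :=
  .mod (.div hc hc' (.pow hm hm' hs hs')) (hc'.of_le fun _ => Nat.div_le_self _ _) hm

theorem CompN.digit {c s : Γ.Ω → ℕ} (hc : CompN Γ c) (hc' : PolyBdd Γ c) (hs : CompN Γ s)
    (hs' : PolyBdd Γ s) : CompN Γ (fun ω => (Γ.setup ω).digit (c ω) (s ω)) :=
  .digit' .dim .dim hc hc' hs hs'

theorem PolyBdd.digit {c : Γ.Ω → ℕ} (hc : PolyBdd Γ c) (s : Γ.Ω → ℕ) :
    PolyBdd Γ (fun ω => (Γ.setup ω).digit (c ω) (s ω)) :=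
  hc.of_le fun _ => (Nat.mod_le _ _).trans (Nat.div_le_self _ _)

theorem CompN.maskCard {b : Γ.Ω → ℕ} (hb : CompN Γ b) (hb' : PolyBdd Γ b) :
    CompN Γ (fun ω => (Γ.setup ω).maskCard (b ω)) :=
  .sum .len .len fun _ _ => .digit' (.const 2) (.const 2) hb.up hb'.up .last PolyBdd.len.last

theorem PolyBdd.maskCard {b : Γ.Ω → ℕ} : PolyBdd Γ (fun ω => (Γ.setup ω).maskCard (b ω)) := by
  refine PolyBdd.len.of_le fun ω => (Finset.sum_le_card_nsmul _ _ 1 fun i _ => ?_).trans (by simp)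
  have := Nat.mod_lt (b ω / 2 ^ i) (show 2 > 0 by norm_num)
  omega

theorem PolyBdd.visited {p : Γ.Ω → ℕ → ℕ} :
    PolyBdd Γ (fun ω => (Γ.setup ω).visited (p ω)) := by
  refine PolyBdd.len.of_le fun ω => (Finset.sum_le_card_nsmul _ _ 1 fun i _ => ?_).trans (by simp)
  split_ifs <;> omega

end


section

variable {Γ : Ctx} {v w s : Γ.Ω → ℕ}

theorem CompN.posDiv (hv : CompN Γ v) (hw : CompN Γ w) (hw' : PolyBdd Γ w) (hs : CompN Γ s)
    (hs' : PolyBdd Γ s) : CompN Γ (fun ω =>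
      (Γ.setup ω).pos (v ω) (w ω) (s ω / (Γ.setup ω).loc)) :=
  .pos hv hw hw' (.div hs hs' .loc) (hs'.of_le fun _ => Nat.div_le_self _ _)

theorem CompN.slotSpin (hv : CompN Γ v) (hw : CompN Γ w) (hw' : PolyBdd Γ w) (hs : CompN Γ s)
    (hs' : PolyBdd Γ s) : CompN Γ (fun ω =>
      (Γ.setup ω).slotSpin ((Γ.setup ω).pos (v ω) (w ω)) (s ω)) :=
  .input 6 (.posDiv hv hw hw' hs hs') (.mod hs hs' .loc)

theorem CompP.valid (hv : CompN Γ v) (hw : CompN Γ w) (hw' : PolyBdd Γ w) (hs : CompN Γ s)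
    (hs' : PolyBdd Γ s) : CompP Γ (fun ω =>
      (Γ.setup ω).Valid ((Γ.setup ω).pos (v ω) (w ω)) (s ω)) :=
  .lt (.mod hs hs' .loc) (.size (.posDiv hv hw hw' hs hs'))

theorem CompP.isFirst (hv : CompN Γ v) (hw : CompN Γ w) (hw' : PolyBdd Γ w) (hs : CompN Γ s)
    (hs' : PolyBdd Γ s) : CompP Γ (fun ω =>
      (Γ.setup ω).IsFirst ((Γ.setup ω).pos (v ω) (w ω)) (s ω)) :=
  .and (.valid hv hw hw' hs hs') (.ball hs hs' fun _ _ => .imp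
    (.valid hv.up hw.up hw'.up .last hs'.last) (.not (.eq
      (.slotSpin hv.up hw.up hw'.up .last hs'.last)
      (.slotSpin hv.up hw.up hw'.up hs.up hs'.up))))

theorem CompP.consistent {c : Γ.Ω → ℕ} (hv : CompN Γ v) (hw : CompN Γ w) (hw' : PolyBdd Γ w)
    (hc : CompN Γ c) (hc' : PolyBdd Γ c) : CompP Γ (fun ω =>
      (Γ.setup ω).Consistent ((Γ.setup ω).pos (v ω) (w ω)) (c ω)) := by
  refine .ball .slots .slots fun a ha => ?_
  have hs := CompN.last (hb := ha) (P := fun ω x => x < (Γ.setup ω).slots)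
  have hs' := PolyBdd.slots (Γ := Γ).last (hb := ha)
  refine .and (.imp (.not (.valid hv.up hw.up hw'.up hs hs'))
    (.eq (.digit hc.up hc'.up hs hs') (.const 0))) (.imp (.valid hv.up hw.up hw'.up hs hs')
    (.ball hs hs' fun _ _ => ?_))
  exact .imp (.valid hv.up.up hw.up.up hw'.up.up .last hs'.last)
    (.imp (.eq (.slotSpin hv.up.up hw.up.up hw'.up.up .last hs'.last)
      (.slotSpin hv.up.up hw.up.up hw'.up.up hs.up hs'.up))
      (.eq (.digit hc.up.up hc'.up.up .last hs'.last)
        (.digit hc.up.up hc'.up.up hs.up hs'.up)))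

theorem CompN.localIndex {i c : Γ.Ω → ℕ} (hv : CompN Γ v) (hw : CompN Γ w) (hw' : PolyBdd Γ w)
    (hi : CompN Γ i) (hi' : PolyBdd Γ i) (hc : CompN Γ c) (hc' : PolyBdd Γ c) :
    CompN Γ (fun ω =>
      (Γ.setup ω).localIndex ((Γ.setup ω).pos (v ω) (w ω)) (i ω) (c ω)) := by
  refine .sum (.size (.pos hv hw hw' hi hi')) .size fun _ _ => ?_
  refine .mul (.digit hc.up hc'.up ((CompN.mul hi.up hi'.up .loc).add .last)
    ((hi'.up.mul .loc).add PolyBdd.size.last)) (hc'.up.digit _)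
    (.pow .dim .dim .last PolyBdd.size.last)

theorem CompC.termEntry {i c c' : Γ.Ω → ℕ} (hv : CompN Γ v) (hw : CompN Γ w)
    (hw' : PolyBdd Γ w) (hi : CompN Γ i) (hi' : PolyBdd Γ i) (hc : CompN Γ c)
    (hcb : PolyBdd Γ c) (hc' : CompN Γ c') (hcb' : PolyBdd Γ c') : CompC Γ (fun ω =>
      (Γ.setup ω).termEntry ((Γ.setup ω).pos (v ω) (w ω)) (i ω) (c ω) (c' ω)) := by
  have hp : CompN Γ fun ω => (Γ.setup ω).pos (v ω) (w ω) (i ω) := .pos hv hw hw' hi hi'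
  classical
  refine .ite (.ball .slots .slots fun a ha => ?_) (.input 3 hp
    (.localIndex hv hw hw' hi hi' hc hcb) (.localIndex hv hw hw' hi hi' hc' hcb')) .zero
  have hs := CompN.last (hb := ha) (P := fun ω x => x < (Γ.setup ω).slots)
  have hs' := PolyBdd.slots (Γ := Γ).last (hb := ha)
  refine .imp (.valid hv.up hw.up hw'.up hs hs') (.imp
    (.ball (.size hp.up) .size fun _ _ => .not (.eq (.input 6 hp.up.up .last)
      (.slotSpin hv.up.up hw.up.up hw'.up.up hs.up hs'.up)))
    (.eq (.digit hc.up hcb.up hs hs') (.digit hc'.up hcb'.up hs hs')))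

theorem CompP.bit {b i : Γ.Ω → ℕ} (hb : CompN Γ b) (hb' : PolyBdd Γ b) (hi : CompN Γ i)
    (hi' : PolyBdd Γ i) : CompP Γ (fun ω => b ω / 2 ^ i ω % 2 = 1) :=
  .eq (.digit' (.const 2) (.const 2) hb hb' hi hi') (.const 1)

theorem CompC.hamEntry {b c c' : Γ.Ω → ℕ} (hv : CompN Γ v) (hw : CompN Γ w)
    (hw' : PolyBdd Γ w) (hb : CompN Γ b) (hb' : PolyBdd Γ b) (hc : CompN Γ c)
    (hcb : PolyBdd Γ c) (hc' : CompN Γ c') (hcb' : PolyBdd Γ c') : CompC Γ (fun ω =>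
      (Γ.setup ω).hamEntry ((Γ.setup ω).pos (v ω) (w ω)) (b ω) (c ω) (c' ω)) := by
  refine .sum .len .len fun a ha => ?_
  have hi := CompN.last (hb := ha) (P := fun ω x => x < (Γ.setup ω).len)
  have hi' := PolyBdd.len (Γ := Γ).last (hb := ha)
  have hp := CompN.pos hv.up hw.up hw'.up hi hi'
  refine .ite (.and (.bit hb.up hb'.up hi hi') (.ball hi hi' fun _ _ => .imp
    (.bit hb.up.up hb'.up.up .last hi'.last) (.not (.eq
      (.pos hv.up.up hw.up.up hw'.up.up .last hi'.last) hp.up)))) ?_ .zero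
  exact .mul (.input 2 hp (.const 0) (.const 0))
    (.termEntry hv.up hw.up hw'.up hi hi' hc.up hcb.up hc'.up hcb'.up)

theorem CompC.stateEntry {c c' : Γ.Ω → ℕ} (hv : CompN Γ v) (hw : CompN Γ w)
    (hw' : PolyBdd Γ w) (hc : CompN Γ c) (hcb : PolyBdd Γ c) (hc' : CompN Γ c')
    (hcb' : PolyBdd Γ c') : CompC Γ (fun ω =>
      (Γ.setup ω).stateEntry ((Γ.setup ω).pos (v ω) (w ω)) (c ω) (c' ω)) := by
  refine .prod .slots .slots fun a ha => ?_
  have hs := CompN.last (hb := ha) (P := fun ω x => x < (Γ.setup ω).slots)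
  have hs' := PolyBdd.slots (Γ := Γ).last (hb := ha)
  classical
  exact .ite (.isFirst hv.up hw.up hw'.up hs hs')
    (.input 4 (.slotSpin hv.up hw.up hw'.up hs hs') (.digit hc.up hcb.up hs hs')
      (.digit hc'.up hcb'.up hs hs')) .one

theorem Setup.dimTot_pos (S : Setup) : 0 < S.dimTot :=
  pow_pos (lt_of_lt_of_le one_pos (le_max_right _ _)) _

theorem Setup.evolTable_index (S : Setup) (p : ℕ → ℕ) (b m : ℕ) {c c' : ℕ} (hc : c < S.dimTot)
    (hc' : c' < S.dimTot) :
    S.evolTable p b (m * (S.dimTot * S.dimTot) + (c * S.dimTot + c')) = S.evolEntry p b m c c' := by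
  have hD := S.dimTot_pos
  have h1 : c * S.dimTot + c' < S.dimTot * S.dimTot := by nlinarith
  have h2 : m * (S.dimTot * S.dimTot) + (c * S.dimTot + c') =
      (m * S.dimTot + c) * S.dimTot + c' := by ring
  unfold evolTable
  congr 1
  · rw [mul_comm m, Nat.mul_add_div (by positivity), Nat.div_eq_of_lt h1, add_zero]
  · rw [h2, mul_comm _ S.dimTot, Nat.mul_add_div hD, Nat.div_eq_of_lt hc', add_zero,
      mul_comm m, Nat.mul_add_mod, Nat.mod_eq_of_lt hc]
  · rw [h2, mul_comm _ S.dimTot, Nat.mul_add_mod, Nat.mod_eq_of_lt hc']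

open Classical in
theorem Setup.evolTable_eq (S : Setup) (p : ℕ → ℕ) (b y : ℕ) : S.evolTable p b y =
    if y < S.dimTot * S.dimTot then S.stateEntry p (y / S.dimTot % S.dimTot) (y % S.dimTot)
    else -Complex.I / (y / (S.dimTot * S.dimTot) : ℕ) * ∑ c ∈ Finset.range S.dimTot,
      if S.Consistent p c then S.hamEntry p b (y / S.dimTot % S.dimTot) c *
        (if (y / (S.dimTot * S.dimTot) - 1) * (S.dimTot * S.dimTot) +
          (c * S.dimTot + y % S.dimTot) < y then
        S.evolTable p b ((y / (S.dimTot * S.dimTot) - 1) * (S.dimTot * S.dimTot) +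
          (c * S.dimTot + y % S.dimTot)) else 0) else 0 := by
  have hD := S.dimTot_pos
  have hD2 : 0 < S.dimTot * S.dimTot := by positivity
  split_ifs with h
  · rw [evolTable, Nat.div_eq_of_lt h, evolEntry]
  · obtain ⟨m, hm⟩ : ∃ m, y / (S.dimTot * S.dimTot) = m + 1 :=
      Nat.exists_eq_succ_of_ne_zero (Nat.div_pos (not_lt.1 h) hD2).ne'
    rw [evolTable, hm, evolEntry]
    push_cast
    congr 1
    refine Finset.sum_congr rfl fun c hc => ?_
    rw [Finset.mem_range] at hc
    split_ifs with hcons hlt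
    · rw [evolTable_index _ _ _ _ hc (Nat.mod_lt y hD)]
    · refine absurd ?_ hlt
      have := Nat.mod_lt y hD
      have h1 : c * S.dimTot + y % S.dimTot < S.dimTot * S.dimTot := by nlinarith
      have h2 := Nat.div_mul_le_self y (S.dimTot * S.dimTot)
      rw [hm, add_mul, one_mul] at h2
      omega
    · rfl

/-- The values of `evolTable` are computed by a course-of-values recursion. -/
theorem CompC.memo_evolTable {b : Γ.Ω → ℕ} {f : Γ.Ω → ℂ} (hv : CompN Γ v) (hw : CompN Γ w)
    (hw' : PolyBdd Γ w) (hb : CompN Γ b) (hb' : PolyBdd Γ b)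
    (hf : ∀ a ha, CompC (Γ.withArr a ha
      (fun ω => (Γ.setup ω).evolTable ((Γ.setup ω).pos (v ω) (w ω)) (b ω))
      (fun ω => ((Γ.setup ω).order + 1) * ((Γ.setup ω).dimTot * (Γ.setup ω).dimTot))) f) :
    CompC Γ f := by
  have hD2 : ∀ {Γ : Ctx}, CompN Γ fun ω => (Γ.setup ω).dimTot * (Γ.setup ω).dimTot :=
    .mul .dimTot .dimTot .dimTot
  have hD2' : ∀ {Γ : Ctx}, PolyBdd Γ fun ω => (Γ.setup ω).dimTot * (Γ.setup ω).dimTot :=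
    PolyBdd.dimTot.mul .dimTot
  have hn : PolyBdd Γ
      fun ω => ((Γ.setup ω).order + 1) * ((Γ.setup ω).dimTot * (Γ.setup ω).dimTot) :=
    (PolyBdd.order.add (.const 1)).mul hD2'
  refine CompC.memo _ (.mul (CompN.order.add (.const 1)) (PolyBdd.order.add (.const 1)) hD2)
    hn (fun a ha a' ha' => ?_) hf
  refine CompC.congr ?_ fun p => (Setup.evolTable_eq _ _ _ _).symm
  classical
  have hy := CompN.last (Γ := Γ) (b := a) (hb := ha) (P := fun ω x =>
    x < ((Γ.setup ω).order + 1) * ((Γ.setup ω).dimTot * (Γ.setup ω).dimTot)) |>.upArr (hb := ha')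
      (A := fun p => (Γ.setup p.1).evolTable ((Γ.setup p.1).pos (v p.1) (w p.1)) (b p.1))
      (m := fun p => p.2.1)
  have hy' := (hn.last (hb := ha)).upArr (hb := ha')
      (A := fun p => (Γ.setup p.1).evolTable ((Γ.setup p.1).pos (v p.1) (w p.1)) (b p.1))
      (m := fun p => p.2.1)
  have hr := CompN.mod (.div hy hy' .dimTot) (hy'.of_le fun _ => Nat.div_le_self _ _) .dimTot
  have hr' := hy'.of_le fun p => (Nat.mod_le (p.2.1 / (Γ.setup p.1).dimTot)
    (Γ.setup p.1).dimTot).trans (Nat.div_le_self _ _)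
  have hq := CompN.mod hy hy' .dimTot
  have hq' := hy'.of_le fun p => Nat.mod_le p.2.1 (Γ.setup p.1).dimTot
  have hd := CompN.div hy hy' hD2
  have hd' := hy'.of_le fun p => Nat.div_le_self p.2.1
    ((Γ.setup p.1).dimTot * (Γ.setup p.1).dimTot)
  refine .ite (.lt hy hD2) (.stateEntry hv.up.upArr hw.up.upArr hw'.up.upArr hr hr' hq hq') (.mul
    (.div (.neg .I) (.ofNat hd))
    (.sum .dimTot .dimTot fun _ _ => .ite
      (.consistent hv.up.upArr.up hw.up.upArr.up hw'.up.upArr.up .last PolyBdd.dimTot.last)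
      (.mul (.hamEntry hv.up.upArr.up hw.up.upArr.up hw'.up.upArr.up hb.up.upArr.up
        hb'.up.upArr.up hr.up hr'.up .last PolyBdd.dimTot.last)
        (.arr HasArr.withArr.up ?_ hy.up)) .zero))
  have hd1 := hd.sub (.const 1)
  have hd1' := hd'.of_le fun p =>
    Nat.sub_le (p.2.1 / ((Γ.setup p.1).dimTot * (Γ.setup p.1).dimTot)) 1
  exact (CompN.mul hd1.up hd1'.up hD2).add ((CompN.mul .last PolyBdd.dimTot.last .dimTot).add hq.up)

theorem CompC.echoCoeff {b m : Γ.Ω → ℕ} (hv : CompN Γ v) (hw : CompN Γ w) (hw' : PolyBdd Γ w)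
    (hm : CompN Γ m) (hm' : PolyBdd Γ m)
    (hA : HasArr Γ (fun ω => (Γ.setup ω).evolTable ((Γ.setup ω).pos (v ω) (w ω)) (b ω))
      (fun ω => ((Γ.setup ω).order + 1) * ((Γ.setup ω).dimTot * (Γ.setup ω).dimTot)))
    (h : ∀ ω, m ω ≤ (Γ.setup ω).order) :
    CompC Γ fun ω => (Γ.setup ω).echoCoeff ((Γ.setup ω).pos (v ω) (w ω)) (b ω) (m ω) := by
  have hD2 : ∀ {Γ : Ctx}, CompN Γ fun ω => (Γ.setup ω).dimTot * (Γ.setup ω).dimTot :=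
    .mul .dimTot .dimTot .dimTot
  classical
  refine .sum .dimTot .dimTot fun a ha => .ite
    (.consistent hv.up hw.up hw'.up .last PolyBdd.dimTot.last) ?_ .zero
  have hc := CompN.last (hb := ha) (P := fun ω x => x < (Γ.setup ω).dimTot)
  have hc' := PolyBdd.dimTot (Γ := Γ).last (hb := ha)
  refine CompC.congr (.arr hA.up ((CompN.mul hm.up hm'.up hD2).add
    ((CompN.mul hc hc' .dimTot).add hc)) (.mul (CompN.order.add (.const 1))
      (PolyBdd.order.add (.const 1)) hD2)) fun p => ?_
  rw [if_pos, Setup.evolTable_index _ _ _ _ p.2.2 p.2.2]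
  have h1 := p.2.2
  have h2 := h p.1
  have h3 : p.2.1 * (Γ.setup p.1).dimTot + p.2.1 <
    (Γ.setup p.1).dimTot * (Γ.setup p.1).dimTot := by nlinarith
  have h4 : m p.1 * ((Γ.setup p.1).dimTot * (Γ.setup p.1).dimTot) ≤
    (Γ.setup p.1).order * ((Γ.setup p.1).dimTot * (Γ.setup p.1).dimTot) :=
    Nat.mul_le_mul_right _ h2
  rw [add_mul, one_mul]
  exact add_lt_add_of_le_of_lt h4 h3

theorem CompC.logPoly {b : Γ.Ω → ℕ} (hv : CompN Γ v) (hw : CompN Γ w) (hw' : PolyBdd Γ w)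
    (hb : CompN Γ b) (hb' : PolyBdd Γ b) :
    CompC Γ fun ω => (Γ.setup ω).logPoly ((Γ.setup ω).pos (v ω) (w ω)) (b ω) := by
  refine CompC.memo_evolTable hv hw hw' hb hb' fun a ha => ?_
  have hA := HasArr.withArr (Γ := Γ) (b := a) (hb := ha)
    (A := fun ω => (Γ.setup ω).evolTable ((Γ.setup ω).pos (v ω) (w ω)) (b ω))
    (m := fun ω => ((Γ.setup ω).order + 1) * ((Γ.setup ω).dimTot * (Γ.setup ω).dimTot))
  refine CompC.memo (Γ := Γ.withArr a ha _ _) (fun ω => dlogCoeff ((Γ.setup ω).echoCoeff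
    ((Γ.setup ω).pos (v ω) (w ω)) (b ω))) .order .order (fun a1 ha1 a2 ha2 => ?_)
    (fun a1 ha1 => ?_)
  · have hm := CompN.last (hb := ha1) (P := fun ω x => x < (Γ.setup ω).order) |>.upArr (hb := ha2)
      (A := fun p => dlogCoeff ((Γ.setup p.1).echoCoeff
        ((Γ.setup p.1).pos (v p.1) (w p.1)) (b p.1))) (m := fun p => p.2.1)
    have hm' := PolyBdd.order (Γ := Γ.withArr a ha _ _).last (hb := ha1) |>.upArr (hb := ha2)
      (A := fun p => dlogCoeff ((Γ.setup p.1).echoCoeff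
        ((Γ.setup p.1).pos (v p.1) (w p.1)) (b p.1))) (m := fun p => p.2.1)
    refine CompC.congr (Γ := ((Γ.withArr a ha _ _).ext a1 ha1 _).withArr a2 ha2 _ _)
      (.sub (.mul (.add (.ofNat hm) .one) (.echoCoeff hv.upArr.up.upArr
      hw.upArr.up.upArr hw'.upArr.up.upArr (hm.add (.const 1)) (hm'.add (.const 1)) hA.up.upArr
      fun p => p.2.2)) (CompC.sum hm hm'
        (Γ := ((Γ.withArr a ha _ _).ext a1 ha1 _).withArr a2 ha2 _ _)
        (F := fun (p : (ω : Γ.Ω) × {x : ℕ // x < (Γ.setup ω).order}) j => (if j < p.2.1 then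
        dlogCoeff ((Γ.setup p.1).echoCoeff ((Γ.setup p.1).pos (v p.1) (w p.1)) (b p.1)) j else 0) *
        (Γ.setup p.1).echoCoeff ((Γ.setup p.1).pos (v p.1) (w p.1)) (b p.1) (p.2.1 - j))
      fun a3 ha3 => .mul (.arr HasArr.withArr.up .last hm.up)
      (.echoCoeff hv.upArr.up.upArr.up hw.upArr.up.upArr.up hw'.upArr.up.upArr.up
        (hm.up.sub .last) (hm'.up.of_le fun _ => Nat.sub_le _ _) hA.up.upArr.up
        fun p => (Nat.sub_le _ _).trans p.1.2.2.le))) fun p => ?_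
    rw [dlogCoeff_eq]
    congr 1
    exact Finset.sum_congr rfl fun x hx => by rw [if_pos (Finset.mem_range.1 hx)]
  · refine CompC.congr (Γ := (Γ.withArr a ha _ _).withArr a1 ha1 _ _) (CompC.sum .order .order
      (Γ := (Γ.withArr a ha _ _).withArr a1 ha1 _ _)
      (F := fun p j => (if j < (Γ.setup p).order then
        dlogCoeff ((Γ.setup p).echoCoeff ((Γ.setup p).pos (v p) (w p)) (b p)) j else 0) /
        (j + 1) * (Γ.setup p).inp.cpx 0 0 0 0 ^ (j + 1)) fun a3 ha3 =>
          .mul (.div (.arr HasArr.withArr.up .last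
      .order) (.add (.ofNat .last) .one)) (.pow (.input 0 (.const 0) (.const 0) (.const 0))
      (CompN.last.add (.const 1)) (PolyBdd.order.last.add (.const 1)))) fun p => ?_
    exact Finset.sum_congr rfl fun x hx => by rw [if_pos (Finset.mem_range.1 hx)]

theorem CompC.weight (hv : CompN Γ v) (hw : CompN Γ w) (hw' : PolyBdd Γ w) :
    CompC Γ fun ω => (Γ.setup ω).weight ((Γ.setup ω).pos (v ω) (w ω)) := by
  have h2 : ∀ {Γ : Ctx}, CompN Γ fun ω => 2 ^ (Γ.setup ω).len :=
    .pow (.const 2) (.const 2) .len .len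
  exact .mul (.pow (.neg .one) (.visited hv hw hw') .visited) (.sum h2 .masks fun a ha =>
    .mul (.pow (.neg .one) (.maskCard .last PolyBdd.masks.last) .maskCard)
      (.logPoly hv.up hw.up hw'.up .last PolyBdd.masks.last))

/-- The output is computed at a cost that is linear in the number of terms, apart from a factor
bounded by a polynomial in the size parameter. -/
theorem exec_output (Γ : Ctx) {b : ℕ} (hb : Γ.base ≤ b) :
    ∃ (P : Program) (c : Γ.Ω → ℕ), PolyBdd Γ c ∧ ∀ ω s, Γ.Rep ω s →
      Exec (Γ.setup ω).inp P s (((Γ.setup ω).numTerms + 1) * c ω)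
        (fun s' => Agree b s s' ∧ s'.cpxReg b = (Γ.setup ω).output) := by
  classical
  refine CompC.exec_fold .numTerms (fun a ha => ?_) (· + ·) (fun b b' => .cpxAdd b b b')
    (fun _ _ _ _ => rfl) 0 (fun ω i => ∑ v ∈ Finset.range i,
      ∑ w ∈ Finset.range (Γ.setup ω).words, if (Γ.setup ω).Canonical v w then
        (Γ.setup ω).weight ((Γ.setup ω).pos v w) else 0) (by simp)
    (fun ω x _ => Finset.sum_range_succ _ _) b hb
  exact .sum .words .words fun a' ha' => .ite
    (.canonical CompN.last.up .last PolyBdd.words.last)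
    (.weight CompN.last.up .last PolyBdd.words.last) .zero

end


/-! ### The program -/

/-- A nonempty sequence of instructions. -/
def Program.block (i : Instr) : List Instr → Program
  | [] => .instr i
  | j :: l => .seq (.instr i) (Program.block j l)

theorem Exec.block {inp : Input} (i : Instr) (l : List Instr) (s : Store) :
    Exec inp (.block i l) s (l.length + 1)
      (fun s' => s' = (i :: l).foldl (fun s i => i.apply inp s) s) := by
  induction l generalizing i s with
  | nil => exact Exec.instr _ rfl
  | cons j l ih =>
    refine (Exec.seq (c := 1) (c' := l.length + 1) (Exec.instr (Q := fun x => x = _) _ rfl)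
      ?_).mono (Nat.le_of_eq (by simp [add_comm])) (fun _ h => h)
    rintro _ rfl
    exact ih j (i.apply inp s)

/-- For the time `t` and the degree bound `𝔡` of the input, this is `|t| / t_L^*`. -/
noncomputable def timeRatio (inp : Input) : ℝ :=
  ‖inp.cpx 0 0 0 0‖ * Real.exp 1 ^ 2 * (inp.nat 3 0 0 : ℕ) * ((inp.nat 3 0 0 : ℕ) + 1) * 2

/-- The bound for the error of the Taylor expansion of order `m`. -/
noncomputable def errorBound (inp : Input) (m : ℕ) : ℝ :=
  (inp.nat 4 0 0 : ℕ) / (1 - timeRatio inp) * timeRatio inp ^ m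

/-- The program that computes the order of the Taylor expansion. -/
def orderProgram : Program :=
  .seq (.block (.natConst 0 0) [.natConst 1 0, .natInput 2 4 1 1, .natInput 3 3 1 1, .natConst 4 1,
    .natAdd 5 3 4, .natAdd 6 4 4, .cpxInput 1 0 1 1 1, .cpxAbs 1 1, .cpxEuler 2, .cpxMul 2 2 2,
    .cpxOfNat 3 3, .cpxOfNat 4 5, .cpxOfNat 5 6, .cpxMul 1 1 2, .cpxMul 1 1 3, .cpxMul 1 1 4,
    .cpxMul 1 1 5, .cpxOfNat 6 4, .cpxSub 6 6 1, .cpxOfNat 7 2, .cpxDiv 7 7 6,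
    .cpxInput 8 1 1 1 1])
    (.loop (.reLt 8 7) (.block (.cpxMul 7 7 1) [.natAdd 0 0 4]))

theorem exec_orderProgram {inp : Input} {M : ℕ}
    (h : ∀ m ≤ M, ((inp.cpx 1 0 0 0).re < errorBound inp m ↔ m < M)) :
    Exec inp orderProgram Store.blank (M * 3 + 24) (fun s => s.natReg 0 = M ∧ s.natReg 1 = 0 ∧
      s.natReg 2 = inp.nat 4 0 0 ∧ s.natReg 3 = inp.nat 3 0 0 ∧ s.natReg 4 = 1 ∧
      (∀ x, s.natArr 0 x = 0) ∧ ∀ x, s.natArr 1 x = 0) := by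
  refine (Exec.seq (Exec.block _ _ _) (Q' := fun s => s.natReg 0 = M ∧ s.natReg 1 = 0 ∧
      s.natReg 2 = inp.nat 4 0 0 ∧ s.natReg 3 = inp.nat 3 0 0 ∧ s.natReg 4 = 1 ∧
      (∀ x, s.natArr 0 x = 0) ∧ ∀ x, s.natArr 1 x = 0) (c' := M * 3 + 1) ?_).mono
    (by simp; omega) (fun _ h => h)
  rintro s rfl
  have he : Complex.exp 1 * Complex.exp 1 = Complex.exp 2 := by
    rw [← Complex.exp_add]; norm_num
  refine (Exec.loop M 2 (fun m s => s.natReg 0 = m ∧ s.natReg 1 = 0 ∧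
      s.natReg 2 = inp.nat 4 0 0 ∧ s.natReg 3 = inp.nat 3 0 0 ∧ s.natReg 4 = 1 ∧
      ((∀ x, s.natArr 0 x = 0) ∧ ∀ x, s.natArr 1 x = 0) ∧
      s.cpxReg 1 = (timeRatio inp : ℝ) ∧ s.cpxReg 7 = (errorBound inp m : ℝ) ∧
      s.cpxReg 8 = inp.cpx 1 0 0 0) ?_ ?_ ?_).mono le_rfl ?_
  · rintro m hm s ⟨h0, h1, h2, h3, h4, h5, h6, h7, h8⟩
    refine (Exec.block _ _ _).mono le_rfl ?_
    rintro _ rfl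
    refine ⟨?_, ?_, ?_, ?_, ?_, ?_, ?_, ?_, ?_⟩ <;>
      simp [Instr.apply, h0, h1, h2, h3, h4, h5, h6, h7, h8]
    simp only [errorBound]
    push_cast
    ring
  · rintro m hm s ⟨-, -, -, -, -, -, -, h7, h8⟩
    simp only [Test.Holds, h7, h8, Complex.ofReal_re]
    exact h m hm
  · refine ⟨?_, ?_, ?_, ?_, ?_, ?_, ?_, ?_, ?_⟩ <;>
      simp [Instr.apply, Store.blank, errorBound, timeRatio, he]
  · rintro s ⟨h0, h1, h2, h3, h4, h5, -⟩
    exact ⟨h0, h1, h2, h3, h4, h5.1, h5.2⟩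

open Classical in
/-- The number of the terms before the `i`-th one that contain the spin `u`. -/
noncomputable def spinRank (inp : Input) (u i : ℕ) : ℕ :=
  ∑ i' ∈ Finset.range i, if ∃ j < inp.nat 5 i' 0, inp.nat 6 i' j = u then 1 else 0

/-- The properties of the array `slot` that the algorithm relies on: the entries are terms, and the
`deg + 1` entries that belong to a spin contain all the terms acting on this spin. -/
structure SlotSpec (inp : Input) (slot : ℕ → ℕ) : Prop where
  lt : ∀ x, slot x < inp.nat 4 0 0
  eq : ∀ i < inp.nat 4 0 0, ∀ j < inp.nat 5 i 0,
    slot ((inp.nat 3 0 0 + 1) * inp.nat 6 i j + spinRank inp (inp.nat 6 i j) i) = i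

/-- The conditions under which the lists of the terms containing a given spin fit into the array:
the spins of a subsystem are distinct, and a spin is in at most `deg + 1` subsystems. -/
structure ListSpec (inp : Input) : Prop where
  pos : 0 < inp.nat 4 0 0
  size_le : ∀ i, inp.nat 5 i 0 ≤ inp.nat 2 0 0
  inj : ∀ i < inp.nat 4 0 0, ∀ j < inp.nat 5 i 0, ∀ j' < inp.nat 5 i 0,
    inp.nat 6 i j = inp.nat 6 i j' → j = j'
  rank_le : ∀ i < inp.nat 4 0 0, ∀ j < inp.nat 5 i 0, spinRank inp (inp.nat 6 i j) i ≤ inp.nat 3 0 0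

/-- The program that lists, for every spin, the terms that contain it. Array `1` holds the number
of terms found so far. -/
def slotProgram : Program :=
  .seq (.block (.natConst 7 0) []) (.loop (.natLt 7 2)
    (.seq (.block (.natInput 8 5 7 1) [.natConst 9 0])
      (.seq (.loop (.natLt 9 8)
        (.seq (.block (.natInput 10 6 7 9) [.natLoad 11 1 10, .natConst 12 0, .natConst 13 0])
          (.seq (.loop (.natLe 12 3) (.block (.natAdd 13 13 10) [.natAdd 12 12 4]))
            (.block (.natAdd 13 13 11) [.natStore 0 13 7, .natAdd 11 11 4, .natStore 1 10 11,
              .natAdd 9 9 4]))))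
        (.block (.natAdd 7 7 4) []))))

open Classical in
/-- The invariant of `slotProgram`: the terms before the `i`-th one, and the first `j` spins of the
`i`-th one, have been entered. -/
structure SlotInv (inp : Input) (M i j : ℕ) (s : Store) : Prop where
  reg0 : s.natReg 0 = M
  reg1 : s.natReg 1 = 0
  reg2 : s.natReg 2 = inp.nat 4 0 0
  reg3 : s.natReg 3 = inp.nat 3 0 0
  reg4 : s.natReg 4 = 1
  reg7 : s.natReg 7 = i
  lt : ∀ x, s.natArr 0 x < inp.nat 4 0 0
  count : ∀ u, s.natArr 1 u = spinRank inp u i + if ∃ j' < j, inp.nat 6 i j' = u then 1 else 0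
  eq : ∀ i' j', j' < inp.nat 5 i' 0 → (i' < i ∨ i' = i ∧ j' < j) →
    s.natArr 0 ((inp.nat 3 0 0 + 1) * inp.nat 6 i' j' + spinRank inp (inp.nat 6 i' j') i') = i'

theorem spinRank_succ (inp : Input) (u i : ℕ) [Decidable (∃ j < inp.nat 5 i 0, inp.nat 6 i j = u)] :
    spinRank inp u (i + 1) = spinRank inp u i +
      if ∃ j < inp.nat 5 i 0, inp.nat 6 i j = u then 1 else 0 := by
  rw [spinRank, Finset.sum_range_succ, spinRank]
  congr

theorem spinRank_lt (inp : Input) {u i i' j : ℕ} (hi : i' < i) (hj : j < inp.nat 5 i' 0)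
    (hu : inp.nat 6 i' j = u) : spinRank inp u i' < spinRank inp u i := by
  classical
  have h1 : spinRank inp u (i' + 1) = spinRank inp u i' + 1 := by
    rw [spinRank_succ, if_pos ⟨j, hj, hu⟩]
  have h2 : spinRank inp u (i' + 1) ≤ spinRank inp u i :=
    Finset.sum_le_sum_of_subset (Finset.range_mono hi)
  omega

/-- The cells reserved for different spins are disjoint. -/
theorem eq_of_mul_add_eq {q u u' a a' : ℕ} (ha : a < q) (ha' : a' < q)
    (h : q * u + a = q * u' + a') : u = u' ∧ a = a' := by
  have hq : 0 < q := by omega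
  have h1 : u = u' := by
    have := congrArg (· / q) h
    simpa [Nat.mul_add_div hq, Nat.div_eq_of_lt ha, Nat.div_eq_of_lt ha'] using this
  subst h1
  exact ⟨rfl, by omega⟩

theorem SlotInv.congr {inp : Input} {M i j : ℕ} {s s' : Store} (h : SlotInv inp M i j s)
    (hr : ∀ r < 8, s'.natReg r = s.natReg r) (h0 : ∀ x, s'.natArr 0 x = s.natArr 0 x)
    (h1 : ∀ x, s'.natArr 1 x = s.natArr 1 x) : SlotInv inp M i j s' where
  reg0 := (hr 0 (by omega)).trans h.reg0
  reg1 := (hr 1 (by omega)).trans h.reg1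
  reg2 := (hr 2 (by omega)).trans h.reg2
  reg3 := (hr 3 (by omega)).trans h.reg3
  reg4 := (hr 4 (by omega)).trans h.reg4
  reg7 := (hr 7 (by omega)).trans h.reg7
  lt x := (h0 x).symm ▸ h.lt x
  count u := (h1 u).trans (h.count u)
  eq i' j' hj hi := (h0 _).trans (h.eq i' j' hj hi)

theorem exec_slotBody {inp : Input} (hL : ListSpec inp) {M i j : ℕ} {s : Store}
    (hi : i < inp.nat 4 0 0) (hj : j < inp.nat 5 i 0) (hs : SlotInv inp M i j s)
    (h8 : s.natReg 8 = inp.nat 5 i 0) (h9 : s.natReg 9 = j) :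
    Exec inp (.seq (.block (.natInput 10 6 7 9) [.natLoad 11 1 10, .natConst 12 0, .natConst 13 0])
          (.seq (.loop (.natLe 12 3) (.block (.natAdd 13 13 10) [.natAdd 12 12 4]))
            (.block (.natAdd 13 13 11) [.natStore 0 13 7, .natAdd 11 11 4, .natStore 1 10 11,
              .natAdd 9 9 4]))) s (3 * inp.nat 3 0 0 + 13)
      (fun s' => SlotInv inp M i (j + 1) s' ∧ s'.natReg 8 = inp.nat 5 i 0 ∧
        s'.natReg 9 = j + 1) := by
  classical
  set u := inp.nat 6 i j with hu
  have hnot : ¬ ∃ j' < j, inp.nat 6 i j' = u := by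
    rintro ⟨j', h1, h2⟩
    have := hL.inj i hi j' (by omega) j hj h2
    omega
  have hcount : s.natArr 1 u = spinRank inp u i := by rw [hs.count, if_neg hnot, add_zero]
  refine Exec.mono (Exec.seq (Exec.block _ _ _) (c' := (inp.nat 3 0 0 + 1) * (2 + 1) + 1 + 5)
    (Q' := fun s' => SlotInv inp M i (j + 1) s' ∧ s'.natReg 8 = inp.nat 5 i 0 ∧
        s'.natReg 9 = j + 1) ?_) (by simp; omega) (fun _ h => h)
  rintro s1 hs1
  refine Exec.seq (Exec.loop (inp.nat 3 0 0 + 1) 2 (fun l s' => SlotInv inp M i j s' ∧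
    s'.natReg 8 = inp.nat 5 i 0 ∧ s'.natReg 9 = j ∧ s'.natReg 10 = u ∧
    s'.natReg 11 = spinRank inp u i ∧ s'.natReg 12 = l ∧ s'.natReg 13 = l * u) ?_ ?_ ?_) ?_
  · rintro l hl t ⟨t0, t1, t2, t3, t4, t5, t6⟩
    refine (Exec.block _ _ _).mono le_rfl ?_
    rintro t' rfl
    refine ⟨t0.congr ?_ ?_ ?_, ?_, ?_, ?_, ?_, ?_, ?_⟩
    · intro r hr
      have h1 : r ≠ 12 := by omega
      have h2 : r ≠ 13 := by omega
      simp [Instr.apply, h1, h2]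
    all_goals simp [Instr.apply, t1, t2, t3, t4, t5, t6, t0.reg4]
    ring
  · rintro l hl t ⟨t0, -, -, -, -, t5, -⟩
    simp only [Test.Holds, t5, t0.reg3]
    omega
  · rw [hs1]
    refine ⟨hs.congr ?_ ?_ ?_, ?_, ?_, ?_, ?_, ?_, ?_⟩
    · intro r hr
      have h0 : r ≠ 10 := by omega
      have h1 : r ≠ 11 := by omega
      have h2 : r ≠ 12 := by omega
      have h3 : r ≠ 13 := by omega
      simp [Instr.apply, h0, h1, h2, h3]
    all_goals simp [Instr.apply, h8, h9, hs.reg7, ← hu, hcount]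
  · rintro t ⟨t0, t1, t2, t3, t4, t5, t6⟩
    refine (Exec.block _ _ _).mono le_rfl ?_
    rintro t' rfl
    refine ⟨⟨?_, ?_, ?_, ?_, ?_, ?_, ?_, ?_, ?_⟩, ?_, ?_⟩
    case refine_7 =>
      intro x
      simp only [Instr.apply, List.foldl, Store.setNat_natArr, Store.setNatArr_natArr,
        Store.setNat_natReg]
      norm_num
      split_ifs
      · rw [t0.reg7]; exact hi
      · exact t0.lt x
    case refine_8 =>
      intro x
      simp only [Instr.apply, List.foldl, Store.setNat_natArr, Store.setNatArr_natArr,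
        Store.setNat_natReg, Store.setNatArr_natReg, t3, t4, t0.reg4]
      norm_num
      split_ifs with h1 h2 h2
      · rw [h1]
      · exact absurd ⟨j, by omega, h1.symm⟩ h2
      · obtain ⟨j', hj', h2⟩ := h2
        have hne : j' ≠ j := by rintro rfl; exact h1 h2.symm
        rw [t0.count, if_pos ⟨j', by omega, h2⟩]
      · rw [t0.count, if_neg]
        rintro ⟨j', hj', h3⟩
        exact h2 ⟨j', by omega, h3⟩
    case refine_9 =>
      intro i' j' hj' hlt
      simp only [Instr.apply, List.foldl, Store.setNat_natArr, Store.setNatArr_natArr,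
        Store.setNat_natReg, Store.setNatArr_natReg, t3, t4, t6, t0.reg4, t0.reg7]
      norm_num
      have hi' : i' ≤ i := by omega
      have hr' := hL.rank_le i' (by omega) j' hj'
      have hr := hL.rank_le i hi j hj
      split_ifs with h1
      · obtain ⟨h2, h3⟩ := eq_of_mul_add_eq (Nat.lt_succ_of_le hr') (Nat.lt_succ_of_le hr) h1
        rcases hi'.lt_or_eq with h4 | h4
        · have := spinRank_lt inp h4 hj' rfl
          rw [h2] at this
          exact absurd h3 (by rw [h2]; exact this.ne)
        · exact h4.symm
      · refine t0.eq i' j' hj' ?_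
        rcases hlt with h4 | ⟨h4, h5⟩
        · exact Or.inl h4
        · refine Or.inr ⟨h4, ?_⟩
          rcases Nat.lt_succ_iff_lt_or_eq.1 h5 with h6 | h6
          · exact h6
          · subst h4 h6
            exact absurd rfl h1
    all_goals simp [Instr.apply, t0.reg0, t0.reg1, t0.reg2, t0.reg3, t0.reg4, t0.reg7, t1, t2]

theorem exec_slotProgram {inp : Input} (hL : ListSpec inp) {M : ℕ} {s : Store}
    (h : s.natReg 0 = M ∧ s.natReg 1 = 0 ∧ s.natReg 2 = inp.nat 4 0 0 ∧
      s.natReg 3 = inp.nat 3 0 0 ∧ s.natReg 4 = 1 ∧ (∀ x, s.natArr 0 x = 0) ∧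
      ∀ x, s.natArr 1 x = 0) :
    Exec inp slotProgram s
      (inp.nat 4 0 0 * (inp.nat 2 0 0 * (3 * inp.nat 3 0 0 + 14) + 5) + 2)
      (fun s' => s'.natReg 0 = M ∧ SlotSpec inp (s'.natArr 0)) := by
  classical
  obtain ⟨h0, h1, h2, h3, h4, h5, h6⟩ := h
  refine (Exec.seq (Exec.block _ _ _) (c' := inp.nat 4 0 0 *
    ((2 + ((inp.nat 2 0 0 * (3 * inp.nat 3 0 0 + 14) + 1) + 1)) + 1) + 1)
    (Q' := fun s' => s'.natReg 0 = M ∧ SlotSpec inp (s'.natArr 0)) ?_).mono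
    (by simp; nlinarith) (fun _ h => h)
  rintro s1 hs1
  refine (Exec.loop (inp.nat 4 0 0) _ (fun i s' => SlotInv inp M i 0 s') ?_ ?_ ?_).mono le_rfl ?_
  · rintro i hi t ht
    refine Exec.seq (Exec.block _ _ _) ?_
    rintro t' ht'
    refine Exec.seq (Q := fun s' => SlotInv inp M i (inp.nat 5 i 0) s') ((Exec.loop
      (inp.nat 5 i 0) _ (fun j s' => SlotInv inp M i j s' ∧
      s'.natReg 8 = inp.nat 5 i 0 ∧ s'.natReg 9 = j)
      (fun j hj x hx => exec_slotBody hL hi hj hx.1 hx.2.1 hx.2.2) ?_ ?_).mono ?_ ?_) ?_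
    · rintro j hj x ⟨-, hx1, hx2⟩
      simp [Test.Holds, hx1, hx2]
    · rw [ht']
      refine ⟨ht.congr ?_ ?_ ?_, ?_, ?_⟩
      · intro r hr
        have h1 : r ≠ 8 := by omega
        have h2 : r ≠ 9 := by omega
        simp [Instr.apply, h1, h2]
      all_goals simp [Instr.apply, ht.reg7, ht.reg1]
    · have := hL.size_le i
      gcongr
    · exact fun _ hx => hx.1
    · rintro x hx
      refine (Exec.block _ _ _).mono le_rfl ?_
      rintro x' rfl
      refine ⟨?_, ?_, ?_, ?_, ?_, ?_, ?_, ?_, ?_⟩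
      case refine_7 => exact hx.lt
      case refine_8 =>
        intro u
        simp only [Instr.apply, List.foldl, Store.setNat_natArr]
        rw [hx.count, spinRank_succ]
        simp
      case refine_9 =>
        intro i' j' hj' hlt
        simp only [Instr.apply, List.foldl, Store.setNat_natArr]
        refine hx.eq i' j' hj' ?_
        rcases hlt with h | ⟨-, h⟩
        · rcases Nat.lt_succ_iff_lt_or_eq.1 h with h | rfl
          · exact Or.inl h
          · exact Or.inr ⟨rfl, hj'⟩
        · omega
      all_goals simp [Instr.apply, hx.reg0, hx.reg1, hx.reg2, hx.reg3, hx.reg4, hx.reg7]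
  · rintro i hi t ht
    simp [Test.Holds, ht.reg7, ht.reg2]
  · rw [hs1]
    refine ⟨?_, ?_, ?_, ?_, ?_, ?_, ?_, ?_, ?_⟩ <;>
      simp [Instr.apply, h0, h1, h2, h3, h4, h5, h6, hL.pos, spinRank]
  · exact fun t ht => ⟨ht.reg0, ht.lt, fun i hi j hj => ht.eq i j hj (Or.inl hi)⟩

/-- The context in which the order of the Taylor expansion and the lists of terms are available. -/
def baseCtx : Ctx where
  Ω := Setup
  setup := id
  base := 1
  Rep S s := s.natReg 0 = S.order ∧ s.natArr 0 = S.slot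
  base_pos := one_pos
  rep_congr h h' := ⟨(h'.natReg 0 one_pos).trans h.1, (h'.natArr 0 one_pos).trans h.2⟩
  rep_order h := h.1
  rep_slot h := h.2

/-- There is a program that computes the output, for every input for which the conditions of
`ListSpec` hold and the error bound gets below the accuracy. -/
theorem exists_program : ∃ (P : Program) (C D : ℕ), ∀ (inp : Input) (M : ℕ) (hL : ListSpec inp),
    (∀ m ≤ M, ((inp.cpx 1 0 0 0).re < errorBound inp m ↔ m < M)) →
    ∃ slot, SlotSpec inp slot ∧ ∃ s T, Runs inp P Store.blank s T ∧
      T ≤ inp.nat 4 0 0 * (C * (Setup.mk inp M slot hL.size_le).bound ^ D) ∧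
      s.cpxReg 0 = (Setup.mk inp M slot hL.size_le).output := by
  obtain ⟨P, c, ⟨C, D, hc⟩, hP⟩ := exec_output baseCtx le_rfl
  have hpb : PolyBdd baseCtx (fun S => S.order * 3 + 24 + (S.loc * (3 * S.deg + 14) + 5) + 2 +
      2 * (C * S.bound ^ D) + 3) :=
    ((((((PolyBdd.order (Γ := baseCtx)).mul (.const 3)).add (.const 24)).add
      ((PolyBdd.loc.mul (((PolyBdd.const 3).mul .deg).add (.const 14))).add (.const 5))).add
      (.const 2)).add ((PolyBdd.const 2).mul ⟨C, D, fun _ => le_rfl⟩)).add (.const 3)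
  obtain ⟨C', D', hC'⟩ := hpb
  refine ⟨.seq orderProgram (.seq slotProgram (.seq P
    (.block (.natConst 1 0) [.cpxOfNat 0 1, .cpxAdd 0 1 0]))), C', D', fun inp M hL hM => ?_⟩
  obtain ⟨s1, T1, hr1, hT1, hs1⟩ := exec_orderProgram hM
  obtain ⟨s2, T2, hr2, hT2, hs2⟩ := exec_slotProgram hL hs1
  refine ⟨s2.natArr 0, hs2.2, ?_⟩
  set S : Setup := ⟨inp, M, s2.natArr 0, hL.size_le⟩ with hS
  obtain ⟨s3, T3, hr3, hT3, hs3⟩ := hP S s2 ⟨hs2.1, rfl⟩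
  obtain ⟨s4, T4, hr4, hT4, hs4⟩ := Exec.block (inp := inp) (.natConst 1 0)
    [.cpxOfNat 0 1, .cpxAdd 0 1 0] s3
  refine ⟨s4, _, .seq hr1 (.seq hr2 (.seq hr3 hr4)), ?_, ?_⟩
  · refine le_trans ?_ (Nat.mul_le_mul_left _ (hC' S))
    have hN := hL.pos
    have h3 : T3 ≤ (inp.nat 4 0 0 + 1) * (C * S.bound ^ D) :=
      hT3.trans (Nat.mul_le_mul_left _ (hc S))
    simp only [List.length] at hT4
    change T1 + (T2 + (T3 + T4)) ≤ inp.nat 4 0 0 * (M * 3 + 24 + (inp.nat 2 0 0 *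
      (3 * inp.nat 3 0 0 + 14) + 5) + 2 + 2 * (C * S.bound ^ D) + 3)
    generalize inp.nat 4 0 0 = N at *
    generalize C * S.bound ^ D = X at *
    generalize inp.nat 2 0 0 * (3 * inp.nat 3 0 0 + 14) = Y at *
    nlinarith [Nat.zero_le X, Nat.zero_le Y, Nat.mul_le_mul_right X hN,
      Nat.mul_le_mul_right M hN]
  · rw [hs4]
    have h : s3.cpxReg 1 = S.output := hs3.2
    simpa [Instr.apply] using h


/-! ### Sums over subsets -/

section Subsets

variable {ι : Type*} [DecidableEq ι]

theorem sum_powerset_union {R : Type*} [AddCommMonoid R] {A B : Finset ι} (h : Disjoint A B)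
    (f : Finset ι → R) : ∑ C ∈ (A ∪ B).powerset, f C =
      ∑ C ∈ A.powerset, ∑ C' ∈ B.powerset, f (C ∪ C') := by
  induction B using Finset.induction_on generalizing f with
  | empty => simp
  | insert x B hx ih =>
    rw [Finset.disjoint_insert_right] at h
    rw [Finset.union_insert, Finset.sum_powerset_insert (by simp [h.1, hx]), ih h.2, ih h.2,
      ← Finset.sum_add_distrib]
    refine Finset.sum_congr rfl fun C _ => ?_
    rw [Finset.sum_powerset_insert hx]
    simp only [Finset.union_insert]

/-- A function of finite sets is determined by its sums over all the subsets of a set. -/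
theorem eq_of_sum_powerset_eq {R : Type*} [AddCommGroup R] {f g : Finset ι → R}
    (h : ∀ B : Finset ι, ∑ A ∈ B.powerset, f A = ∑ A ∈ B.powerset, g A) (A : Finset ι) :
    f A = g A := by
  induction A using Finset.strongInduction with
  | H A ih =>
    have h1 := h A
    rw [← Finset.sum_erase_add _ _ (Finset.mem_powerset_self A),
      ← Finset.sum_erase_add _ _ (Finset.mem_powerset_self A), Finset.sum_congr rfl, add_right_inj]
      at h1
    · exact h1
    · intro B hB
      rw [Finset.mem_erase, Finset.mem_powerset] at hB
      exact ih B (hB.2.ssubset_of_ne hB.1)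

/-- The alternating sum of `f` over the subsets of `A`. -/
def altSum (f : Finset ι → ℂ) (A : Finset ι) : ℂ :=
  (-1) ^ A.card * ∑ B ∈ A.powerset, (-1) ^ B.card * f B

theorem altSum_insert (f : Finset ι → ℂ) {x : ι} {A : Finset ι} (hx : x ∉ A) :
    altSum f (insert x A) = altSum (fun B => f (insert x B)) A - altSum f A := by
  have h : ∑ B ∈ A.powerset, (-1 : ℂ) ^ (insert x B).card * f (insert x B) =
      -∑ B ∈ A.powerset, (-1) ^ B.card * f (insert x B) := by
    rw [← Finset.sum_neg_distrib]
    refine Finset.sum_congr rfl fun B hB => ?_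
    rw [Finset.card_insert_of_notMem fun h => hx (Finset.mem_powerset.1 hB h), pow_succ]
    ring
  rw [altSum, Finset.sum_powerset_insert hx, h, Finset.card_insert_of_notMem hx, altSum, altSum]
  ring

/-- Möbius inversion. -/
theorem sum_altSum (f : Finset ι → ℂ) (B : Finset ι) :
    ∑ A ∈ B.powerset, altSum f A = f B := by
  induction B using Finset.induction_on generalizing f with
  | empty => simp [altSum]
  | insert x B hx ih =>
    rw [Finset.sum_powerset_insert hx, Finset.sum_congr rfl fun A hA =>
      altSum_insert f fun h => hx (Finset.mem_powerset.1 hA h), Finset.sum_sub_distrib, ih, ih]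
    ring

theorem altSum_of_sum {f g : Finset ι → ℂ} (h : ∀ B, f B = ∑ A ∈ B.powerset, g A)
    (A : Finset ι) : altSum f A = g A :=
  eq_of_sum_powerset_eq (fun B => by rw [sum_altSum, h]) A

/-- The alternating sum vanishes for a function that is additive with respect to a partition of the
set. -/
theorem altSum_eq_zero_of_additive {f : Finset ι → ℂ} {A B : Finset ι} (hAB : Disjoint A B)
    (hA : A.Nonempty) (hB : B.Nonempty)
    (h : ∀ A' ⊆ A, ∀ B' ⊆ B, f (A' ∪ B') = f A' + f B') : altSum f (A ∪ B) = 0 := by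
  have h0 : ∀ {C : Finset ι}, C.Nonempty → ∑ D ∈ C.powerset, (-1 : ℂ) ^ D.card = 0 := by
    intro C hC
    have := Finset.sum_powerset_neg_one_pow_card_of_nonempty hC
    exact_mod_cast this
  rw [altSum, sum_powerset_union hAB]
  have h1 : ∀ A' ∈ A.powerset, ∑ B' ∈ B.powerset, (-1 : ℂ) ^ (A' ∪ B').card * f (A' ∪ B') =
      (-1) ^ A'.card * ∑ B' ∈ B.powerset, (-1) ^ B'.card * f B' := by
    intro A' hA'
    rw [Finset.mem_powerset] at hA'
    have : ∑ B' ∈ B.powerset, (-1 : ℂ) ^ (A' ∪ B').card * f (A' ∪ B') =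
        ∑ B' ∈ B.powerset, ((-1) ^ A'.card * f A' * (-1) ^ B'.card +
          (-1) ^ A'.card * ((-1) ^ B'.card * f B')) := by
      refine Finset.sum_congr rfl fun B' hB' => ?_
      rw [Finset.mem_powerset] at hB'
      rw [h A' hA' B' hB', Finset.card_union_of_disjoint
        (Finset.disjoint_of_subset_left hA' (Finset.disjoint_of_subset_right hB' hAB)), pow_add]
      ring
    rw [this, Finset.sum_add_distrib, ← Finset.mul_sum, ← Finset.mul_sum, h0 hB, mul_zero, zero_add]
  rw [Finset.sum_congr rfl h1, ← Finset.sum_mul, h0 hA, zero_mul, mul_zero]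

/-- The alternating sum over the subsets of the image of a map can be taken over the subsets of the
domain: the contributions of the fibers cancel, except for a sign. -/
theorem sum_powerset_image {κ : Type*} [DecidableEq κ] (p : κ → ι) (I : Finset κ)
    (f : Finset ι → ℂ) : ∑ b ∈ I.powerset, (-1) ^ b.card * f (b.image p) =
      ∑ B ∈ (I.image p).powerset, (-1) ^ B.card * f B := by
  induction I using Finset.induction_on generalizing f with
  | empty => simp
  | insert i I hi ih =>
    have h1 : ∑ b ∈ I.powerset, (-1 : ℂ) ^ (insert i b).card * f ((insert i b).image p) =
        -∑ b ∈ I.powerset, (-1) ^ b.card * f (insert (p i) (b.image p)) := by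
      rw [← Finset.sum_neg_distrib]
      refine Finset.sum_congr rfl fun b hb => ?_
      rw [Finset.card_insert_of_notMem fun h => hi (Finset.mem_powerset.1 hb h), pow_succ,
        Finset.image_insert]
      ring
    have key : ∀ {x : ι} {A : Finset ι}, x ∉ A →
        ∑ B ∈ A.powerset, (-1 : ℂ) ^ (insert x B).card * f (insert x B) =
        -∑ B ∈ A.powerset, (-1) ^ B.card * f (insert x B) := by
      intro x A hx
      rw [← Finset.sum_neg_distrib]
      refine Finset.sum_congr rfl fun B hB => ?_
      rw [Finset.card_insert_of_notMem fun h => hx (Finset.mem_powerset.1 hB h), pow_succ]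
      ring
    rw [Finset.sum_powerset_insert hi, h1, ih f, ih (fun B => f (insert (p i) B)),
      Finset.image_insert]
    by_cases hp : p i ∈ I.image p
    · -- the sum of `f (insert x B)` over `B ⊆ A` vanishes if `x ∈ A`
      have h2 : ∑ B ∈ (I.image p).powerset, (-1 : ℂ) ^ B.card * f (insert (p i) B) = 0 := by
        rw [← Finset.insert_erase hp, Finset.sum_powerset_insert (Finset.notMem_erase _ _)]
        simp only [Finset.insert_idem]
        rw [key (Finset.notMem_erase _ _)]
        ring
      rw [h2, Finset.insert_eq_of_mem hp]
      ring
    · rw [Finset.sum_powerset_insert hp, key hp]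

/-! ### Surjective words -/

/-- The sum of the products `h j₁ * ⋯ * h jₘ` over the words of length `m` in which exactly the
letters in `A` occur. These are the Möbius coefficients of `B ↦ (∑ j ∈ B, h j) ^ m`. The recursion
splits off the first letter `j`, which may or may not occur again. -/
def surjSum {R : Type*} [Semiring R] (h : ι → R) : ℕ → Finset ι → R
  | 0, A => if A = ∅ then 1 else 0
  | m + 1, A => ∑ j ∈ A, h j * (surjSum h m A + surjSum h m (A.erase j))

theorem sum_surjSum {R : Type*} [Semiring R] (h : ι → R) (m : ℕ) (B : Finset ι) :
    ∑ A ∈ B.powerset, surjSum h m A = (∑ j ∈ B, h j) ^ m := by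
  induction m with
  | zero =>
    simp [surjSum]
  | succ m ih =>
    have h1 : ∀ A ∈ B.powerset, surjSum h (m + 1) A = ∑ j ∈ B, if j ∈ A then
        h j * (surjSum h m A + surjSum h m (A.erase j)) else 0 := by
      intro A hA
      rw [surjSum, ← Finset.sum_filter, Finset.filter_mem_eq_inter,
        Finset.inter_eq_right.2 (Finset.mem_powerset.1 hA)]
    rw [Finset.sum_congr rfl h1, Finset.sum_comm, pow_succ', Finset.sum_mul]
    refine Finset.sum_congr rfl fun j hj => ?_
    rw [← ih, ← Finset.insert_erase hj, Finset.sum_powerset_insert (Finset.notMem_erase _ _),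
      Finset.sum_powerset_insert (Finset.notMem_erase _ _), Finset.sum_eq_zero, zero_add,
      ← Finset.sum_add_distrib, Finset.mul_sum]
    · refine Finset.sum_congr rfl fun A hA => ?_
      rw [Finset.mem_powerset] at hA
      rw [if_pos (Finset.mem_insert_self _ _), Finset.erase_insert fun h =>
        Finset.notMem_erase _ _ (hA h), add_comm]
    · intro A hA
      rw [Finset.mem_powerset] at hA
      rw [if_neg fun h => Finset.notMem_erase _ _ (hA h)]

theorem surjSum_eq_zero {R : Type*} [Semiring R] (h : ι → R) {m : ℕ} {A : Finset ι}
    (hm : m < A.card) : surjSum h m A = 0 := by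
  induction m generalizing A with
  | zero =>
    rw [surjSum, if_neg]
    rintro rfl
    simp at hm
  | succ m ih =>
    refine Finset.sum_eq_zero fun j hj => ?_
    rw [ih (by omega), ih (by rw [Finset.card_erase_of_mem hj]; omega), add_zero, mul_zero]

theorem surjSum_one_nonneg (m : ℕ) (A : Finset ι) : 0 ≤ surjSum (fun _ => (1 : ℝ)) m A := by
  induction m generalizing A with
  | zero => rw [surjSum]; split_ifs <;> norm_num
  | succ m ih =>
    exact Finset.sum_nonneg fun j _ => by rw [one_mul]; exact add_nonneg (ih _) (ih _)

theorem norm_surjSum_le {R : Type*} [NormedRing R] (h1 : ‖(1 : R)‖ ≤ 1) {h : ι → R}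
    (hh : ∀ j, ‖h j‖ ≤ 1) (m : ℕ) (A : Finset ι) :
    ‖surjSum h m A‖ ≤ surjSum (fun _ => (1 : ℝ)) m A := by
  induction m generalizing A with
  | zero =>
    rw [surjSum, surjSum]
    split_ifs
    · exact h1
    · simp
  | succ m ih =>
    refine (norm_sum_le _ _).trans (Finset.sum_le_sum fun j _ => ?_)
    refine (norm_mul_le _ _).trans (mul_le_mul (hh j) ?_ (norm_nonneg _) zero_le_one)
    exact (norm_add_le _ _).trans (add_le_add (ih _) (ih _))

theorem surjSum_one_le_pow (m : ℕ) (A : Finset ι) :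
    surjSum (fun _ => (1 : ℝ)) m A ≤ (A.card : ℝ) ^ m := by
  have h := sum_surjSum (fun _ : ι => (1 : ℝ)) m A
  simp only [Finset.sum_const, nsmul_eq_mul, mul_one] at h
  rw [← h]
  exact Finset.single_le_sum (f := fun A => surjSum (fun _ => (1 : ℝ)) m A)
    (fun B _ => surjSum_one_nonneg m B) (Finset.mem_powerset_self A)

theorem summable_pow_div_factorial (c x : ℝ) :
    Summable fun m : ℕ => c ^ m * x ^ m / m.factorial := by
  simpa only [mul_pow] using Real.summable_pow_div_factorial (c * x)

theorem summable_surjSum_one {x : ℝ} (hx : 0 ≤ x) (A : Finset ι) :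
    Summable fun m : ℕ => surjSum (fun _ => (1 : ℝ)) m A * x ^ m / m.factorial := by
  refine Summable.of_nonneg_of_le (fun m => ?_) (fun m => ?_)
    (summable_pow_div_factorial A.card x)
  · have := surjSum_one_nonneg m A
    positivity
  · gcongr
    exact surjSum_one_le_pow m A

/-- The exponential generating function of the number of surjective words. -/
theorem tsum_surjSum_one {x : ℝ} (hx : 0 ≤ x) (A : Finset ι) :
    ∑' m : ℕ, surjSum (fun _ => (1 : ℝ)) m A * x ^ m / m.factorial =
      (Real.exp x - 1) ^ A.card := by
  refine eq_of_sum_powerset_eq (f := fun A =>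
    ∑' m : ℕ, surjSum (fun _ => (1 : ℝ)) m A * x ^ m / m.factorial)
    (g := fun A => (Real.exp x - 1) ^ A.card) (fun B => ?_) A
  rw [← Summable.tsum_finsetSum fun A _ => summable_surjSum_one hx A]
  have h1 := Finset.sum_pow_mul_eq_add_pow (Real.exp x - 1) 1 B
  simp only [one_pow, mul_one, sub_add_cancel] at h1
  rw [h1, ← Real.exp_nat_mul, Real.exp_eq_exp_ℝ, NormedSpace.exp_eq_tsum_div]
  refine tsum_congr fun m => ?_
  rw [← Finset.sum_div, ← Finset.sum_mul, sum_surjSum]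
  simp [mul_pow]

end Subsets


/-! ### A zero-free region from the Möbius coefficients -/

section ZeroFree

variable {ι : Type*}

/-- The sets `A` and `B` have no common vertices and no edges between them. -/
def Separated (G : SimpleGraph ι) (A B : Finset ι) : Prop :=
  Disjoint A B ∧ ∀ a ∈ A, ∀ b ∈ B, ¬ G.Adj a b

theorem Separated.mono {G : SimpleGraph ι} {A B A' B' : Finset ι} (h : Separated G A B)
    (hA : A' ⊆ A) (hB : B' ⊆ B) : Separated G A' B' :=
  ⟨Finset.disjoint_of_subset_left hA (Finset.disjoint_of_subset_right hB h.1),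
    fun a ha b hb => h.2 a (hA ha) b (hB hb)⟩

/-- The graph `G` has maximal degree at most `Δ`. -/
def DegreeLE (G : SimpleGraph ι) (Δ : ℕ) : Prop :=
  ∀ (x : ι) (A : Finset ι), (∀ y ∈ A, G.Adj x y) → A.card ≤ Δ

variable [DecidableEq ι]

theorem altSum_union_eq_mul {f : Finset ι → ℂ} {A B : Finset ι} (hAB : Disjoint A B)
    (h : ∀ A' ⊆ A, ∀ B' ⊆ B, f (A' ∪ B') = f A' * f B') :
    altSum f (A ∪ B) = altSum f A * altSum f B := by
  rw [altSum, altSum, altSum, sum_powerset_union hAB, Finset.card_union_of_disjoint hAB, pow_add]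
  have : ∑ A' ∈ A.powerset, ∑ B' ∈ B.powerset, (-1 : ℂ) ^ (A' ∪ B').card * f (A' ∪ B') =
      (∑ A' ∈ A.powerset, (-1) ^ A'.card * f A') * ∑ B' ∈ B.powerset, (-1) ^ B'.card * f B' := by
    rw [Finset.sum_mul_sum]
    refine Finset.sum_congr rfl fun A' hA => Finset.sum_congr rfl fun B' hB => ?_
    rw [Finset.mem_powerset] at hA hB
    rw [h A' hA B' hB, Finset.card_union_of_disjoint
      (Finset.disjoint_of_subset_left hA (Finset.disjoint_of_subset_right hB hAB)), pow_add]
    ring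
  rw [this]
  ring

/-- The part of `f (C ∪ D)` that consists of the Möbius coefficients of the sets containing `D`. -/
def containing (f : Finset ι → ℂ) (D C : Finset ι) : ℂ :=
  ∑ A ∈ C.powerset, altSum f (D ∪ A)

variable {G : SimpleGraph ι} {Δ : ℕ} {f : Finset ι → ℂ} {u g : ℝ}

open Classical in
/-- The contribution of the sets containing `D`, compared with `f C`. The neighbors of `D` in `C`
are treated one after the other: each either is removed, which costs a factor `g`, or joins `D`,
which costs a factor `u` and creates up to `Δ` new neighbors. -/
theorem norm_containing_le (hG : DegreeLE G Δ) (hu : 0 ≤ u) (hg : 1 ≤ g)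
    (hug : 1 + u * g ^ (2 * Δ) ≤ g)
    (hmul : ∀ A B, Separated G A B → f (A ∪ B) = f A * f B)
    (hf : ∀ A, ‖altSum f A‖ ≤ u ^ A.card) (C D : Finset ι) (hCD : Disjoint D C)
    (hC : ∀ C' ⊆ C, ∀ y ∈ C', ‖f (C'.erase y)‖ ≤ g * ‖f C'‖) :
    ‖containing f D C‖ ≤
      u ^ D.card * g ^ (2 * (C.filter fun c => ∃ a ∈ D, G.Adj a c).card) * ‖f C‖ := by
  induction C using Finset.strongInduction generalizing D with
  | H C ih =>
    rcases (C.filter fun c => ∃ a ∈ D, G.Adj a c).eq_empty_or_nonempty with h0 | ⟨y, hy⟩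
    · have hsep : Separated G D C := by
        refine ⟨hCD, fun a ha b hb hab => ?_⟩
        have : b ∈ C.filter fun c => ∃ a ∈ D, G.Adj a c := Finset.mem_filter.2 ⟨hb, a, ha, hab⟩
        rw [h0] at this
        simp at this
      have h1 : containing f D C = altSum f D * f C := by
        rw [containing, ← sum_altSum f C, Finset.mul_sum]
        refine Finset.sum_congr rfl fun A hA => ?_
        rw [Finset.mem_powerset] at hA
        have h2 := hsep.mono subset_rfl hA
        exact altSum_union_eq_mul h2.1 fun A' hA' B' hB' => hmul _ _ (h2.mono hA' hB')
      rw [h1, h0, norm_mul]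
      simpa using mul_le_mul_of_nonneg_right (hf D) (norm_nonneg (f C))
    · set N := C.filter fun c => ∃ a ∈ D, G.Adj a c with hN
      have hyC : y ∈ C := (Finset.mem_filter.1 hy).1
      have hss : C.erase y ⊂ C := Finset.erase_ssubset hyC
      have hyD : y ∉ D := fun h => Finset.disjoint_left.1 hCD h hyC
      have hsplit : containing f D C =
          containing f D (C.erase y) + containing f (insert y D) (C.erase y) := by
        rw [containing, ← Finset.insert_erase hyC,
          Finset.sum_powerset_insert (Finset.notMem_erase _ _), containing, containing,
          Finset.erase_insert (Finset.notMem_erase _ _)]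
        simp only [Finset.union_insert, Finset.insert_union]
      have hC' : ∀ C' ⊆ C.erase y, ∀ y ∈ C', ‖f (C'.erase y)‖ ≤ g * ‖f C'‖ :=
        fun C' h => hC C' (h.trans hss.subset)
      have h1 := ih _ hss D (Finset.disjoint_of_subset_right hss.subset hCD) hC'
      have h2 := ih _ hss (insert y D) (Finset.disjoint_insert_left.2
        ⟨Finset.notMem_erase _ _, Finset.disjoint_of_subset_right hss.subset hCD⟩) hC'
      have h3 := hC C subset_rfl y hyC
      have hcard1 : ((C.erase y).filter fun c => ∃ a ∈ D, G.Adj a c).card = N.card - 1 := by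
        rw [← Finset.card_erase_of_mem hy, hN, Finset.filter_erase]
      have hNpos : 0 < N.card := Finset.card_pos.2 ⟨y, hy⟩
      have hcard2 : ((C.erase y).filter fun c => ∃ a ∈ insert y D, G.Adj a c).card ≤
          N.card - 1 + Δ := by
        rw [← hcard1]
        refine (Finset.card_le_card (t := ((C.erase y).filter fun c => ∃ a ∈ D, G.Adj a c) ∪
          (C.erase y).filter fun c => G.Adj y c) ?_).trans
          ((Finset.card_union_le _ _).trans (Nat.add_le_add_left (hG y _ ?_) _))
        · intro c hc
          simp only [Finset.mem_filter, Finset.mem_insert, Finset.mem_union] at hc ⊢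
          obtain ⟨hc, a, rfl | ha, hac⟩ := hc
          · exact Or.inr ⟨hc, hac⟩
          · exact Or.inl ⟨hc, a, ha, hac⟩
        · exact fun c hc => (Finset.mem_filter.1 hc).2
      rw [hcard1] at h1
      rw [Finset.card_insert_of_notMem hyD] at h2
      have h0g : (0 : ℝ) ≤ g := zero_le_one.trans hg
      obtain ⟨N', hN'⟩ : ∃ N', N.card = N' + 1 := ⟨N.card - 1, by omega⟩
      rw [hN', Nat.add_sub_cancel] at h1 hcard2
      rw [hsplit, hN']
      calc _ ≤ _ := norm_add_le _ _
        _ ≤ u ^ D.card * g ^ (2 * N') * (g * ‖f C‖) +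
            u ^ (D.card + 1) * g ^ (2 * (N' + Δ)) * (g * ‖f C‖) := by
          refine add_le_add (h1.trans ?_) (h2.trans ?_)
          · exact mul_le_mul_of_nonneg_left h3 (by positivity)
          · refine mul_le_mul ?_ h3 (norm_nonneg _) (by positivity)
            exact mul_le_mul_of_nonneg_left (pow_le_pow_right₀ hg (by omega)) (by positivity)
        _ = u ^ D.card * g ^ (2 * N') * g * ‖f C‖ * (1 + u * g ^ (2 * Δ)) := by ring
        _ ≤ u ^ D.card * g ^ (2 * N') * g * ‖f C‖ * g :=
          mul_le_mul_of_nonneg_left hug (by positivity)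
        _ = _ := by ring

/-- If the Möbius coefficients of a multiplicative set function are small, adding one element to the
set changes the value by a small factor. -/
theorem norm_sub_erase_le (hG : DegreeLE G Δ) (hu : 0 ≤ u) (hΔ : 1 ≤ Δ)
    (huΔ : u * Real.exp 1 * (2 * Δ + 1) ≤ 1)
    (hmul : ∀ A B, Separated G A B → f (A ∪ B) = f A * f B)
    (hf : ∀ A, ‖altSum f A‖ ≤ u ^ A.card) {C : Finset ι} {y : ι} (hy : y ∈ C) :
    ‖f C - f (C.erase y)‖ ≤ 1 / (2 * Δ + 1) * ‖f (C.erase y)‖ := by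
  classical
  have hΔ' : (1 : ℝ) ≤ Δ := by exact_mod_cast hΔ
  -- with this `g`, one has `1 - 1 / (2 Δ + 1) = 1 / g`, and `g ^ (2 Δ) ≤ e`
  set g : ℝ := 1 + 1 / (2 * Δ) with hgdef
  have hg : 1 ≤ g := by rw [hgdef]; simp
  have hpow : g ^ (2 * Δ) ≤ Real.exp 1 := by
    have h1 : g ≤ Real.exp (1 / (2 * Δ)) := by
      rw [hgdef, add_comm]; exact Real.add_one_le_exp _
    refine (pow_le_pow_left₀ (zero_le_one.trans hg) h1 _).trans_eq ?_
    rw [← Real.exp_nat_mul]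
    push_cast
    congr 1
    field_simp
  have hu1 : u * g ^ (2 * Δ) ≤ 1 / (2 * Δ + 1) := by
    rw [le_div_iff₀ (by positivity)]
    exact le_trans (by gcongr) huΔ
  have hug : 1 + u * g ^ (2 * Δ) ≤ g := by
    refine add_le_add_right (hu1.trans ?_) 1
    exact one_div_le_one_div_of_le (by positivity) (by linarith)
  induction C using Finset.strongInduction generalizing y with
  | H C ih =>
    have key : f C - f (C.erase y) = containing f {y} (C.erase y) := by
      rw [← sum_altSum f C, ← Finset.insert_erase hy,
        Finset.sum_powerset_insert (Finset.notMem_erase _ _), sum_altSum,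
        Finset.erase_insert (Finset.notMem_erase _ _), add_sub_cancel_left, containing]
      rfl
    have hstep : ∀ C' ⊆ C.erase y, ∀ x ∈ C', ‖f (C'.erase x)‖ ≤ g * ‖f C'‖ := by
      intro C' hC' x hx
      have h1 := ih C' (lt_of_le_of_lt hC' (Finset.erase_ssubset hy)) hx
      have h2 : ‖f (C'.erase x)‖ ≤ ‖f C'‖ + ‖f C' - f (C'.erase x)‖ := by
        simpa using norm_sub_le (f C') (f C' - f (C'.erase x))
      have h3 : g * (1 - 1 / (2 * Δ + 1)) = 1 := by rw [hgdef]; field_simp; ring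
      have h4 : (1 - 1 / (2 * Δ + 1)) * ‖f (C'.erase x)‖ ≤ ‖f C'‖ := by linarith
      calc _ = g * ((1 - 1 / (2 * Δ + 1)) * ‖f (C'.erase x)‖) := by rw [← mul_assoc, h3, one_mul]
        _ ≤ _ := mul_le_mul_of_nonneg_left h4 (zero_le_one.trans hg)
    rw [key]
    refine (norm_containing_le hG hu hg hug hmul hf _ _ (by simp) hstep).trans ?_
    refine mul_le_mul_of_nonneg_right (le_trans ?_ hu1) (norm_nonneg _)
    rw [Finset.card_singleton, pow_one]
    refine mul_le_mul_of_nonneg_left (pow_le_pow_right₀ hg ?_) hu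
    refine Nat.mul_le_mul_left _ (hG y _ fun c hc => ?_)
    simpa using (Finset.mem_filter.1 hc).2

end ZeroFree


/-! ### Taylor coefficients of logarithms -/

section Taylor

/-- The coefficient of `z ^ m` in the Taylor series of `f` at the origin. -/
noncomputable def taylorCoeff (f : ℂ → ℂ) (m : ℕ) : ℂ := iteratedDeriv m f 0 / m.factorial

theorem taylorCoeff_eq_of_hasSum {f : ℂ → ℂ} {a : ℕ → ℂ}
    (h : ∀ᶠ z in nhds (0 : ℂ), HasSum (fun m => a m * z ^ m) (f z)) : taylorCoeff f = a := by
  have h1 : HasFPowerSeriesAt f (FormalMultilinearSeries.ofScalars ℂ a) 0 := by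
    rw [hasFPowerSeriesAt_iff]
    filter_upwards [h] with z hz
    simpa [FormalMultilinearSeries.coeff_ofScalars, mul_comm] using hz
  have h2 := h1.analyticAt.hasFPowerSeriesAt
  exact FormalMultilinearSeries.ofScalars_series_injective ℂ (E := ℂ)
    (h2.eq_formalMultilinearSeries h1)

theorem taylorCoeff_deriv (f : ℂ → ℂ) (m : ℕ) :
    taylorCoeff (deriv f) m = (m + 1) * taylorCoeff f (m + 1) := by
  rw [taylorCoeff, taylorCoeff, iteratedDeriv_succ', Nat.factorial_succ]
  have := Nat.factorial_ne_zero m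
  push_cast
  field_simp

theorem taylorCoeff_mul {f g : ℂ → ℂ} (hf : AnalyticAt ℂ f 0) (hg : AnalyticAt ℂ g 0) (m : ℕ) :
    taylorCoeff (fun z => f z * g z) m =
      ∑ i ∈ Finset.range (m + 1), taylorCoeff f i * taylorCoeff g (m - i) := by
  rw [taylorCoeff, iteratedDeriv_fun_mul hf.contDiffAt hg.contDiffAt, Finset.sum_div]
  refine Finset.sum_congr rfl fun i hi => ?_
  have hi' : i ≤ m := Nat.lt_succ_iff.1 (Finset.mem_range.1 hi)
  rw [taylorCoeff, taylorCoeff, ← Nat.choose_mul_factorial_mul_factorial hi']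
  have h1 := Nat.factorial_ne_zero i
  have h2 := Nat.factorial_ne_zero (m - i)
  have h3 : (m.choose i : ℂ) ≠ 0 := by exact_mod_cast (Nat.choose_pos hi').ne'
  push_cast
  field_simp

/-- The derivative of a logarithm `F` of `f` satisfies `F' f = f'`; comparing coefficients gives the
recursion that defines `dlogCoeff`. -/
theorem succ_mul_taylorCoeff_eq_dlogCoeff {f F : ℂ → ℂ} (hF : AnalyticAt ℂ F 0) (hf0 : f 0 = 1)
    (h : ∀ᶠ z in nhds (0 : ℂ), Complex.exp (F z) = f z) (m : ℕ) :
    ((m : ℂ) + 1) * taylorCoeff F (m + 1) = dlogCoeff (taylorCoeff f) m := by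
  have hf : AnalyticAt ℂ f 0 := (hF.cexp).congr h
  have hderiv : deriv f =ᶠ[nhds 0] fun z => deriv F z * f z := by
    filter_upwards [h.eventually_nhds, hF.eventually_analyticAt] with z hz hFz
    have h1 : deriv f z = deriv (fun z => Complex.exp (F z)) z :=
      (Filter.EventuallyEq.deriv_eq hz).symm
    rw [h1, (hFz.differentiableAt.hasDerivAt.cexp).deriv, hz.self_of_nhds, mul_comm]
  induction m using Nat.strong_induction_on with
  | _ m ih =>
    have h1 : taylorCoeff (deriv f) m = taylorCoeff (fun z => deriv F z * f z) m := by
      rw [taylorCoeff, taylorCoeff, hderiv.iteratedDeriv_eq]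
    have h0 : taylorCoeff f 0 = 1 := by simp [taylorCoeff, hf0]
    rw [taylorCoeff_deriv, taylorCoeff_mul hF.deriv hf, Finset.sum_range_succ, Nat.sub_self, h0,
      mul_one, taylorCoeff_deriv] at h1
    rw [dlogCoeff_eq, h1, Finset.sum_congr rfl fun i hi => by
      rw [taylorCoeff_deriv, ih i (Finset.mem_range.1 hi)], add_sub_cancel_left]

/-- Truncating the Taylor series of a bounded function, by the Cauchy estimates. -/
theorem norm_sub_taylor_le {F : ℂ → ℂ} {R K : ℝ}
    (hF : DifferentiableOn ℂ F (Metric.ball 0 R)) (hK : ∀ z ∈ Metric.ball (0 : ℂ) R, ‖F z‖ ≤ K)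
    {t : ℂ} (ht : ‖t‖ < R) (M : ℕ) :
    ‖F t - ∑ m ∈ Finset.range M, taylorCoeff F m * t ^ m‖ ≤
      K * (‖t‖ / R) ^ M / (1 - ‖t‖ / R) := by
  have hR : 0 < R := (norm_nonneg t).trans_lt ht
  have hcoef : ∀ m, ‖taylorCoeff F m‖ ≤ K / R ^ m := by
    intro m
    have h1 : ∀ r ∈ Set.Ioo 0 R, ‖taylorCoeff F m‖ ≤ K / r ^ m := by
      intro r hr
      have h2 := Complex.norm_iteratedDeriv_le_of_forall_mem_sphere_norm_le (c := 0) (C := K) m hr.1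
        ((hF.mono (by
          rw [closure_ball _ hr.1.ne']
          exact Metric.closedBall_subset_ball hr.2)).diffContOnCl)
        fun z hz => hK z (by
          rw [mem_sphere_zero_iff_norm] at hz; rw [mem_ball_zero_iff, hz]; exact hr.2)
      rw [taylorCoeff, norm_div, Complex.norm_natCast, div_le_iff₀ (by positivity)]
      exact h2.trans_eq (by ring)
    refine ge_of_tendsto (f := fun r => K / r ^ m) (x := nhdsWithin R (Set.Iio R)) ?_ ?_
    · have : ContinuousAt (fun r : ℝ => K / r ^ m) R :=
        continuousAt_const.div (continuousAt_id.pow m) (pow_ne_zero _ hR.ne')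
      exact this.tendsto.mono_left nhdsWithin_le_nhds
    · filter_upwards [Ioo_mem_nhdsLT hR] with r hr using h1 r hr
  have hq0 : 0 ≤ ‖t‖ / R := by positivity
  have hq : ‖t‖ / R < 1 := (div_lt_one hR).2 ht
  have hsum : HasSum (fun m => taylorCoeff F m * t ^ m) (F t) := by
    refine (Complex.hasSum_taylorSeries_on_ball hF (mem_ball_zero_iff.2 ht)).congr_fun fun m => ?_
    simp only [taylorCoeff, sub_zero, smul_eq_mul]
    ring
  have htail := (hasSum_nat_add_iff' M).2 hsum
  rw [← htail.tsum_eq]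
  have hgeo := (hasSum_geometric_of_lt_one hq0 hq).mul_left (K * (‖t‖ / R) ^ M)
  refine (tsum_of_norm_bounded hgeo fun m => ?_).trans_eq (div_eq_mul_inv _ _).symm
  rw [norm_mul, norm_pow]
  calc _ ≤ K / R ^ (m + M) * ‖t‖ ^ (m + M) :=
        mul_le_mul_of_nonneg_right (hcoef _) (by positivity)
    _ = _ := by rw [div_pow, div_pow, pow_add, pow_add]; field_simp

end Taylor

/-! ### The logarithm of a cluster series -/

section ClusterSeries

variable {ι : Type*} [DecidableEq ι]

/-- The hypotheses on the coefficients `l B m` of the power series attached to the finite sets `B`: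
the series is multiplicative on separated sets, and the Möbius coefficients satisfy the bound that
comes from sums over surjective words. -/
structure IsClusterSeries (G : SimpleGraph ι) (l : Finset ι → ℕ → ℂ) : Prop where
  coeff_zero : ∀ B, l B 0 = 1
  coeff_union : ∀ A B, Separated G A B → ∀ m,
    l (A ∪ B) m = ∑ i ∈ Finset.range (m + 1), l A i * l B (m - i)
  norm_altSum_le : ∀ A m,
    ‖altSum (fun B => l B m) A‖ ≤ surjSum (fun _ => (1 : ℝ)) m A / m.factorial

/-- The sum of the power series. -/
noncomputable def seriesSum (l : Finset ι → ℕ → ℂ) (z : ℂ) (B : Finset ι) : ℂ := ∑' m, l B m * z ^ m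

variable {G : SimpleGraph ι} {Δ : ℕ} {l : Finset ι → ℕ → ℂ}

namespace IsClusterSeries

theorem norm_coeff_le (hl : IsClusterSeries G l) (B : Finset ι) (m : ℕ) :
    ‖l B m‖ ≤ (B.card : ℝ) ^ m / m.factorial := by
  rw [← sum_altSum (fun B => l B m) B]
  refine (norm_sum_le _ _).trans ((Finset.sum_le_sum fun A _ => hl.norm_altSum_le A m).trans_eq ?_)
  rw [← Finset.sum_div, sum_surjSum]
  simp

theorem summable_norm (hl : IsClusterSeries G l) (B : Finset ι) (z : ℂ) :
    Summable fun m => ‖l B m * z ^ m‖ := by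
  refine Summable.of_nonneg_of_le (fun _ => norm_nonneg _) (fun m => ?_)
    (summable_pow_div_factorial B.card ‖z‖)
  rw [norm_mul, norm_pow, mul_div_right_comm]
  exact mul_le_mul_of_nonneg_right (hl.norm_coeff_le B m) (by positivity)

theorem hasSum (hl : IsClusterSeries G l) (B : Finset ι) (z : ℂ) :
    HasSum (fun m => l B m * z ^ m) (seriesSum l z B) :=
  (hl.summable_norm B z).of_norm.hasSum

theorem seriesSum_empty (hl : IsClusterSeries G l) (z : ℂ) : seriesSum l z ∅ = 1 := by
  have h : ∀ m, m ≠ 0 → l ∅ m * z ^ m = 0 := by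
    intro m hm
    have := hl.norm_coeff_le ∅ m
    rw [Finset.card_empty, Nat.cast_zero, zero_pow hm, zero_div] at this
    rw [norm_le_zero_iff.1 this, zero_mul]
  rw [seriesSum, tsum_eq_single 0 h, hl.coeff_zero, pow_zero, mul_one]

theorem seriesSum_zero (hl : IsClusterSeries G l) (B : Finset ι) : seriesSum l 0 B = 1 := by
  rw [seriesSum, tsum_eq_single 0 fun m hm => by rw [zero_pow hm, mul_zero], hl.coeff_zero,
    pow_zero, mul_one]

theorem seriesSum_union (hl : IsClusterSeries G l) (z : ℂ) {A B : Finset ι}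
    (h : Separated G A B) : seriesSum l z (A ∪ B) = seriesSum l z A * seriesSum l z B := by
  rw [seriesSum, seriesSum, seriesSum, tsum_mul_tsum_eq_tsum_sum_range_of_summable_norm
    (hl.summable_norm A z) (hl.summable_norm B z)]
  refine tsum_congr fun m => ?_
  rw [hl.coeff_union A B h, Finset.sum_mul]
  refine Finset.sum_congr rfl fun i hi => ?_
  rw [← Nat.add_sub_of_le (Nat.lt_succ_iff.1 (Finset.mem_range.1 hi)), pow_add,
    Nat.add_sub_cancel_left]
  ring

theorem norm_altSum_seriesSum_le (hl : IsClusterSeries G l) (z : ℂ) (A : Finset ι) :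
    ‖altSum (seriesSum l z) A‖ ≤ (Real.exp ‖z‖ - 1) ^ A.card := by
  have h1 : HasSum (fun m => altSum (fun B => l B m) A * z ^ m) (altSum (seriesSum l z) A) := by
    have h2 := (hasSum_sum fun B (_ : B ∈ A.powerset) =>
      (hl.hasSum B z).mul_left ((-1 : ℂ) ^ B.card)).mul_left ((-1 : ℂ) ^ A.card)
    refine h2.congr_fun ?_
    intro m
    simp only [altSum]
    rw [mul_assoc, Finset.sum_mul]
    simp only [mul_assoc]
  rw [← h1.tsum_eq, ← tsum_surjSum_one (norm_nonneg z)]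
  refine tsum_of_norm_bounded (summable_surjSum_one (norm_nonneg z) A).hasSum fun m => ?_
  rw [norm_mul, norm_pow, mul_div_right_comm]
  exact mul_le_mul_of_nonneg_right (hl.norm_altSum_le A m) (by positivity)

theorem differentiable (hl : IsClusterSeries G l) (B : Finset ι) :
    Differentiable ℂ fun z => seriesSum l z B := by
  intro z
  have h := Complex.differentiableOn_tsum_of_summable_norm
    (F := fun m w => l B m * w ^ m) (U := Metric.ball 0 (‖z‖ + 1))
    (summable_pow_div_factorial B.card (‖z‖ + 1)) (fun m => by fun_prop) Metric.isOpen_ball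
    (fun m w hw => by
      rw [norm_mul, norm_pow, mul_div_right_comm]
      rw [mem_ball_zero_iff] at hw
      gcongr
      exact hl.norm_coeff_le B m)
  exact (h z (by simp)).differentiableAt (Metric.isOpen_ball.mem_nhds (by simp))

theorem taylorCoeff_seriesSum (hl : IsClusterSeries G l) (B : Finset ι) :
    taylorCoeff (fun z => seriesSum l z B) = l B :=
  taylorCoeff_eq_of_hasSum (Filter.Eventually.of_forall fun z => hl.hasSum B z)

/-- Within the threshold, adding a vertex changes the value of the series by less than a third. -/
theorem norm_seriesSum_sub_erase_le (hl : IsClusterSeries G l) (hG : DegreeLE G Δ) (hΔ : 1 ≤ Δ)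
    {z : ℂ} (hz : z ∈ Metric.ball (0 : ℂ) (thresholdTime Δ)) {B : Finset ι} {y : ι} (hy : y ∈ B) :
    ‖seriesSum l z B - seriesSum l z (B.erase y)‖ ≤ 1 / 3 * ‖seriesSum l z (B.erase y)‖ := by
  have hΔ' : (1 : ℝ) ≤ Δ := by exact_mod_cast hΔ
  have he : (2.7 : ℝ) ≤ Real.exp 1 := by linarith [Real.exp_one_gt_d9]
  rw [mem_ball_zero_iff, thresholdTime, lt_div_iff₀ (by positivity)] at hz
  have hz1 : ‖z‖ ≤ 1 := by
    by_contra! h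
    have : (1 : ℝ) ≤ 2 * Real.exp 1 ^ 2 * Δ * (Δ + 1) := by
      have h1 : (1 : ℝ) ≤ Real.exp 1 ^ 2 := one_le_pow₀ (by linarith)
      nlinarith [mul_nonneg (sub_nonneg.2 h1) (sub_nonneg.2 hΔ')]
    nlinarith
  -- the Möbius coefficients are bounded by powers of `exp ‖z‖ - 1`, which is at most `2 ‖z‖`
  have hu : Real.exp ‖z‖ - 1 ≤ 2 * ‖z‖ := by
    have := Real.abs_exp_sub_one_le (x := ‖z‖) (by rwa [abs_of_nonneg (norm_nonneg _)])
    rw [abs_of_nonneg (norm_nonneg z)] at this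
    exact (le_abs_self _).trans this
  have hu0 : 0 ≤ Real.exp ‖z‖ - 1 := by linarith [Real.add_one_le_exp ‖z‖, norm_nonneg z]
  have huΔ : (Real.exp ‖z‖ - 1) * Real.exp 1 * (2 * Δ + 1) ≤ 1 := by
    have h2 : Real.exp 1 * (2 * Δ + 1) ≤ Real.exp 1 ^ 2 * Δ * (Δ + 1) := by
      have : (2 * Δ + 1 : ℝ) ≤ Real.exp 1 * (Δ * (Δ + 1)) :=
        le_trans (b := 2 * (Δ * (Δ + 1) : ℝ)) (by nlinarith) (by gcongr; linarith)
      nlinarith [Real.exp_pos 1]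
    calc _ ≤ 2 * ‖z‖ * (Real.exp 1 * (2 * Δ + 1)) := by
          rw [mul_assoc]; exact mul_le_mul_of_nonneg_right hu (by positivity)
      _ ≤ 2 * ‖z‖ * (Real.exp 1 ^ 2 * Δ * (Δ + 1)) := by gcongr
      _ ≤ 1 := by linarith
  refine (norm_sub_erase_le hG hu0 hΔ huΔ (fun A B h => hl.seriesSum_union z h)
    (hl.norm_altSum_seriesSum_le z) hy).trans (mul_le_mul_of_nonneg_right ?_ (norm_nonneg _))
  exact one_div_le_one_div_of_le (by norm_num) (by linarith)

theorem seriesSum_ne_zero (hl : IsClusterSeries G l) (hG : DegreeLE G Δ) (hΔ : 1 ≤ Δ)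
    {z : ℂ} (hz : z ∈ Metric.ball (0 : ℂ) (thresholdTime Δ)) (B : Finset ι) :
    seriesSum l z B ≠ 0 := by
  induction B using Finset.induction_on with
  | empty => rw [hl.seriesSum_empty]; exact one_ne_zero
  | insert y B hy ih =>
    have h := hl.norm_seriesSum_sub_erase_le hG hΔ hz (Finset.mem_insert_self y B)
    rw [Finset.erase_insert hy] at h
    intro h0
    rw [h0, zero_sub, norm_neg] at h
    linarith [norm_pos_iff.2 ih]

/-- The logarithm of the series is the sum of the logarithms of the ratios that are obtained by
adding the vertices one after the other. -/
theorem exists_log (hl : IsClusterSeries G l) (hG : DegreeLE G Δ) (hΔ : 1 ≤ Δ) (B : Finset ι) :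
    ∃ F : ℂ → ℂ, AnalyticOnNhd ℂ F (Metric.ball 0 (thresholdTime Δ)) ∧ F 0 = 0 ∧
      (∀ z ∈ Metric.ball (0 : ℂ) (thresholdTime Δ), Complex.exp (F z) = seriesSum l z B) ∧
      ∀ z ∈ Metric.ball (0 : ℂ) (thresholdTime Δ), ‖F z‖ ≤ B.card / 2 := by
  induction B using Finset.induction_on with
  | empty =>
    refine ⟨fun _ => 0, analyticOnNhd_const, rfl, fun z _ => ?_, fun z _ => by simp⟩
    rw [hl.seriesSum_empty, Complex.exp_zero]
  | insert y B hy ih =>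
    obtain ⟨F, hF, hF0, hexp, hbd⟩ := ih
    set q : ℂ → ℂ := fun z => (seriesSum l z (insert y B) - seriesSum l z B) / seriesSum l z B
    have hne := fun z hz => hl.seriesSum_ne_zero hG hΔ (z := z) hz B
    have hq : ∀ z ∈ Metric.ball (0 : ℂ) (thresholdTime Δ), ‖q z‖ ≤ 1 / 3 := by
      intro z hz
      have h := hl.norm_seriesSum_sub_erase_le hG hΔ hz (Finset.mem_insert_self y B)
      rw [Finset.erase_insert hy] at h
      rw [norm_div]
      exact div_le_of_le_mul₀ (norm_nonneg _) (by norm_num) h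
    have hslit : ∀ z ∈ Metric.ball (0 : ℂ) (thresholdTime Δ), 1 + q z ∈ Complex.slitPlane := by
      intro z hz
      refine Or.inl ?_
      have h1 := (Complex.abs_re_le_norm (q z)).trans (hq z hz)
      rw [abs_le] at h1
      rw [Complex.add_re, Complex.one_re]
      linarith [h1.1]
    refine ⟨fun z => F z + Complex.log (1 + q z), ?_, ?_, ?_, ?_⟩
    · refine DifferentiableOn.analyticOnNhd (fun z hz => ?_) Metric.isOpen_ball
      have h1 : DifferentiableAt ℂ q z :=
        ((hl.differentiable (insert y B) z).sub (hl.differentiable B z)).div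
          (hl.differentiable B z) (hne z hz)
      exact ((hF z hz).differentiableAt.add
        ((h1.const_add 1).clog (hslit z hz))).differentiableWithinAt
    · simp [hF0, q, hl.seriesSum_zero]
    · intro z hz
      have h1 : (1 : ℂ) + q z = seriesSum l z (insert y B) / seriesSum l z B := by
        have := hne z hz
        simp only [q]
        field_simp
        ring
      rw [Complex.exp_add, hexp z hz, Complex.exp_log (Complex.slitPlane_ne_zero (hslit z hz)), h1,
        mul_div_cancel₀ _ (hne z hz)]
    · intro z hz
      rw [Finset.card_insert_of_notMem hy]
      have h1 := Complex.norm_log_one_add_half_le_self ((hq z hz).trans (by norm_num))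
      refine (norm_add_le _ _).trans ?_
      push_cast
      linarith [hbd z hz, hq z hz]

end IsClusterSeries

end ClusterSeries


/-! ### The cluster expansion of the logarithm -/

section DlogCoeff

/-- The recursion for `dlogCoeff`, as the identity `(f' / f) f = f'` of formal power series. -/
theorem mk_dlogCoeff_mul {l : ℕ → ℂ} (h0 : l 0 = 1) :
    PowerSeries.mk (dlogCoeff l) * PowerSeries.mk l =
      PowerSeries.derivative ℂ (PowerSeries.mk l) := by
  ext m
  rw [PowerSeries.coeff_mul, Finset.Nat.sum_antidiagonal_eq_sum_range_succ_mk,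
    PowerSeries.coeff_derivative, Finset.sum_range_succ]
  simp only [PowerSeries.coeff_mk, Nat.sub_self, h0, mul_one]
  rw [dlogCoeff_eq]
  ring

/-- The logarithmic derivative of a product is the sum of the logarithmic derivatives. -/
theorem dlogCoeff_mul {l₁ l₂ l : ℕ → ℂ} (h₁ : l₁ 0 = 1) (h₂ : l₂ 0 = 1)
    (h : ∀ m, l m = ∑ i ∈ Finset.range (m + 1), l₁ i * l₂ (m - i)) (m : ℕ) :
    dlogCoeff l m = dlogCoeff l₁ m + dlogCoeff l₂ m := by
  have h0 : l 0 = 1 := by simp [h, h₁, h₂]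
  have hmul : PowerSeries.mk l = PowerSeries.mk l₁ * PowerSeries.mk l₂ := by
    ext m
    rw [PowerSeries.coeff_mul, Finset.Nat.sum_antidiagonal_eq_sum_range_succ_mk]
    simp [h]
  have hne : PowerSeries.mk l ≠ 0 := by
    intro h'
    have := congrArg (PowerSeries.coeff 0) h'
    simp [h0] at this
  have key : PowerSeries.mk (dlogCoeff l) =
      PowerSeries.mk (dlogCoeff l₁) + PowerSeries.mk (dlogCoeff l₂) := by
    refine mul_right_cancel₀ hne ?_
    rw [mk_dlogCoeff_mul h0, hmul, Derivation.leibniz, ← mk_dlogCoeff_mul h₁,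
      ← mk_dlogCoeff_mul h₂, smul_eq_mul, smul_eq_mul]
    ring
  simpa using congrArg (PowerSeries.coeff m) key

end DlogCoeff

section Order

variable {ι : Type*}

/-- The set function `f` is a sum of functions that depend on at most `k` elements at a time. -/
def OrderLE (f : Finset ι → ℂ) (k : ℕ) : Prop := ∀ A, k < A.card → altSum f A = 0

theorem altSum_sub (f g : Finset ι → ℂ) (A : Finset ι) :
    altSum (fun B => f B - g B) A = altSum f A - altSum g A := by
  simp only [altSum, mul_sub, Finset.sum_sub_distrib]

theorem altSum_sum {κ : Type*} (s : Finset κ) (f : κ → Finset ι → ℂ) (A : Finset ι) :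
    altSum (fun B => ∑ j ∈ s, f j B) A = ∑ j ∈ s, altSum (f j) A := by
  simp only [altSum, Finset.mul_sum]
  exact Finset.sum_comm

theorem altSum_const_mul (c : ℂ) (f : Finset ι → ℂ) (A : Finset ι) :
    altSum (fun B => c * f B) A = c * altSum f A := by
  simp only [altSum, Finset.mul_sum]
  exact Finset.sum_congr rfl fun B _ => by ring

theorem OrderLE.mono {f : Finset ι → ℂ} {k k' : ℕ} (hf : OrderLE f k) (h : k ≤ k') :
    OrderLE f k' := fun A hA => hf A (h.trans_lt hA)

theorem OrderLE.const_mul (c : ℂ) {f : Finset ι → ℂ} {k : ℕ} (hf : OrderLE f k) :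
    OrderLE (fun B => c * f B) k := fun A hA => by rw [altSum_const_mul, hf A hA, mul_zero]

theorem OrderLE.sub {f g : Finset ι → ℂ} {k : ℕ} (hf : OrderLE f k) (hg : OrderLE g k) :
    OrderLE (fun B => f B - g B) k := fun A hA => by rw [altSum_sub, hf A hA, hg A hA, sub_zero]

theorem OrderLE.sum {κ : Type*} {s : Finset κ} {f : κ → Finset ι → ℂ} {k : ℕ}
    (hf : ∀ j ∈ s, OrderLE (f j) k) : OrderLE (fun B => ∑ j ∈ s, f j B) k := fun A hA => by
  rw [altSum_sum]
  exact Finset.sum_eq_zero fun j hj => hf j hj A hA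

variable [DecidableEq ι]

/-- The Möbius coefficients of a product: the product is expanded over pairs of sets, sorted by
their union. -/
theorem altSum_mul (f g : Finset ι → ℂ) (A : Finset ι) :
    altSum (fun B => f B * g B) A = ∑ P ∈ A.powerset, ∑ Q ∈ A.powerset,
      if P ∪ Q = A then altSum f P * altSum g Q else 0 := by
  refine altSum_of_sum (f := fun B => f B * g B) (g := fun A => ∑ P ∈ A.powerset,
    ∑ Q ∈ A.powerset, if P ∪ Q = A then altSum f P * altSum g Q else 0) (fun B => ?_) A
  have h1 : ∀ A ∈ B.powerset, (∑ P ∈ A.powerset, ∑ Q ∈ A.powerset,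
      if P ∪ Q = A then altSum f P * altSum g Q else 0) =
      ∑ P ∈ B.powerset, ∑ Q ∈ B.powerset, if P ∪ Q = A then altSum f P * altSum g Q else 0 := by
    intro A hA
    rw [Finset.mem_powerset] at hA
    have h2 : ∀ P, (∑ Q ∈ A.powerset, if P ∪ Q = A then altSum f P * altSum g Q else 0) =
        ∑ Q ∈ B.powerset, if P ∪ Q = A then altSum f P * altSum g Q else 0 := by
      refine fun P => Finset.sum_subset (Finset.powerset_mono.2 hA) fun Q _ hQ => if_neg ?_
      rintro rfl
      exact hQ (Finset.mem_powerset.2 Finset.subset_union_right)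
    rw [Finset.sum_congr rfl fun P _ => h2 P]
    refine Finset.sum_subset (Finset.powerset_mono.2 hA) fun P _ hP =>
      Finset.sum_eq_zero fun Q _ => if_neg ?_
    rintro rfl
    exact hP (Finset.mem_powerset.2 Finset.subset_union_left)
  rw [Finset.sum_congr rfl h1, Finset.sum_comm, ← sum_altSum f B, ← sum_altSum g B,
    Finset.sum_mul_sum]
  refine Finset.sum_congr rfl fun P hP => ?_
  rw [Finset.sum_comm]
  refine Finset.sum_congr rfl fun Q hQ => ?_
  rw [Finset.sum_ite_eq, if_pos]
  exact Finset.mem_powerset.2 (Finset.union_subset (Finset.mem_powerset.1 hP)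
    (Finset.mem_powerset.1 hQ))

theorem OrderLE.mul {f g : Finset ι → ℂ} {k k' : ℕ} (hf : OrderLE f k) (hg : OrderLE g k') :
    OrderLE (fun B => f B * g B) (k + k') := fun A hA => by
  rw [altSum_mul]
  refine Finset.sum_eq_zero fun P _ => Finset.sum_eq_zero fun Q _ => ?_
  split_ifs with h
  · have h1 := Finset.card_union_le P Q
    rw [h] at h1
    rcases lt_or_ge k P.card with h2 | h2
    · rw [hf P h2, zero_mul]
    · rw [hg Q (by omega), mul_zero]
  · rfl

end Order

section Expansion

variable {ι : Type*} [DecidableEq ι]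

/-- The Taylor polynomial of order `M` of the logarithm of a power series with coefficients `l`. -/
noncomputable def logTaylor (l : ℕ → ℂ) (M : ℕ) (t : ℂ) : ℂ :=
  ∑ m ∈ Finset.range M, dlogCoeff l m / (m + 1) * t ^ (m + 1)

/-- The set `A` is nonempty and spans a connected subgraph. -/
def IsCluster (G : SimpleGraph ι) (A : Finset ι) : Prop :=
  A.Nonempty ∧ ∀ A₁ A₂, A₁ ∪ A₂ = A → A₁.Nonempty → A₂.Nonempty → ¬ Separated G A₁ A₂

variable {G : SimpleGraph ι} {Δ : ℕ} {l : Finset ι → ℕ → ℂ}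

namespace IsClusterSeries

theorem orderLE_coeff (hl : IsClusterSeries G l) (m : ℕ) : OrderLE (fun B => l B m) m := by
  intro A hA
  have h := hl.norm_altSum_le A m
  rw [surjSum_eq_zero _ hA, zero_div] at h
  exact norm_le_zero_iff.1 h

/-- The coefficient of `z ^ m` of the logarithmic derivative only involves products of coefficients
whose orders add up to at most `m + 1`. -/
theorem orderLE_dlogCoeff (hl : IsClusterSeries G l) (m : ℕ) :
    OrderLE (fun B => dlogCoeff (l B) m) (m + 1) := by
  induction m using Nat.strong_induction_on with
  | _ m ih =>
    rw [show (fun B => dlogCoeff (l B) m) = fun B => (m + 1) * l B (m + 1) -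
      ∑ j ∈ Finset.range m, dlogCoeff (l B) j * l B (m - j) from funext fun B => dlogCoeff_eq _ _]
    refine ((hl.orderLE_coeff (m + 1)).const_mul _).sub (OrderLE.sum fun j hj => ?_)
    rw [Finset.mem_range] at hj
    exact ((ih j hj).mul (hl.orderLE_coeff (m - j))).mono (by omega)

theorem altSum_logTaylor_eq_zero_of_card_lt (hl : IsClusterSeries G l) {M : ℕ} (t : ℂ)
    {A : Finset ι} (hA : M < A.card) : altSum (fun B => logTaylor (l B) M t) A = 0 := by
  have : OrderLE (fun B => logTaylor (l B) M t) M := by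
    unfold logTaylor
    refine OrderLE.sum fun m hm => ?_
    rw [Finset.mem_range] at hm
    rw [show (fun B => dlogCoeff (l B) m / (m + 1) * t ^ (m + 1)) = fun B =>
      t ^ (m + 1) / (m + 1) * dlogCoeff (l B) m from funext fun B => by ring]
    exact ((hl.orderLE_dlogCoeff m).mono hm).const_mul _
  exact this A hA

theorem logTaylor_union (hl : IsClusterSeries G l) (M : ℕ) (t : ℂ) {A B : Finset ι}
    (h : Separated G A B) :
    logTaylor (l (A ∪ B)) M t = logTaylor (l A) M t + logTaylor (l B) M t := by
  rw [logTaylor, logTaylor, logTaylor, ← Finset.sum_add_distrib]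
  refine Finset.sum_congr rfl fun m _ => ?_
  rw [dlogCoeff_mul (hl.coeff_zero A) (hl.coeff_zero B) (hl.coeff_union A B h)]
  ring

theorem altSum_logTaylor_eq_zero (hl : IsClusterSeries G l) (M : ℕ) (t : ℂ)
    {A : Finset ι} (hA : ¬ IsCluster G A) : altSum (fun B => logTaylor (l B) M t) A = 0 := by
  rcases A.eq_empty_or_nonempty with rfl | hne
  · have h : Separated G (∅ : Finset ι) ∅ := ⟨Finset.disjoint_empty_left _, by simp⟩
    have h1 := hl.logTaylor_union M t h
    rw [Finset.union_empty, left_eq_add] at h1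
    simp [altSum, h1]
  · simp only [IsCluster, not_and, not_forall, not_not] at hA
    obtain ⟨A₁, A₂, rfl, h₁, h₂, h⟩ := hA hne
    exact altSum_eq_zero_of_additive h.1 h₁ h₂ fun A' hA' B' hB' =>
      hl.logTaylor_union M t (h.mono hA' hB')

/-- The cluster expansion: only connected sets of at most `M` elements contribute to the Taylor
polynomial of order `M`. -/
theorem logTaylor_eq_sum (hl : IsClusterSeries G l) (M : ℕ) (t : ℂ) {B : Finset ι}
    {F : Finset (Finset ι)} (hF : ∀ A ∈ F, A ⊆ B)
    (hF' : ∀ A ⊆ B, IsCluster G A → A.card ≤ M → A ∈ F) :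
    logTaylor (l B) M t = ∑ A ∈ F, altSum (fun B => logTaylor (l B) M t) A := by
  rw [← sum_altSum (fun B => logTaylor (l B) M t) B]
  refine (Finset.sum_subset (fun A hA => Finset.mem_powerset.2 (hF A hA)) fun A hA hAF => ?_).symm
  by_contra hne
  refine hAF (hF' A (Finset.mem_powerset.1 hA) ?_ ?_)
  · by_contra h
    exact hne (hl.altSum_logTaylor_eq_zero M t h)
  · by_contra! h
    exact hne (hl.altSum_logTaylor_eq_zero_of_card_lt t h)

/-- The Taylor polynomials of the logarithm converge uniformly in compact subsets of the disc. -/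
theorem exists_log_taylor (hl : IsClusterSeries G l) (hG : DegreeLE G Δ) (hΔ : 1 ≤ Δ)
    (B : Finset ι) :
    ∃ F : ℂ → ℂ, AnalyticOnNhd ℂ F (Metric.ball 0 (thresholdTime Δ)) ∧ F 0 = 0 ∧
      (∀ z ∈ Metric.ball (0 : ℂ) (thresholdTime Δ), Complex.exp (F z) = seriesSum l z B) ∧
      ∀ t, ‖t‖ < thresholdTime Δ → ∀ M, ‖F t - logTaylor (l B) M t‖ ≤
        B.card / (1 - ‖t‖ / thresholdTime Δ) * (‖t‖ / thresholdTime Δ) ^ M := by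
  obtain ⟨F, hF, hF0, hexp, hbd⟩ := hl.exists_log hG hΔ B
  refine ⟨F, hF, hF0, hexp, fun t ht M => ?_⟩
  have hR : 0 < thresholdTime Δ := (norm_nonneg t).trans_lt ht
  have h1 := norm_sub_taylor_le hF.differentiableOn hbd ht (M + 1)
  have h2 : ∑ m ∈ Finset.range (M + 1), taylorCoeff F m * t ^ m = logTaylor (l B) M t := by
    have h0 : taylorCoeff F 0 = 0 := by simp [taylorCoeff, hF0]
    rw [Finset.sum_range_succ', h0, zero_mul, add_zero, logTaylor]
    refine Finset.sum_congr rfl fun m _ => ?_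
    rw [← hl.taylorCoeff_seriesSum B, ← succ_mul_taylorCoeff_eq_dlogCoeff
      (hF 0 (Metric.mem_ball_self hR)) (hl.seriesSum_zero B)
      (Filter.eventually_of_mem (Metric.ball_mem_nhds _ hR) hexp) m, mul_div_cancel_left₀]
    exact_mod_cast Nat.succ_ne_zero m
  rw [h2] at h1
  have hq : ‖t‖ / thresholdTime Δ < 1 := (div_lt_one hR).2 ht
  have hq' : 0 < 1 - ‖t‖ / thresholdTime Δ := sub_pos.2 hq
  refine h1.trans ?_
  rw [div_mul_eq_mul_div (_ : ℝ) (1 - _), pow_succ]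
  refine div_le_div_of_nonneg_right ?_ hq'.le
  have h3 : 0 ≤ (B.card : ℝ) * (‖t‖ / thresholdTime Δ) ^ M := by positivity
  nlinarith

end IsClusterSeries

end Expansion


/-! ### Operators on tensor products -/

section Operators

open scoped Kronecker Matrix

set_option linter.unusedSectionVars false

variable {V W U X : Type*}

/-- The total configurations, split into the configurations of the sites in the range of an
injective map and those of the remaining sites. -/
noncomputable def splitConfig (g : W → V) (hg : Function.Injective g) :
    (V → X) ≃ (W → X) × ({v // v ∉ Set.range g} → X) :=
  Equiv.ofBijective (fun σ => (fun a => σ (g a), fun v => σ v)) <| by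
    classical
    refine ⟨fun σ τ h => funext fun v => ?_, fun p => ?_⟩
    · rw [Prod.mk.injEq] at h
      by_cases hv : v ∈ Set.range g
      · obtain ⟨a, rfl⟩ := hv
        exact congrFun h.1 a
      · exact congrFun h.2 ⟨v, hv⟩
    · refine ⟨fun v => if hv : v ∈ Set.range g then p.1 hv.choose else p.2 ⟨v, hv⟩, ?_⟩
      refine Prod.ext (funext fun a => ?_) (funext fun v => ?_)
      · have ha : g a ∈ Set.range g := ⟨a, rfl⟩
        simp only [dif_pos ha]
        exact congrArg p.1 (hg ha.choose_spec)
      · simp only [dif_neg v.2]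

@[simp] theorem splitConfig_apply (g : W → V) (hg : Function.Injective g) (σ : V → X) :
    splitConfig g hg σ =
    (fun a => σ (g a), fun v : {v // v ∉ Set.range g} => σ v) := rfl

variable [Fintype V] [Fintype W] [Fintype U] [Fintype X] [DecidableEq V] [DecidableEq W]
  [DecidableEq U] [DecidableEq X]

open Classical in
/-- The operator that acts as `A` on the sites in the range of `g`, and trivially on the others. -/
noncomputable def embedAlong (g : W → V) (A : Matrix (W → X) (W → X) ℂ) :
    Matrix (V → X) (V → X) ℂ :=
  fun σ τ => if ∀ v, v ∉ Set.range g → σ v = τ v then A (fun a => σ (g a)) (fun a => τ (g a)) else 0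

/-- The product matrix `⨂ ρ_v`. -/
def prodMatrix (ρ : V → Matrix X X ℂ) : Matrix (V → X) (V → X) ℂ := fun σ τ => ∏ v, ρ v (σ v) (τ v)

theorem embedAlong_eq (g : W → V) (hg : Function.Injective g) (A : Matrix (W → X) (W → X) ℂ) :
    embedAlong g A = (A ⊗ₖ (1 : Matrix ({v // v ∉ Set.range g} → X) _ ℂ)).submatrix
      (splitConfig g hg) (splitConfig g hg) := by
  ext σ τ
  rw [embedAlong, Matrix.submatrix_apply, splitConfig_apply, splitConfig_apply,
    Matrix.kronecker_apply, Matrix.one_apply]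
  have : (∀ v, v ∉ Set.range g → σ v = τ v) ↔
      (fun v : {v // v ∉ Set.range g} => σ v) = fun v : {v // v ∉ Set.range g} => τ v := by
    simp [funext_iff]
  simp only [this]
  split_ifs <;> simp

/-- Embedding of operators is a homomorphism of star-algebras. -/
noncomputable def embedHom (g : W → V) (hg : Function.Injective g) :
    Matrix (W → X) (W → X) ℂ →⋆ₐ[ℂ] Matrix (V → X) (V → X) ℂ where
  toFun := embedAlong g
  map_one' := by rw [embedAlong_eq g hg, Matrix.one_kronecker_one, Matrix.submatrix_one_equiv]
  map_mul' A B := by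
    rw [embedAlong_eq g hg, embedAlong_eq g hg, embedAlong_eq g hg, Matrix.submatrix_mul_equiv,
      ← Matrix.mul_kronecker_mul, one_mul]
  map_zero' := by ext; simp [embedAlong]
  map_add' A B := by ext; simp only [embedAlong, Matrix.add_apply]; split_ifs <;> simp
  commutes' c := by
    rw [Algebra.algebraMap_eq_smul_one, Algebra.algebraMap_eq_smul_one, embedAlong_eq g hg,
      Matrix.smul_kronecker, Matrix.one_kronecker_one, Matrix.submatrix_smul, Pi.smul_apply,
      Pi.smul_apply, Matrix.submatrix_one_equiv]
  map_star' A := by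
    rw [Matrix.star_eq_conjTranspose, Matrix.star_eq_conjTranspose, embedAlong_eq g hg,
      embedAlong_eq g hg, Matrix.conjTranspose_submatrix, Matrix.conjTranspose_kronecker,
      Matrix.conjTranspose_one]

theorem embedHom_apply (g : W → V) (hg : Function.Injective g) (A : Matrix (W → X) (W → X) ℂ) :
    embedHom g hg A = embedAlong g A := rfl

theorem embedAlong_comp (g : W → V) (hg : Function.Injective g) (h : U → W)
    (A : Matrix (U → X) (U → X) ℂ) :
    embedAlong g (embedAlong h A) = embedAlong (fun a => g (h a)) A := by
  ext σ τ
  simp only [embedAlong]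
  rw [← ite_and]
  refine if_congr ?_ rfl rfl
  constructor
  · rintro ⟨h1, h2⟩ v hv
    by_cases hv' : v ∈ Set.range g
    · obtain ⟨a, rfl⟩ := hv'
      refine h2 a ?_
      rintro ⟨b, rfl⟩
      exact hv ⟨b, rfl⟩
    · exact h1 v hv'
  · refine fun h1 => ⟨fun v hv => h1 v ?_, fun a ha => h1 _ ?_⟩
    · rintro ⟨b, rfl⟩
      exact hv ⟨_, rfl⟩
    · rintro ⟨b, hb⟩
      exact ha ⟨b, hg hb⟩

theorem prodMatrix_eq (ρ : V → Matrix X X ℂ) (g : W → V) (hg : Function.Injective g) :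
    prodMatrix ρ = (prodMatrix (fun a => ρ (g a)) ⊗ₖ
      prodMatrix fun v : {v // v ∉ Set.range g} => ρ v).submatrix
        (splitConfig g hg) (splitConfig g hg) := by
  classical
  ext σ τ
  rw [prodMatrix, Matrix.submatrix_apply, splitConfig_apply, splitConfig_apply,
    Matrix.kronecker_apply, prodMatrix, prodMatrix,
    ← Fintype.prod_subtype_mul_prod_subtype (fun v => v ∈ Set.range g)
      fun v => ρ v (σ v) (τ v)]
  congr 1
  convert (Fintype.prod_equiv (Equiv.ofInjective g hg) (fun a => ρ (g a) (σ (g a)) (τ (g a)))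
    (fun v => ρ v (σ v) (τ v)) fun a => rfl).symm

theorem prodMatrix_mul (ρ ρ' : V → Matrix X X ℂ) :
    prodMatrix ρ * prodMatrix ρ' = prodMatrix fun v => ρ v * ρ' v := by
  ext σ τ
  simp only [prodMatrix, Matrix.mul_apply, Finset.prod_univ_sum, Fintype.piFinset_univ,
    Finset.prod_mul_distrib]

theorem trace_prodMatrix (ρ : V → Matrix X X ℂ) (hρ : ∀ v, (ρ v).trace = 1) :
    (prodMatrix ρ).trace = 1 := by
  have h : (prodMatrix ρ).trace = ∏ v, (ρ v).trace := by
    simp only [prodMatrix, Matrix.trace, Matrix.diag_apply, Finset.prod_univ_sum,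
      Fintype.piFinset_univ]
  rw [h, Finset.prod_congr rfl fun v _ => hρ v, Finset.prod_const_one]

theorem trace_submatrix_equiv {m n : Type*} [Fintype m] [Fintype n] (e : m ≃ n)
    (A : Matrix n n ℂ) : (A.submatrix e e).trace = A.trace :=
  e.sum_comp fun i => A i i

/-- The expectation of an operator in a product state only depends on the states of the sites on
which it acts. -/
theorem trace_embedAlong_mul (g : W → V) (hg : Function.Injective g)
    (A : Matrix (W → X) (W → X) ℂ) (ρ : V → Matrix X X ℂ) (hρ : ∀ v, (ρ v).trace = 1) :
    (embedAlong g A * prodMatrix ρ).trace = (A * prodMatrix fun a => ρ (g a)).trace := by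
  rw [embedAlong_eq g hg, prodMatrix_eq ρ g hg, Matrix.submatrix_mul_equiv,
    trace_submatrix_equiv, ← Matrix.mul_kronecker_mul, Matrix.trace_kronecker, one_mul,
    trace_prodMatrix (fun v : {v // v ∉ Set.range g} => ρ v) fun v => hρ v, mul_one]

/-- An operator on sites outside the range of `g`, in terms of the splitting along `g`. -/
theorem embedAlong_eq_of_disjoint (g : W → V) (hg : Function.Injective g) (h : U → V)
    (hgh : ∀ a b, g a ≠ h b) (B : Matrix (U → X) (U → X) ℂ) :
    embedAlong h B = ((1 : Matrix (W → X) _ ℂ) ⊗ₖ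
      embedAlong (fun b => (⟨h b, fun ⟨a, ha⟩ => hgh a b ha⟩ : {v // v ∉ Set.range g})) B).submatrix
        (splitConfig g hg) (splitConfig g hg) := by
  ext σ τ
  rw [embedAlong, Matrix.submatrix_apply, splitConfig_apply, splitConfig_apply,
    Matrix.kronecker_apply, Matrix.one_apply, embedAlong, ite_mul, one_mul, zero_mul, ← ite_and]
  refine if_congr ⟨fun h1 => ⟨funext fun a => h1 _ ?_, fun v hv => h1 _ ?_⟩, ?_⟩ rfl rfl
  · rintro ⟨b, hb⟩
    exact hgh a b hb.symm
  · rintro ⟨b, hb⟩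
    exact hv ⟨b, Subtype.ext hb⟩
  · rintro ⟨h1, h2⟩ v hv
    by_cases hv' : v ∈ Set.range g
    · obtain ⟨a, rfl⟩ := hv'
      exact congrFun h1 a
    · refine h2 ⟨v, hv'⟩ ?_
      rintro ⟨b, hb⟩
      exact hv ⟨b, congrArg Subtype.val hb⟩

theorem embedAlong_commute (g : W → V) (hg : Function.Injective g) (h : U → V)
    (hgh : ∀ a b, g a ≠ h b) (A : Matrix (W → X) (W → X) ℂ) (B : Matrix (U → X) (U → X) ℂ) :
    Commute (embedAlong g A) (embedAlong h B) := by
  rw [Commute, SemiconjBy, embedAlong_eq g hg, embedAlong_eq_of_disjoint g hg h hgh,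
    Matrix.submatrix_mul_equiv, Matrix.submatrix_mul_equiv, ← Matrix.mul_kronecker_mul,
    ← Matrix.mul_kronecker_mul, one_mul, mul_one, one_mul, mul_one]

/-- Expectations in product states of operators on disjoint sets of sites are independent. -/
theorem trace_embedAlong_mul_embedAlong_mul (g : W → V) (hg : Function.Injective g) (h : U → V)
    (hh : Function.Injective h) (hgh : ∀ a b, g a ≠ h b) (A : Matrix (W → X) (W → X) ℂ)
    (B : Matrix (U → X) (U → X) ℂ) (ρ : V → Matrix X X ℂ) (hρ : ∀ v, (ρ v).trace = 1) :
    (embedAlong g A * embedAlong h B * prodMatrix ρ).trace =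
      (embedAlong g A * prodMatrix ρ).trace * (embedAlong h B * prodMatrix ρ).trace := by
  rw [trace_embedAlong_mul g hg A ρ hρ, trace_embedAlong_mul h hh B ρ hρ, embedAlong_eq g hg,
    embedAlong_eq_of_disjoint g hg h hgh, prodMatrix_eq ρ g hg, Matrix.submatrix_mul_equiv,
    Matrix.submatrix_mul_equiv, trace_submatrix_equiv, ← Matrix.mul_kronecker_mul,
    ← Matrix.mul_kronecker_mul, Matrix.trace_kronecker, one_mul, mul_one,
    trace_embedAlong_mul
      (fun b => (⟨h b, fun ⟨a, ha⟩ => hgh a b ha⟩ : {v // v ∉ Set.range g}))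
      (fun a b hab => hh (congrArg Subtype.val hab)) B (fun v => ρ v) fun v => hρ v]

open scoped Matrix.Norms.L2Operator

/-- Homomorphisms of C⋆-algebras are contractive. -/
theorem norm_embedAlong_le (g : W → V) (hg : Function.Injective g)
    (A : Matrix (W → X) (W → X) ℂ) : ‖embedAlong g A‖ ≤ ‖A‖ :=
  NonUnitalStarAlgHom.norm_apply_le (embedHom g hg) A

theorem norm_one_matrix_le {m : Type*} [Fintype m] [DecidableEq m] :
    ‖(1 : Matrix m m ℂ)‖ ≤ 1 := by
  rcases subsingleton_or_nontrivial (Matrix m m ℂ) with h | h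
  · rw [Subsingleton.elim (1 : Matrix m m ℂ) 0, norm_zero]
    exact zero_le_one
  · exact CStarRing.norm_one.le

/-- The inequality `|tr (A ρ)| ≤ ‖A‖ tr ρ` for a positive matrix `ρ = Cᴴ C`: the trace is the sum of
the inner products `⟨x, A x⟩` over the columns `x` of `Cᴴ`. -/
theorem norm_trace_mul_conjTranspose_mul_self_le {m : Type*} [Fintype m] [DecidableEq m]
    (A C : Matrix m m ℂ) : ‖(A * (Cᴴ * C)).trace‖ ≤ ‖A‖ * ‖(Cᴴ * C).trace‖ := by
  have h1 : ∀ A : Matrix m m ℂ, (A * (Cᴴ * C)).trace = ∑ i, inner ℂ (WithLp.toLp 2 fun j => Cᴴ j i)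
      (Matrix.toEuclideanCLM (n := m) (𝕜 := ℂ) A (WithLp.toLp 2 fun j => Cᴴ j i)) := by
    intro A
    rw [← mul_assoc, Matrix.trace_mul_comm, Matrix.trace]
    refine Finset.sum_congr rfl fun i _ => ?_
    rw [Matrix.diag_apply, Matrix.mul_apply, PiLp.inner_apply]
    refine Finset.sum_congr rfl fun j _ => ?_
    simp [Matrix.mul_apply, Matrix.mulVec, dotProduct, mul_comm]
  have h2 : (Cᴴ * C).trace =
      ((∑ i, ‖(WithLp.toLp 2 fun j => Cᴴ j i : EuclideanSpace ℂ m)‖ ^ 2 : ℝ) : ℂ) := by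
    have := h1 1
    rw [one_mul] at this
    rw [this, Complex.ofReal_sum]
    refine Finset.sum_congr rfl fun i _ => ?_
    rw [map_one, one_apply_eq_self, inner_self_eq_norm_sq_to_K]
    simp
  rw [h1, h2, Complex.norm_real, Real.norm_of_nonneg (by positivity), Finset.mul_sum]
  refine (norm_sum_le _ _).trans (Finset.sum_le_sum fun i _ => ?_)
  refine (norm_inner_le_norm _ _).trans ?_
  have h3 := (Matrix.toEuclideanCLM (n := m) (𝕜 := ℂ) A).le_opNorm (WithLp.toLp 2 fun j => Cᴴ j i)
  rw [Matrix.l2_opNorm_toEuclideanCLM] at h3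
  calc _ ≤ _ := mul_le_mul_of_nonneg_left h3 (norm_nonneg _)
    _ = _ := by ring

open scoped MatrixOrder in
theorem norm_trace_mul_prodMatrix_le (A : Matrix (V → X) (V → X) ℂ) (ρ : V → Matrix X X ℂ)
    (hpos : ∀ v, (ρ v).PosSemidef) (hρ : ∀ v, (ρ v).trace = 1) :
    ‖(A * prodMatrix ρ).trace‖ ≤ ‖A‖ := by
  choose C hC using fun v => CStarAlgebra.nonneg_iff_eq_star_mul_self.1 (hpos v).nonneg
  have h1 : prodMatrix ρ = (prodMatrix C)ᴴ * prodMatrix C := by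
    have h2 : (prodMatrix C)ᴴ = prodMatrix fun v => (C v)ᴴ := by
      ext σ τ
      simp [prodMatrix]
    rw [h2, prodMatrix_mul]
    exact congrArg prodMatrix (funext hC)
  have h3 := norm_trace_mul_conjTranspose_mul_self_le A (prodMatrix C)
  rwa [← h1, trace_prodMatrix ρ hρ, norm_one, mul_one] at h3

end Operators


/-! ### The Loschmidt echo as a cluster series -/

theorem embedOperator_eq {n d : ℕ} (X : Finset (Fin n)) (A : Matrix (X → Fin d) (X → Fin d) ℂ) :
    embedOperator X A = embedAlong (Subtype.val : X → Fin n) A := by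
  ext σ τ
  simp [embedOperator, embedAlong]

theorem degreeLE_of_maxDegree_le {ι : Type*} [Fintype ι] (G : SimpleGraph ι) [DecidableRel G.Adj]
    {Δ : ℕ} (h : G.maxDegree ≤ Δ) : DegreeLE G Δ := by
  intro x A hA
  refine le_trans (Finset.card_le_card (t := G.neighborFinset x) fun y hy => ?_)
    ((G.degree_le_maxDegree x).trans h)
  exact (G.mem_neighborFinset x y).2 (hA y hy)

theorem ProductState.toMatrix_eq {n d : ℕ} (ρ : ProductState n d) :
    ρ.toMatrix = prodMatrix ρ.site := rfl

namespace LocalHamiltonian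

variable {n d k : ℕ} (H : LocalHamiltonian n d k) (ρ : ProductState n d)

/-- The contribution of a term to the Hamiltonian. -/
noncomputable def termOperator (j : Fin H.numTerms) : Matrix (Fin n → Fin d) (Fin n → Fin d) ℂ :=
  (H.coeff j : ℂ) • embedOperator (H.subsystem j) (H.term j)

/-- The sum of the terms in `B`, as an operator on the spins in `U`. Terms that are not supported in
`U` are left out. -/
noncomputable def localHamiltonian (U : Finset (Fin n)) (B : Finset (Fin H.numTerms)) :
    Matrix (U → Fin d) (U → Fin d) ℂ :=
  ∑ j ∈ B, if h : H.subsystem j ⊆ U then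
    (H.coeff j : ℂ) • embedAlong (fun v : H.subsystem j => (⟨v, h v.2⟩ : U)) (H.term j) else 0

/-- The Taylor coefficients of the Loschmidt echo for the sum of the terms in `B`. -/
noncomputable def echoSeries (B : Finset (Fin H.numTerms)) (m : ℕ) : ℂ :=
  (-Complex.I) ^ m / m.factorial * ((∑ j ∈ B, H.termOperator j) ^ m * ρ.toMatrix).trace

/-- The spins on which the terms in `B` act. -/
def support (B : Finset (Fin H.numTerms)) : Finset (Fin n) := B.biUnion H.subsystem

theorem subsystem_subset_support {B : Finset (Fin H.numTerms)} {j : Fin H.numTerms} (hj : j ∈ B) :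
    H.subsystem j ⊆ H.support B := Finset.subset_biUnion_of_mem H.subsystem hj

theorem sum_termOperator_eq {U : Finset (Fin n)} {B : Finset (Fin H.numTerms)}
    (hU : ∀ j ∈ B, H.subsystem j ⊆ U) : ∑ j ∈ B, H.termOperator j =
      embedAlong (Subtype.val : U → Fin n) (H.localHamiltonian U B) := by
  rw [localHamiltonian, ← embedHom_apply _ Subtype.val_injective, map_sum]
  refine Finset.sum_congr rfl fun j hj => ?_
  rw [dif_pos (hU j hj), map_smul, embedHom_apply, embedAlong_comp _ Subtype.val_injective,
    termOperator, embedOperator_eq]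

theorem sum_termOperator_pow {U : Finset (Fin n)} {B : Finset (Fin H.numTerms)}
    (hU : ∀ j ∈ B, H.subsystem j ⊆ U) (m : ℕ) : (∑ j ∈ B, H.termOperator j) ^ m =
      embedAlong (Subtype.val : U → Fin n) (H.localHamiltonian U B ^ m) := by
  rw [H.sum_termOperator_eq hU, ← embedHom_apply _ Subtype.val_injective, ← map_pow, embedHom_apply]

/-- The Taylor coefficients can be computed on any set of spins that contains the support. -/
theorem echoSeries_eq {U : Finset (Fin n)} {B : Finset (Fin H.numTerms)}
    (hU : ∀ j ∈ B, H.subsystem j ⊆ U) (m : ℕ) : H.echoSeries ρ B m =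
      (-Complex.I) ^ m / m.factorial *
        (H.localHamiltonian U B ^ m * prodMatrix fun v : U => ρ.site v).trace := by
  rw [echoSeries, H.sum_termOperator_pow hU, ρ.toMatrix_eq,
    trace_embedAlong_mul _ Subtype.val_injective _ _ ρ.site_trace]

theorem disjoint_support {A B : Finset (Fin H.numTerms)} (h : Separated H.interactionGraph A B) :
    Disjoint (H.support A) (H.support B) := by
  rw [support, support, Finset.disjoint_biUnion_left]
  intro i hi
  rw [Finset.disjoint_biUnion_right]
  intro j hj
  have hij : i ≠ j := fun hij => Finset.disjoint_left.1 h.1 hi (hij ▸ hj)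
  by_contra hdis
  exact h.2 i hi j hj ⟨hij, hdis⟩

open scoped Matrix.Norms.L2Operator

theorem norm_termOperator_le (j : Fin H.numTerms) : ‖H.termOperator j‖ ≤ 1 := by
  rw [termOperator, norm_smul, embedOperator_eq]
  refine mul_le_one₀ ?_ (norm_nonneg _) ((norm_embedAlong_le _ Subtype.val_injective _).trans ?_)
  · rw [Complex.norm_real]
    exact H.abs_coeff_le j
  · rw [← Matrix.l2_opNorm_toEuclideanCLM]
    exact H.norm_term_le j

/-- Sums of terms with disjoint supports commute and are independent in a product state, and the
Möbius coefficients are expectations of sums over surjective words in contractions. -/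
theorem isClusterSeries_echoSeries : IsClusterSeries H.interactionGraph (H.echoSeries ρ) where
  coeff_zero B := by
    simp [echoSeries, ρ.toMatrix_eq, trace_prodMatrix _ ρ.site_trace]
  coeff_union A B hAB m := by
    have hne : ∀ (a : H.support A) (b : H.support B), (a : Fin n) ≠ b := fun a b hab =>
      Finset.disjoint_left.1 (H.disjoint_support hAB) a.2 (hab ▸ b.2)
    have hA := fun i => H.sum_termOperator_pow (U := H.support A) (B := A)
      (fun _ hj => H.subsystem_subset_support hj) i
    have hB := fun i => H.sum_termOperator_pow (U := H.support B) (B := B)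
      (fun _ hj => H.subsystem_subset_support hj) i
    have hcomm : Commute (∑ j ∈ A, H.termOperator j) (∑ j ∈ B, H.termOperator j) := by
      have := embedAlong_commute _ Subtype.val_injective _ hne
        (H.localHamiltonian (H.support A) A ^ 1) (H.localHamiltonian (H.support B) B ^ 1)
      rwa [← hA 1, ← hB 1, pow_one, pow_one] at this
    have htrace : ∀ i j, ((∑ j ∈ A, H.termOperator j) ^ i * (∑ j ∈ B, H.termOperator j) ^ j *
        ρ.toMatrix).trace = ((∑ j ∈ A, H.termOperator j) ^ i * ρ.toMatrix).trace *
          ((∑ j ∈ B, H.termOperator j) ^ j * ρ.toMatrix).trace := by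
      intro i j
      rw [hA, hB, ρ.toMatrix_eq]
      exact trace_embedAlong_mul_embedAlong_mul _ Subtype.val_injective _ Subtype.val_injective hne
        _ _ _ ρ.site_trace
    simp only [echoSeries]
    rw [Finset.sum_union hAB.1, hcomm.add_pow, Finset.sum_mul, Matrix.trace_sum, Finset.mul_sum]
    refine Finset.sum_congr rfl fun i hi => ?_
    have hi' : i ≤ m := Nat.lt_succ_iff.1 (Finset.mem_range.1 hi)
    have hsmul : ∀ (P : Matrix (Fin n → Fin d) (Fin n → Fin d) ℂ) (c : ℕ),
        (P * (c : Matrix (Fin n → Fin d) (Fin n → Fin d) ℂ) * ρ.toMatrix).trace =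
          c * (P * ρ.toMatrix).trace := by
      intro P c
      rw [← nsmul_eq_mul', smul_mul_assoc, Matrix.trace_smul, nsmul_eq_mul]
    have h1 := Nat.factorial_ne_zero i
    have h2 := Nat.factorial_ne_zero (m - i)
    have h3 : (m.choose i : ℂ) ≠ 0 := by exact_mod_cast (Nat.choose_pos hi').ne'
    rw [hsmul, htrace, ← Nat.choose_mul_factorial_mul_factorial hi']
    nth_rewrite 1 [← Nat.add_sub_of_le hi']
    rw [pow_add]
    push_cast
    field_simp
  norm_altSum_le A m := by
    have h1 : altSum (fun B => H.echoSeries ρ B m) A = (-Complex.I) ^ m / m.factorial *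
        (surjSum H.termOperator m A * ρ.toMatrix).trace := by
      simp only [echoSeries]
      rw [altSum_const_mul, altSum_of_sum
        (f := fun B => ((∑ j ∈ B, H.termOperator j) ^ m * ρ.toMatrix).trace)
        (g := fun A => (surjSum H.termOperator m A * ρ.toMatrix).trace)]
      intro B
      rw [← sum_surjSum, Finset.sum_mul, Matrix.trace_sum]
    rw [h1, norm_mul, norm_div, norm_pow, norm_neg, Complex.norm_I, one_pow, Complex.norm_natCast,
      div_mul_eq_mul_div, one_mul]
    refine div_le_div_of_nonneg_right ?_ (Nat.cast_nonneg _)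
    exact (norm_trace_mul_prodMatrix_le _ _ ρ.site_posSemidef ρ.site_trace).trans
      (norm_surjSum_le norm_one_matrix_le H.norm_termOperator_le m A)

theorem loschmidtEcho_eq (z : ℂ) :
    loschmidtEcho H ρ z = seriesSum (H.echoSeries ρ) z Finset.univ := by
  have h1 := NormedSpace.exp_series_hasSum_exp' (𝕂 := ℂ) ((-(Complex.I * z)) • H.toMatrix)
  have h2 : Continuous fun A : Matrix (Fin n → Fin d) (Fin n → Fin d) ℂ =>
      (A * ρ.toMatrix).trace := by fun_prop
  have h3 := h1.map (AddMonoidHom.mk' (fun A : Matrix (Fin n → Fin d) (Fin n → Fin d) ℂ =>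
    (A * ρ.toMatrix).trace) fun A B => by rw [add_mul, Matrix.trace_add]) h2
  refine h3.unique ((H.isClusterSeries_echoSeries ρ).hasSum Finset.univ z |>.congr_fun fun m => ?_)
  simp only [Function.comp_apply, AddMonoidHom.mk'_apply]
  rw [smul_pow, smul_smul, smul_mul_assoc, Matrix.trace_smul, smul_eq_mul, echoSeries, toMatrix,
    ← neg_mul, mul_pow]
  simp only [termOperator]
  ring

end LocalHamiltonian


/-! ### Digits, first occurrences and walks -/

section Digits

theorem sum_mul_pow_eq_finFunctionFinEquiv {m n : ℕ} {f : ℕ → ℕ} (hf : ∀ s < n, f s < m) :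
    ∑ s ∈ Finset.range n, f s * m ^ s =
      (finFunctionFinEquiv fun s : Fin n => (⟨f s, hf s s.2⟩ : Fin m) : ℕ) := by
  rw [finFunctionFinEquiv_apply, Finset.sum_range]

theorem sum_mul_pow_lt {m n : ℕ} {f : ℕ → ℕ} (hf : ∀ s < n, f s < m) :
    ∑ s ∈ Finset.range n, f s * m ^ s < m ^ n := by
  rw [sum_mul_pow_eq_finFunctionFinEquiv hf]
  exact Fin.is_lt _

theorem sum_mul_pow_div_mod {m n : ℕ} {f : ℕ → ℕ} (hf : ∀ s < n, f s < m) {s : ℕ} (hs : s < n) :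
    (∑ s ∈ Finset.range n, f s * m ^ s) / m ^ s % m = f s := by
  have h := finFunctionFinEquiv_symm_apply_val
    (finFunctionFinEquiv fun s : Fin n => (⟨f s, hf s s.2⟩ : Fin m)) ⟨s, hs⟩
  rw [Equiv.symm_apply_apply] at h
  rw [sum_mul_pow_eq_finFunctionFinEquiv hf, ← h]

theorem sum_div_mod_mul_pow {m n c : ℕ} (hm : 0 < m) (hc : c < m ^ n) :
    ∑ s ∈ Finset.range n, c / m ^ s % m * m ^ s = c := by
  rw [sum_mul_pow_eq_finFunctionFinEquiv (f := fun s => c / m ^ s % m) fun s _ => Nat.mod_lt _ hm]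
  have : (fun s : Fin n => (⟨c / m ^ (s : ℕ) % m, Nat.mod_lt _ hm⟩ : Fin m)) =
      finFunctionFinEquiv.symm ⟨c, hc⟩ := by
    ext s
    rw [finFunctionFinEquiv_symm_apply_val]
  rw [this, Equiv.apply_symm_apply]

/-- The positions of the digits `1` of `b` in base two, up to the position `n`. -/
def bitSet (n b : ℕ) : Finset ℕ := (Finset.range n).filter fun i => b / 2 ^ i % 2 = 1

theorem mem_bitSet {n b i : ℕ} : i ∈ bitSet n b ↔ i < n ∧ b / 2 ^ i % 2 = 1 := by
  simp [bitSet]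

/-- Numbers with `n` binary digits stand for the subsets of a set of `n` elements. -/
theorem sum_bitSet {R : Type*} [AddCommMonoid R] (n : ℕ) (f : Finset ℕ → R) :
    ∑ b ∈ Finset.range (2 ^ n), f (bitSet n b) = ∑ I ∈ (Finset.range n).powerset, f I := by
  have hdig : ∀ I : Finset ℕ, ∀ s < n, (if s ∈ I then 1 else 0) < 2 := by
    intro I s _; split_ifs <;> omega
  refine Finset.sum_nbij' (bitSet n)
    (fun I => ∑ s ∈ Finset.range n, (if s ∈ I then 1 else 0) * 2 ^ s) ?_ ?_ ?_ ?_ fun _ _ => rfl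
  · intro b _
    exact Finset.mem_powerset.2 (Finset.filter_subset _ _)
  · intro I _
    exact Finset.mem_range.2 (sum_mul_pow_lt (hdig I))
  · intro b hb
    have h1 : ∀ s ∈ Finset.range n,
        (if s ∈ bitSet n b then 1 else 0) * 2 ^ s = b / 2 ^ s % 2 * 2 ^ s := by
      intro s hs
      have h2 := Nat.mod_two_eq_zero_or_one (b / 2 ^ s)
      rw [Finset.mem_range] at hs
      simp only [mem_bitSet, hs, true_and]
      rcases h2 with h2 | h2 <;> simp [h2]
    rw [Finset.sum_congr rfl h1]
    exact sum_div_mod_mul_pow two_pos (Finset.mem_range.1 hb)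
  · intro I hI
    rw [Finset.mem_powerset] at hI
    ext s
    rw [mem_bitSet]
    constructor
    · rintro ⟨hs, h⟩
      rw [sum_mul_pow_div_mod (hdig I) hs] at h
      by_contra h'
      simp [h'] at h
    · intro hs
      have hs' := Finset.mem_range.1 (hI hs)
      exact ⟨hs', by rw [sum_mul_pow_div_mod (hdig I) hs', if_pos hs]⟩

end Digits

section FirstOccurrence

/-- The product over the image of a sequence can be taken over the first occurrences. -/
@[to_additive]
theorem prod_first_eq_prod_image {ι R : Type*} [DecidableEq ι] [CommMonoid R] (I : Finset ℕ)
    (p : ℕ → ι) (f : ι → R) : (∏ i ∈ I, if ∀ j ∈ I, j < i → p j ≠ p i then f (p i) else 1) =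
      ∏ x ∈ I.image p, f x := by
  induction I using Finset.induction_on_max with
  | empty => simp
  | insert a I hI ih =>
    have ha : a ∉ I := fun h => lt_irrefl _ (hI a h)
    have h1 : ∀ i ∈ I, (if ∀ j ∈ insert a I, j < i → p j ≠ p i then f (p i) else 1) =
        if ∀ j ∈ I, j < i → p j ≠ p i then f (p i) else 1 := by
      intro i hi
      refine if_congr ?_ rfl rfl
      rw [Finset.forall_mem_insert]
      exact and_iff_right fun h => absurd h (hI i hi).not_gt
    rw [Finset.prod_insert ha, Finset.prod_congr rfl h1, ih, Finset.image_insert]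
    by_cases hp : p a ∈ I.image p
    · rw [Finset.insert_eq_of_mem hp, if_neg, one_mul]
      obtain ⟨j, hj, hja⟩ := Finset.mem_image.1 hp
      exact fun h => h j (Finset.mem_insert_of_mem hj) (hI j hj) hja
    · rw [Finset.prod_insert hp, if_pos]
      intro j hj hja h
      rcases Finset.mem_insert.1 hj with rfl | hj
      · exact lt_irrefl _ hja
      · exact hp (Finset.mem_image.2 ⟨j, hj, h⟩)

end FirstOccurrence

section Walks

variable {ι : Type*} [DecidableEq ι] {G : SimpleGraph ι}

/-- A walk of length `m` that starts at `x`, may pause, and visits precisely the vertices in `A`. -/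
def Visits (G : SimpleGraph ι) (x : ι) (m : ℕ) (A : Finset ι) : Prop :=
  ∃ f : ℕ → ι, f 0 = x ∧ (∀ i < m, f (i + 1) = f i ∨ G.Adj (f i) (f (i + 1))) ∧
    (Finset.range (m + 1)).image f = A

theorem Visits.pause {x : ι} {m : ℕ} {A : Finset ι} (h : Visits G x m A) {m' : ℕ} (hm : m ≤ m') :
    Visits G x m' A := by
  obtain ⟨f, h0, h1, rfl⟩ := h
  refine ⟨fun i => f (min i m), by simpa using h0, fun i _ => ?_, ?_⟩
  · dsimp only
    rcases lt_or_ge i m with hi | hi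
    · rw [min_eq_left hi.le, min_eq_left (by omega)]
      exact h1 i hi
    · rw [min_eq_right hi, min_eq_right (by omega)]
      exact Or.inl rfl
  · ext y
    simp only [Finset.mem_image, Finset.mem_range]
    constructor
    · rintro ⟨i, -, rfl⟩
      exact ⟨min i m, by omega, rfl⟩
    · rintro ⟨i, hi, rfl⟩
      exact ⟨i, by omega, by rw [min_eq_left (by omega)]⟩

/-- A walk can be extended by a detour to a neighbor of one of its vertices and back. -/
theorem Visits.detour {x : ι} {m : ℕ} {A : Finset ι} (h : Visits G x m A) {a b : ι} (ha : a ∈ A)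
    (hab : G.Adj a b) : Visits G x (m + 2) (insert b A) := by
  obtain ⟨f, h0, h1, rfl⟩ := h
  obtain ⟨k, hk, rfl⟩ := Finset.mem_image.1 ha
  rw [Finset.mem_range] at hk
  set g : ℕ → ι := fun i => if i ≤ k then f i else if i = k + 1 then b else f (i - 2) with hg
  have g1 : ∀ i ≤ k, g i = f i := fun i hi => if_pos hi
  have g2 : g (k + 1) = b := by simp [hg]
  have g3 : ∀ i, k ≤ i → g (i + 2) = f i := by
    intro i hi
    simp only [hg]
    rw [if_neg (by omega), if_neg (by omega), Nat.add_sub_cancel]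
  refine ⟨g, by rw [g1 0 (Nat.zero_le _), h0], fun i hi => ?_, ?_⟩
  · rcases lt_trichotomy i k with hik | rfl | hik
    · rw [g1 _ hik.le, g1 _ hik]
      exact h1 i (by omega)
    · rw [g1 _ le_rfl, g2]
      exact Or.inr hab
    · obtain ⟨j, rfl⟩ : ∃ j, i = k + 1 + j := ⟨i - (k + 1), by omega⟩
      rcases Nat.eq_zero_or_pos j with rfl | hj
      · rw [add_zero, g2, show k + 1 + 1 = k + 2 by rfl, g3 k le_rfl]
        exact Or.inr hab.symm
      · obtain ⟨l, rfl⟩ : ∃ l, j = l + 1 := ⟨j - 1, by omega⟩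
        rw [show k + 1 + (l + 1) = k + l + 2 by ring, show k + l + 2 + 1 = k + l + 1 + 2 by ring,
          g3 _ (by omega), g3 _ (by omega)]
        exact h1 _ (by omega)
  · ext y
    simp only [Finset.mem_image, Finset.mem_range, Finset.mem_insert]
    constructor
    · rintro ⟨i, hi, rfl⟩
      simp only [hg]
      split_ifs with h2 h3
      · exact Or.inr ⟨i, by omega, rfl⟩
      · exact Or.inl rfl
      · exact Or.inr ⟨i - 2, by omega, rfl⟩
    · rintro (rfl | ⟨i, hi, rfl⟩)
      · exact ⟨k + 1, by omega, g2⟩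
      · rcases le_or_gt i k with hik | hik
        · exact ⟨i, by omega, g1 i hik⟩
        · exact ⟨i + 2, by omega, g3 i hik.le⟩

/-- A connected set of `m + 1` elements is visited by a walk of length `2 m` from any of its
elements. -/
theorem IsCluster.visits {A : Finset ι} (hA : IsCluster G A) {x : ι} (hx : x ∈ A) {m : ℕ}
    (hm : A.card ≤ m + 1) : Visits G x (2 * m) A := by
  have key : ∀ k < A.card, ∃ B ⊆ A, B.card = k + 1 ∧ Visits G x (2 * k) B := by
    intro k
    induction k with
    | zero =>
      intro _
      exact ⟨{x}, by simpa using hx, by simp, fun _ => x, rfl, by simp, by simp⟩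
    | succ k ih =>
      intro hk
      obtain ⟨B, hBA, hB, hv⟩ := ih (by omega)
      have hne : (A \ B).Nonempty := by
        rw [← Finset.card_pos, Finset.card_sdiff_of_subset hBA]
        omega
      have h1 := hA.2 B (A \ B) (Finset.union_sdiff_of_subset hBA)
        (Finset.card_pos.1 (by omega)) hne
      simp only [Separated, not_and, not_forall, not_not] at h1
      obtain ⟨a, ha, b, hb, hab⟩ := h1 Finset.disjoint_sdiff
      rw [Finset.mem_sdiff] at hb
      refine ⟨insert b B, Finset.insert_subset hb.1 hBA, ?_, hv.detour ha hab⟩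
      rw [Finset.card_insert_of_notMem hb.2, hB]
  have hpos := Finset.card_pos.2 hA.1
  obtain ⟨B, hBA, hB, hv⟩ := key (A.card - 1) (by omega)
  obtain rfl := Finset.eq_of_subset_of_card_le hBA (by omega)
  exact hv.pause (by omega)

end Walks


/-! ### Reading the input -/

section EncodedInput

variable {n d k : ℕ} (deg : ℕ) (H : LocalHamiltonian n d k) (ρ : ProductState n d) (t : ℂ) (ε : ℝ)

theorem encodeInput_size_le (i : ℕ) :
    (encodeInput deg H ρ t ε).nat 5 i 0 ≤ (encodeInput deg H ρ t ε).nat 2 0 0 := by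
  by_cases hi : i < H.numTerms
  · simpa [encodeInput, hi] using H.card_subsystem_le ⟨i, hi⟩
  · simp [encodeInput, hi]

theorem ProductState.dim_pos {n d : ℕ} (ρ : ProductState n d) (v : Fin n) : 0 < d := by
  rcases Nat.eq_zero_or_pos d with rfl | h
  · have := ρ.site_trace v
    simp [Matrix.trace] at this
  · exact h

/-- The input of the computation describes the Hamiltonian `H` and the product state `ρ`. -/
structure Setup.Encodes (S : Setup) (H : LocalHamiltonian n d k) (ρ : ProductState n d) :
    Prop where
  numTerms_eq : S.numTerms = H.numTerms
  dim_eq : S.dim = max d 1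
  loc_eq : S.loc = k
  size_eq : ∀ j : Fin H.numTerms, S.inp.nat 5 j 0 = (H.subsystem j).card
  spin_eq : ∀ (j : Fin H.numTerms) (a : ℕ) (ha : a < (H.subsystem j).card),
    S.inp.nat 6 j a = ((H.subsystem j).orderEmbOfFin rfl ⟨a, ha⟩ : Fin n)
  coeff_eq : ∀ j : Fin H.numTerms, S.inp.cpx 2 j 0 0 = H.coeff j
  term_eq : ∀ (j : Fin H.numTerms) (a b : Fin (d ^ (H.subsystem j).card)),
    S.inp.cpx 3 j a b = H.term j (localConfig _ a) (localConfig _ b)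
  site_eq : ∀ (v : Fin n) (a b : Fin d), S.inp.cpx 4 v a b = ρ.site v a b

theorem encodes_of_inp_eq {S : Setup} (hS : S.inp = encodeInput deg H ρ t ε) : S.Encodes H ρ where
  numTerms_eq := by rw [Setup.numTerms, hS]; rfl
  dim_eq := by rw [Setup.dim, hS]; rfl
  loc_eq := by rw [Setup.loc, hS]; rfl
  size_eq j := by rw [hS]; simp [encodeInput]
  spin_eq j a ha := by rw [hS]; simp [encodeInput, ha]
  coeff_eq j := by rw [hS]; simp [encodeInput]
  term_eq j a b := by rw [hS]; simp [encodeInput]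
  site_eq v a b := by rw [hS]; simp [encodeInput]

variable {H ρ}

theorem Setup.Encodes.mem_subsystem_iff {S : Setup} (hS : S.Encodes H ρ) (j : Fin H.numTerms)
    (u : ℕ) : (∃ a < (H.subsystem j).card, S.inp.nat 6 j a = u) ↔
      ∃ v ∈ H.subsystem j, (v : ℕ) = u := by
  constructor
  · rintro ⟨a, ha, rfl⟩
    rw [hS.spin_eq j a ha]
    exact ⟨_, Finset.orderEmbOfFin_mem _ rfl _, rfl⟩
  · rintro ⟨v, hv, rfl⟩
    have h : v ∈ Set.range ((H.subsystem j).orderEmbOfFin rfl) := by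
      rw [Finset.range_orderEmbOfFin]
      exact hv
    obtain ⟨a, ha⟩ := h
    exact ⟨a, a.2, by rw [hS.spin_eq j a a.2, ← ha]⟩

theorem Setup.Encodes.dim_pos {S : Setup} (hS : S.Encodes H ρ) : 0 < S.dim := by
  rw [hS.dim_eq]
  omega

theorem Setup.Encodes.dim_eq_of_spin {S : Setup} (hS : S.Encodes H ρ) (v : Fin n) : S.dim = d :=
  hS.dim_eq.trans (max_eq_left (ρ.dim_pos v))

end EncodedInput

/-! ### The configurations of the spins of a walk -/

section WalkSpins

variable {n d k : ℕ} {H : LocalHamiltonian n d k} {ρ : ProductState n d}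

/-- The spins on which the terms visited by the first `m` positions of a walk act. -/
def walkSpins (m : ℕ) (P : ℕ → Fin H.numTerms) : Finset (Fin n) :=
  (Finset.range m).biUnion fun i => H.subsystem (P i)

variable {S : Setup} (P : ℕ → Fin H.numTerms)

/-- The state of the spin with number `u` in a configuration, or `0` if there is no such spin. -/
noncomputable def spinState {m : ℕ} {P : ℕ → Fin H.numTerms} (σ : walkSpins m P → Fin d) (u : ℕ) :
    ℕ :=
  if h : u < n then if h' : ⟨u, h⟩ ∈ walkSpins m P then σ ⟨⟨u, h⟩, h'⟩ else 0 else 0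

theorem spinState_coe {m : ℕ} (σ : walkSpins m P → Fin d) (v : walkSpins m P) :
    spinState σ (v : Fin n) = σ v := by
  simp [spinState]

theorem Setup.Encodes.spinState_lt (hS : S.Encodes H ρ)
    {m : ℕ} (σ : walkSpins m P → Fin d) (u : ℕ) : spinState σ u < S.dim := by
  have h := hS.dim_pos
  rw [spinState]
  split_ifs with h1 h2
  · exact lt_of_lt_of_le (Fin.is_lt _) ((le_max_left _ _).trans hS.dim_eq.ge)
  · exact h
  · exact h

theorem Setup.Encodes.valid_iff (hS : S.Encodes H ρ)
    (s : ℕ) : S.Valid (fun i => P i) s ↔ s % S.loc < (H.subsystem (P (s / S.loc))).card := by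
  rw [Setup.Valid, hS.size_eq]

/-- The spin in a slot is one of the spins of the walk. -/
theorem Setup.Encodes.exists_slotSpin_eq (hS : S.Encodes H ρ)
    {s : ℕ} (hs : s < S.slots) (hv : S.Valid (fun i => P i) s) :
    ∃ v ∈ walkSpins S.len P, (v : ℕ) = S.slotSpin (fun i => P i) s := by
  have hv' := hv
  rw [hS.valid_iff] at hv'
  obtain ⟨v, hv1, hv2⟩ := (hS.mem_subsystem_iff (P (s / S.loc)) _).1 ⟨s % S.loc, hv', rfl⟩
  refine ⟨v, Finset.mem_biUnion.2 ⟨s / S.loc, Finset.mem_range.2 ?_, hv1⟩, hv2⟩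
  exact Nat.div_lt_of_lt_mul (by rwa [mul_comm])

/-- The slot of the spin at place `j` of the subsystem at position `i` of the walk. -/
theorem Setup.Encodes.slot_at (hS : S.Encodes H ρ)
    {i j : ℕ} (hi : i < S.len) (hj : j < (H.subsystem (P i)).card) :
    i * S.loc + j < S.slots ∧ S.Valid (fun i => P i) (i * S.loc + j) ∧
      S.slotSpin (fun i => P i) (i * S.loc + j) = S.inp.nat 6 (P i) j := by
  have hjk : j < S.loc := hj.trans_le ((H.card_subsystem_le _).trans hS.loc_eq.ge)
  have h1 : (i * S.loc + j) / S.loc = i := by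
    rw [mul_comm, Nat.mul_add_div (by omega), Nat.div_eq_of_lt hjk, add_zero]
  have h2 : (i * S.loc + j) % S.loc = j := by
    rw [mul_comm, Nat.mul_add_mod, Nat.mod_eq_of_lt hjk]
  refine ⟨?_, ?_, ?_⟩
  · calc i * S.loc + j < (i + 1) * S.loc := by rw [add_mul, one_mul]; omega
      _ ≤ _ := Nat.mul_le_mul_right S.loc hi
  · rwa [hS.valid_iff, h1, h2]
  · change S.inp.nat 6 (P ((i * S.loc + j) / S.loc)) ((i * S.loc + j) % S.loc) = _
    rw [h1, h2]

/-- Every spin of the walk is in some slot. -/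
theorem Setup.Encodes.exists_slot (hS : S.Encodes H ρ) {v : Fin n} (hv : v ∈ walkSpins S.len P) :
    ∃ s < S.slots, S.Valid (fun i => P i) s ∧ S.slotSpin (fun i => P i) s = v := by
  obtain ⟨i, hi, hv⟩ := Finset.mem_biUnion.1 hv
  obtain ⟨j, hj, hjv⟩ := (hS.mem_subsystem_iff (P i) v).2 ⟨v, hv, rfl⟩
  have h := hS.slot_at P
    (Finset.mem_range.1 hi) hj
  exact ⟨_, h.1, h.2.1, h.2.2.trans hjv⟩

open Classical in
/-- The number that encodes a configuration of the spins of a walk. -/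
noncomputable def encodeConfig (S : Setup) (P : ℕ → Fin H.numTerms)
    (σ : walkSpins S.len P → Fin d) : ℕ :=
  ∑ s ∈ Finset.range S.slots,
    (if S.Valid (fun i => P i) s then spinState σ (S.slotSpin (fun i => P i) s) else 0) * S.dim ^ s

variable (σ τ : walkSpins S.len P → Fin d)

theorem Setup.Encodes.encodeConfig_lt (hS : S.Encodes H ρ) : (encodeConfig S P σ) < S.dimTot := by
  refine sum_mul_pow_lt fun s _ => ?_
  split_ifs
  · exact hS.spinState_lt P σ _
  · exact hS.dim_pos

open Classical in
theorem Setup.Encodes.digit_encodeConfig (hS : S.Encodes H ρ)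
    {s : ℕ} (hs : s < S.slots) : S.digit (encodeConfig S P σ) s =
    if S.Valid (fun i => P i) s then spinState σ (S.slotSpin (fun i => P i) s) else 0 := by
  rw [Setup.digit, encodeConfig]
  refine sum_mul_pow_div_mod (m := S.dim)
    (f := fun s => if S.Valid (fun i => P i) s then spinState σ (S.slotSpin (fun i => P i) s) else 0)
    (fun s _ => ?_) hs
  split_ifs
  · exact hS.spinState_lt P σ _
  · exact hS.dim_pos

theorem Setup.Encodes.digit_encodeConfig_of_valid (hS : S.Encodes H ρ)
    {s : ℕ} (hs : s < S.slots) (hv : S.Valid (fun i => P i) s) :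
    S.digit (encodeConfig S P σ) s = spinState σ (S.slotSpin (fun i => P i) s) := by
  rw [hS.digit_encodeConfig P σ hs, if_pos hv]

theorem Setup.Encodes.consistent_encodeConfig (hS : S.Encodes H ρ) :
    S.Consistent (fun i => P i) (encodeConfig S P σ) := by
  refine fun s hs => ⟨fun hv => ?_, fun hv s' hs' hv' h => ?_⟩
  · rw [hS.digit_encodeConfig P σ hs, if_neg hv]
  · rw [hS.digit_encodeConfig_of_valid P σ hs hv,
      hS.digit_encodeConfig_of_valid P σ (hs'.trans hs) hv', h]

theorem Setup.Encodes.encodeConfig_injective (hS : S.Encodes H ρ)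
    {σ τ : walkSpins S.len P → Fin d} (h : (encodeConfig S P σ) = encodeConfig S P τ) :
    σ = τ := by
  funext v
  obtain ⟨s, hs, hv, hsv⟩ := hS.exists_slot P v.2
  have h1 := hS.digit_encodeConfig_of_valid P σ hs hv
  rw [h, hS.digit_encodeConfig_of_valid P τ hs hv, hsv, spinState_coe, spinState_coe] at h1
  exact Fin.ext h1.symm

theorem Setup.Encodes.exists_encodeConfig (hS : S.Encodes H ρ)
    {c : ℕ} (hc : c < S.dimTot) (hcon : S.Consistent (fun i => P i) c) :
    ∃ σ : walkSpins S.len P → Fin d, (encodeConfig S P σ) = c := by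
  have hslot := fun v : walkSpins S.len P => hS.exists_slot P v.2
  choose s hs hval hsv using hslot
  have hdim := hS.dim_pos
  have hlt : ∀ v, S.digit c (s v) < d := fun v =>
    (Nat.mod_lt _ hdim).trans_eq (hS.dim_eq_of_spin (v : Fin n))
  refine ⟨fun v => ⟨S.digit c (s v), hlt v⟩, ?_⟩
  refine (Finset.sum_congr rfl fun r hr => ?_).trans (sum_div_mod_mul_pow hdim hc)
  rw [Finset.mem_range] at hr
  congr 1
  change _ = S.digit c r
  split_ifs with hv
  · obtain ⟨v, hv1, hv2⟩ := hS.exists_slotSpin_eq P hr hv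
    rw [← hv2, spinState_coe P _ ⟨v, hv1⟩]
    -- two slots with the same spin have the same digit
    rcases lt_trichotomy (s ⟨v, hv1⟩) r with h | h | h
    · exact (hcon r hr).2 hv _ h (hval _) ((hsv _).trans hv2)
    · exact congrArg (S.digit c) h
    · exact ((hcon _ (hs ⟨v, hv1⟩)).2 (hval _) r h hv (hv2.symm.trans (hsv ⟨v, hv1⟩).symm)).symm
  · exact ((hcon r hr).1 hv).symm

open Classical in
/-- Sums over consistent numbers are sums over the configurations of the spins of the walk. -/
theorem Setup.Encodes.sum_consistent (hS : S.Encodes H ρ) (f : ℕ → ℂ) :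
    (∑ c ∈ Finset.range S.dimTot, if S.Consistent (fun i => P i) c then f c else 0) =
      ∑ σ : walkSpins S.len P → Fin d, f (encodeConfig S P σ) := by
  rw [← Finset.sum_filter]
  refine (Finset.sum_bij (fun σ _ => encodeConfig S P σ) (fun σ _ => ?_) (fun σ _ τ _ h => ?_)
    (fun c hc => ?_) fun _ _ => rfl).symm
  · exact Finset.mem_filter.2 ⟨Finset.mem_range.2 (hS.encodeConfig_lt P σ),
      hS.consistent_encodeConfig P σ⟩
  · exact hS.encodeConfig_injective P h
  · rw [Finset.mem_filter, Finset.mem_range] at hc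
    obtain ⟨σ, hσ⟩ := hS.exists_encodeConfig P hc.1 hc.2
    exact ⟨σ, Finset.mem_univ _, hσ⟩

/-! ### The matrix entries -/

theorem subsystem_subset_walkSpins {i : ℕ} (hi : i < S.len) :
    H.subsystem (P i) ⊆ walkSpins S.len P :=
  Finset.subset_biUnion_of_mem (fun i => H.subsystem (P i)) (Finset.mem_range.2 hi)

/-- The row and column numbers that the algorithm computes for a term are those of the input
format. -/
theorem Setup.Encodes.localIndex_encodeConfig (hS : S.Encodes H ρ) {i : ℕ} (hi : i < S.len) :
    ∃ a : Fin (d ^ (H.subsystem (P i)).card),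
      S.localIndex (fun i => P i) i (encodeConfig S P σ) = a ∧ localConfig _ a =
        fun v : H.subsystem (P i) => σ ⟨v, subsystem_subset_walkSpins P hi v.2⟩ := by
  set X := H.subsystem (P i) with hX
  have hdig : ∀ j, ∀ hj : j < X.card, S.digit (encodeConfig S P σ) (i * S.loc + j) =
      σ ⟨X.orderEmbOfFin rfl ⟨j, hj⟩,
        subsystem_subset_walkSpins P hi (Finset.orderEmbOfFin_mem _ _ _)⟩ := by
    intro j hj
    obtain ⟨h1, h2, h3⟩ := hS.slot_at P hi hj
    rw [hS.digit_encodeConfig_of_valid P σ h1 h2, h3, hS.spin_eq (P i) j hj]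
    exact spinState_coe P σ ⟨_, _⟩
  have hidx : S.localIndex (fun i => P i) i (encodeConfig S P σ) =
      ∑ j ∈ Finset.range X.card, S.digit (encodeConfig S P σ) (i * S.loc + j) * d ^ j := by
    rw [Setup.localIndex, hS.size_eq]
    refine Finset.sum_congr rfl fun j hj => ?_
    rw [Finset.mem_range] at hj
    rw [hS.dim_eq_of_spin (X.orderEmbOfFin rfl ⟨j, hj⟩)]
  have hlt : ∀ j < X.card, S.digit (encodeConfig S P σ) (i * S.loc + j) < d := fun j hj => by
    rw [hdig j hj]; exact Fin.is_lt _
  refine ⟨⟨_, sum_mul_pow_lt hlt⟩, hidx, funext fun v => ?_⟩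
  set j := (X.orderIsoOfFin rfl).symm v with hj
  have hv : (v : Fin n) = X.orderEmbOfFin rfl j := by
    rw [← Finset.coe_orderIsoOfFin_apply, hj, OrderIso.apply_symm_apply]
  rw [localConfig, ← hj]
  refine Fin.ext ?_
  rw [finFunctionFinEquiv_symm_apply_val]
  refine (sum_mul_pow_div_mod hlt j.2).trans ((hdig j j.2).trans ?_)
  congr 3
  exact hv.symm

theorem Setup.Encodes.termEntry_encodeConfig (hS : S.Encodes H ρ) {i : ℕ} (hi : i < S.len) :
    S.termEntry (fun i => P i) i (encodeConfig S P σ) (encodeConfig S P τ) =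
      embedAlong (fun v : H.subsystem (P i) => (⟨v, subsystem_subset_walkSpins P hi v.2⟩ :
        walkSpins S.len P)) (H.term (P i)) σ τ := by
  obtain ⟨a, ha, ha'⟩ := hS.localIndex_encodeConfig P σ hi
  obtain ⟨b, hb, hb'⟩ := hS.localIndex_encodeConfig P τ hi
  rw [Setup.termEntry, embedAlong, ha, hb, hS.term_eq, ha', hb', hS.size_eq]
  classical
  refine if_congr ⟨fun h v hv => ?_, fun h s hs hval hne => ?_⟩ rfl rfl
  · obtain ⟨s, hs, hval, hsv⟩ := hS.exists_slot P v.2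
    have h1 := h s hs hval fun j hj hjs => by
      obtain ⟨u, hu, huv⟩ := (hS.mem_subsystem_iff (P i) v).1 ⟨j, hj, hjs.trans hsv⟩
      exact hv ⟨⟨u, hu⟩, Subtype.ext (Fin.ext huv)⟩
    rw [hS.digit_encodeConfig_of_valid P σ hs hval, hS.digit_encodeConfig_of_valid P τ hs hval, hsv,
      spinState_coe, spinState_coe] at h1
    exact Fin.ext h1
  · obtain ⟨v, hv1, hv2⟩ := hS.exists_slotSpin_eq P hs hval
    rw [hS.digit_encodeConfig_of_valid P σ hs hval, hS.digit_encodeConfig_of_valid P τ hs hval,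
      ← hv2, spinState_coe P σ ⟨v, hv1⟩, spinState_coe P τ ⟨v, hv1⟩, h ⟨v, hv1⟩]
    rintro ⟨u, hu⟩
    have huv : (u : Fin n) = v := congrArg Subtype.val hu
    obtain ⟨j, hj, hju⟩ := (hS.mem_subsystem_iff (P i) (v : ℕ)).2
      ⟨v, huv ▸ u.2, rfl⟩
    exact hne j hj (hju.trans hv2)

theorem Setup.Encodes.hamEntry_encodeConfig (hS : S.Encodes H ρ)
    (b : ℕ) : S.hamEntry (fun i => P i) b (encodeConfig S P σ) (encodeConfig S P τ) =
    H.localHamiltonian (walkSpins S.len P) ((bitSet S.len b).image P) σ τ := by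
  classical
  rw [LocalHamiltonian.localHamiltonian, ← sum_first_eq_sum_image, Matrix.sum_apply,
    Setup.hamEntry]
  have hsub : bitSet S.len b ⊆ Finset.range S.len := Finset.filter_subset _ _
  rw [← Finset.sum_subset hsub]
  · refine Finset.sum_congr rfl fun i hi => ?_
    obtain ⟨hi1, hi2⟩ := mem_bitSet.1 hi
    have hcond : (b / 2 ^ i % 2 = 1 ∧ ∀ j < i, b / 2 ^ j % 2 = 1 → (P j : ℕ) ≠ P i) ↔
        ∀ j ∈ bitSet S.len b, j < i → P j ≠ P i := by
      simp only [hi2, true_and, mem_bitSet, ne_eq, Fin.val_inj]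
      exact ⟨fun h j hj hji => h j hji hj.2, fun h j hji hj => h j ⟨hji.trans hi1, hj⟩ hji⟩
    rw [if_congr hcond rfl rfl]
    split_ifs with h1 h2
    · rw [hS.coeff_eq, hS.termEntry_encodeConfig P σ τ hi1]
      rfl
    · exact absurd (subsystem_subset_walkSpins P hi1) h2
    · rfl
  · intro i hi hi'
    rw [mem_bitSet, not_and] at hi'
    exact if_neg fun h => hi' (Finset.mem_range.1 hi) h.1

theorem Setup.Encodes.stateEntry_encodeConfig (hS : S.Encodes H ρ) :
    S.stateEntry (fun i => P i) (encodeConfig S P σ) (encodeConfig S P τ) =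
    prodMatrix (fun v : walkSpins S.len P => ρ.site v) σ τ := by
  classical
  set I := (Finset.range S.slots).filter (S.Valid (fun i => P i)) with hI
  set F : ℕ → ℂ := fun u => S.inp.cpx 4 u (spinState σ u) (spinState τ u) with hF
  have h1 : S.stateEntry (fun i => P i) (encodeConfig S P σ) (encodeConfig S P τ) =
      ∏ s ∈ I, if ∀ s' ∈ I, s' < s → S.slotSpin (fun i => P i) s' ≠ S.slotSpin (fun i => P i) s then
        F (S.slotSpin (fun i => P i) s) else 1 := by
    rw [Setup.stateEntry, hI, Finset.prod_filter]
    refine Finset.prod_congr rfl fun s hs => ?_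
    rw [Finset.mem_range] at hs
    by_cases hv : S.Valid (fun i => P i) s
    · rw [if_pos hv]
      refine if_congr ?_ ?_ rfl
      · simp only [Setup.IsFirst, hv, true_and, Finset.mem_filter, Finset.mem_range]
        exact ⟨fun h s' hs' hs'' => h s' hs'' hs'.2, fun h s' hs' hv' =>
          h s' ⟨hs'.trans hs, hv'⟩ hs'⟩
      · rw [hS.digit_encodeConfig_of_valid P σ hs hv, hS.digit_encodeConfig_of_valid P τ hs hv]
    · rw [if_neg hv, if_neg fun h => hv h.1]
  have h2 : I.image (S.slotSpin (fun i => P i)) = (walkSpins S.len P).image Fin.val := by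
    ext u
    simp only [hI, Finset.mem_image, Finset.mem_filter, Finset.mem_range]
    constructor
    · rintro ⟨s, ⟨hs, hv⟩, rfl⟩
      exact hS.exists_slotSpin_eq P hs hv
    · rintro ⟨v, hv, rfl⟩
      obtain ⟨s, hs, hval, hsv⟩ :=
        hS.exists_slot P hv
      exact ⟨s, ⟨hs, hval⟩, hsv⟩
  rw [h1, prod_first_eq_prod_image, h2, Finset.prod_image fun _ _ _ _ h => Fin.ext h, prodMatrix,
    ← Finset.prod_coe_sort]
  refine Finset.prod_congr rfl fun v _ => ?_
  rw [hF]
  dsimp only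
  rw [spinState_coe, spinState_coe, hS.site_eq]

theorem Setup.Encodes.evolEntry_encodeConfig (hS : S.Encodes H ρ)
    (b m : ℕ) : S.evolEntry (fun i => P i) b m (encodeConfig S P σ) (encodeConfig S P τ) =
    (-Complex.I) ^ m / m.factorial *
      (H.localHamiltonian (walkSpins S.len P) ((bitSet S.len b).image P) ^ m *
        prodMatrix fun v : walkSpins S.len P => ρ.site v) σ τ := by
  induction m generalizing σ with
  | zero =>
    rw [Setup.evolEntry, hS.stateEntry_encodeConfig]
    simp
  | succ m ih =>
    rw [Setup.evolEntry, hS.sum_consistent P fun c =>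
        S.hamEntry (fun i => P i) b (encodeConfig S P σ) c *
          S.evolEntry (fun i => P i) b m c (encodeConfig S P τ),
      pow_succ' (H.localHamiltonian _ _), mul_assoc, Matrix.mul_apply, Finset.mul_sum, Finset.mul_sum]
    refine Finset.sum_congr rfl fun υ _ => ?_
    have := Nat.factorial_ne_zero m
    have h' : (m : ℂ) + 1 ≠ 0 := by exact_mod_cast Nat.succ_ne_zero m
    rw [hS.hamEntry_encodeConfig, ih, Nat.factorial_succ, pow_succ]
    push_cast
    field_simp

theorem Setup.Encodes.echoCoeff_eq (hS : S.Encodes H ρ) (b m : ℕ) :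
    S.echoCoeff (fun i => P i) b m = H.echoSeries ρ ((bitSet S.len b).image P) m := by
  rw [H.echoSeries_eq ρ (U := walkSpins S.len P), Setup.echoCoeff,
    hS.sum_consistent P fun c => S.evolEntry (fun i => P i) b m c c, Matrix.trace, Finset.mul_sum]
  · exact Finset.sum_congr rfl fun σ _ => hS.evolEntry_encodeConfig P σ σ b m
  · intro j hj
    obtain ⟨i, hi, rfl⟩ := Finset.mem_image.1 hj
    exact subsystem_subset_walkSpins P (mem_bitSet.1 hi).1

end WalkSpins


/-! ### The output of the algorithm -/

section Output

variable {n d k : ℕ} {H : LocalHamiltonian n d k} {ρ : ProductState n d} {S : Setup}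

/-- The term at a position of the walk described by a word. -/
def walkTerms (S : Setup) (H : LocalHamiltonian n d k) (v : Fin H.numTerms) (w i : ℕ) :
    Fin H.numTerms := if h : S.pos v w i < H.numTerms then ⟨S.pos v w i, h⟩ else v

/-- The set of terms visited by the walk described by a word. -/
def visitedTerms (S : Setup) (H : LocalHamiltonian n d k) (v : Fin H.numTerms) (w : ℕ) :
    Finset (Fin H.numTerms) := (Finset.range S.len).image (walkTerms S H v w)

theorem coe_walkTerms (hS : S.Encodes H ρ) (hslot : SlotSpec S.inp S.slot) (v : Fin H.numTerms)
    (w i : ℕ) : (walkTerms S H v w i : ℕ) = S.pos v w i := by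
  have h : S.pos v w i < H.numTerms := by
    induction i with
    | zero => exact v.2
    | succ i ih =>
      rw [Setup.pos, Setup.step]
      split_ifs
      · exact (hslot.lt _).trans_eq hS.numTerms_eq
      · exact ih
  rw [walkTerms, dif_pos h]

theorem self_mem_visitedTerms (v : Fin H.numTerms) (w : ℕ) : v ∈ visitedTerms S H v w := by
  refine Finset.mem_image.2 ⟨0, Finset.mem_range.2 (Nat.succ_pos _), ?_⟩
  rw [walkTerms, Setup.pos, dif_pos v.2]

theorem maskCard_eq (b : ℕ) : S.maskCard b = (bitSet S.len b).card := by
  rw [Setup.maskCard, bitSet, Finset.card_filter]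
  refine Finset.sum_congr rfl fun i _ => ?_
  rcases Nat.mod_two_eq_zero_or_one (b / 2 ^ i) with h | h <;> simp [h]

theorem weight_eq (hS : S.Encodes H ρ) (hslot : SlotSpec S.inp S.slot) (v : Fin H.numTerms)
    (w : ℕ) : S.weight (S.pos v w) = altSum
      (fun B => logTaylor (H.echoSeries ρ B) S.order (S.inp.cpx 0 0 0 0))
        (visitedTerms S H v w) := by
  have hpos : S.pos v w = fun i => (walkTerms S H v w i : ℕ) :=
    funext fun i => (coe_walkTerms hS hslot v w i).symm
  have hvis : S.visited (S.pos v w) = (visitedTerms S H v w).card := by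
    rw [visitedTerms, Finset.card_eq_sum_ones, ← sum_first_eq_sum_image, Setup.visited]
    refine Finset.sum_congr rfl fun i hi => if_congr ?_ rfl rfl
    rw [Finset.mem_range] at hi
    simp only [hpos, ne_eq, Fin.val_inj, Finset.mem_range]
    exact ⟨fun h j _ hj => h j hj, fun h j hj => h j (hj.trans hi) hj⟩
  have hlog : ∀ b, S.logPoly (S.pos v w) b = logTaylor
      (H.echoSeries ρ ((bitSet S.len b).image (walkTerms S H v w))) S.order
        (S.inp.cpx 0 0 0 0) := by
    intro b
    rw [Setup.logPoly, logTaylor, hpos,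
      show S.echoCoeff (fun i => (walkTerms S H v w i : ℕ)) b = _ from
        funext fun m => hS.echoCoeff_eq (walkTerms S H v w) b m]
  rw [Setup.weight, hvis, altSum, visitedTerms, ← sum_powerset_image, ← sum_bitSet]
  simp only [maskCard_eq, hlog]

theorem covers_iff (hS : S.Encodes H ρ) (hslot : SlotSpec S.inp S.slot) (v : Fin H.numTerms)
    (w w' : ℕ) : S.Covers (S.pos v w) (S.pos v w') ↔
      visitedTerms S H v w ⊆ visitedTerms S H v w' := by
  simp only [Setup.Covers, visitedTerms, Finset.subset_iff, Finset.mem_image, Finset.mem_range,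
    forall_exists_index, and_imp, forall_apply_eq_imp_iff₂, ← coe_walkTerms hS hslot, Fin.val_inj]
  simp only [eq_comm]

theorem canonical_iff (hS : S.Encodes H ρ) (hslot : SlotSpec S.inp S.slot) (v : Fin H.numTerms)
    (w : ℕ) : S.Canonical v w ↔ (∀ x ∈ visitedTerms S H v w, v ≤ x) ∧
      ∀ w' < w, visitedTerms S H v w' ≠ visitedTerms S H v w := by
  rw [Setup.Canonical]
  simp only [covers_iff hS hslot]
  refine and_congr ?_ (forall₂_congr fun w' _ => not_congr ?_)
  · simp only [visitedTerms, Finset.mem_image, Finset.mem_range, forall_exists_index, and_imp,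
      forall_apply_eq_imp_iff₂, Fin.le_def, coe_walkTerms hS hslot]
  · rw [and_comm]
    exact Finset.Subset.antisymm_iff.symm

/-- Every step in the interaction graph can be prescribed by a letter. -/
theorem exists_step (hS : S.Encodes H ρ) (hlist : ListSpec S.inp) (hslot : SlotSpec S.inp S.slot)
    {i j : Fin H.numTerms} (hij : j = i ∨ H.interactionGraph.Adj i j) :
    ∃ c < S.letters, S.step i c = j := by
  rcases hij with rfl | hij
  · exact ⟨S.loc * (S.deg + 1), Nat.lt_succ_self _, if_neg (lt_irrefl _)⟩
  · obtain ⟨u, hui, huj⟩ := Finset.not_disjoint_iff.1 hij.2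
    obtain ⟨a, ha, hau⟩ := (hS.mem_subsystem_iff i u).2 ⟨u, hui, rfl⟩
    obtain ⟨b, hb, hbu⟩ := (hS.mem_subsystem_iff j u).2 ⟨u, huj, rfl⟩
    have hj : (j : ℕ) < S.inp.nat 4 0 0 := j.2.trans_eq hS.numTerms_eq.symm
    have hrank := hlist.rank_le j hj b (hb.trans_eq (hS.size_eq j).symm)
    have hloc := hslot.eq j hj b (hb.trans_eq (hS.size_eq j).symm)
    rw [hbu] at hrank hloc
    have ha' : a < S.loc := ha.trans_le ((H.card_subsystem_le i).trans hS.loc_eq.ge)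
    set r := spinRank S.inp u j with hr
    have hr' : r < S.deg + 1 := Nat.lt_succ_of_le hrank
    have h1 : ((S.deg + 1) * a + r) / (S.deg + 1) = a := by
      rw [Nat.mul_add_div (Nat.succ_pos _), Nat.div_eq_of_lt hr', add_zero]
    have h2 : ((S.deg + 1) * a + r) % (S.deg + 1) = r := by
      rw [Nat.mul_add_mod, Nat.mod_eq_of_lt hr']
    have h3 : (S.deg + 1) * a + r < S.loc * (S.deg + 1) := by
      calc (S.deg + 1) * a + r < (S.deg + 1) * (a + 1) := by rw [mul_add, mul_one]; omega
        _ ≤ (S.deg + 1) * S.loc := Nat.mul_le_mul_left _ ha'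
        _ = _ := mul_comm _ _
    refine ⟨_, h3.trans (Nat.lt_succ_self _), ?_⟩
    rw [Setup.step, if_pos h3, h1, h2, hau]
    exact hloc

/-- Every small connected set of terms is visited by a walk described by a word. -/
theorem exists_word (hS : S.Encodes H ρ) (hlist : ListSpec S.inp) (hslot : SlotSpec S.inp S.slot)
    {A : Finset (Fin H.numTerms)} (hA : IsCluster H.interactionGraph A) (hcard : A.card ≤ S.order)
    {v : Fin H.numTerms} (hv : v ∈ A) : ∃ w < S.words, visitedTerms S H v w = A := by
  obtain ⟨f, h0, hf, hfA⟩ := hA.visits hv (m := S.order) (by omega)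
  have hc : ∀ i, ∃ c < S.letters, i < 2 * S.order → S.step (f i) c = f (i + 1) := by
    intro i
    by_cases hi : i < 2 * S.order
    · obtain ⟨c, hc, h⟩ := exists_step hS hlist hslot (hf i hi)
      exact ⟨c, hc, fun _ => h⟩
    · exact ⟨0, Nat.succ_pos _, fun h => absurd h hi⟩
  choose c hc hstep using hc
  refine ⟨∑ i ∈ Finset.range (2 * S.order), c i * S.letters ^ i, sum_mul_pow_lt fun i _ => hc i, ?_⟩
  rw [← hfA, visitedTerms]
  refine Finset.image_congr fun i hi => ?_
  have hi' : i ≤ 2 * S.order := Nat.lt_succ_iff.1 (Finset.mem_range.1 (Finset.mem_coe.1 hi))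
  refine Fin.ext ?_
  rw [coe_walkTerms hS hslot]
  clear hi
  induction i with
  | zero => rw [Setup.pos, h0]
  | succ i ih =>
    rw [Setup.pos, ih (by omega), sum_mul_pow_div_mod (fun i _ => hc i) (by omega),
      hstep i (by omega)]

/-- The algorithm evaluates the Taylor polynomial of the logarithm by its cluster expansion: every
connected set of at most `order` terms is the set visited by exactly one canonical walk. -/
theorem output_eq_logTaylor (hS : S.Encodes H ρ) (hlist : ListSpec S.inp)
    (hslot : SlotSpec S.inp S.slot) :
    S.output = logTaylor (H.echoSeries ρ Finset.univ) S.order (S.inp.cpx 0 0 0 0) := by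
  classical
  set C : Finset (Fin H.numTerms × ℕ) :=
    (Finset.univ ×ˢ Finset.range S.words).filter fun x => S.Canonical x.1 x.2 with hC
  have hmem : ∀ x, x ∈ C ↔ x.2 < S.words ∧ S.Canonical x.1 x.2 := fun x => by simp [hC]
  have hout : S.output = ∑ x ∈ C, altSum
      (fun B => logTaylor (H.echoSeries ρ B) S.order (S.inp.cpx 0 0 0 0))
        (visitedTerms S H x.1 x.2) := by
    rw [hC, Finset.sum_filter, Finset.sum_product, Setup.output, hS.numTerms_eq, Finset.sum_range]
    exact Finset.sum_congr rfl fun v _ => Finset.sum_congr rfl fun w _ =>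
      if_congr Iff.rfl (weight_eq hS hslot v w) rfl
  have hinj : Set.InjOn (fun x : Fin H.numTerms × ℕ => visitedTerms S H x.1 x.2) C := by
    rintro ⟨v, w⟩ hx ⟨v', w'⟩ hx' h
    have h1 := (canonical_iff hS hslot v w).1 ((hmem _).1 hx).2
    have h2 := (canonical_iff hS hslot v' w').1 ((hmem _).1 hx').2
    dsimp only at h
    obtain rfl : v = v' := le_antisymm (h1.1 v' (h ▸ self_mem_visitedTerms v' w'))
      (h2.1 v (h ▸ self_mem_visitedTerms v w))
    rcases lt_trichotomy w w' with hw | rfl | hw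
    · exact absurd h (h2.2 w hw)
    · rfl
    · exact absurd h.symm (h1.2 w' hw)
  rw [hout, ← Finset.sum_image (f := fun A => altSum
      (fun B => logTaylor (H.echoSeries ρ B) S.order (S.inp.cpx 0 0 0 0)) A) hinj]
  refine ((H.isClusterSeries_echoSeries ρ).logTaylor_eq_sum S.order _
    (fun A _ => Finset.subset_univ A) fun A _ hA hcard => ?_).symm
  set v := A.min' hA.1 with hv
  obtain ⟨w₀, hw₀, hA₀⟩ := exists_word hS hlist hslot hA hcard (A.min'_mem hA.1)
  have hex : ∃ w, visitedTerms S H v w = A := ⟨w₀, hA₀⟩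
  refine Finset.mem_image.2 ⟨(v, Nat.find hex), (hmem _).2 ⟨?_, ?_⟩, Nat.find_spec hex⟩
  · exact (Nat.find_le hA₀).trans_lt hw₀
  · rw [canonical_iff hS hslot]
    dsimp only
    rw [Nat.find_spec hex]
    exact ⟨fun x hx => A.min'_le x hx, fun w' hw' => Nat.find_min hex hw'⟩

end Output

/-! ### The number of steps -/

section Steps

variable {n d k : ℕ} {deg : ℕ} {H : LocalHamiltonian n d k} {ρ : ProductState n d} {t : ℂ} {ε : ℝ}

/-- The terms acting on a given spin are pairwise adjacent in the interaction graph, so there are at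
most `deg + 1` of them. -/
theorem listSpec_encodeInput (hN : 1 ≤ H.numTerms) (hdeg : DegreeLE H.interactionGraph deg) :
    ListSpec (encodeInput deg H ρ t ε) where
  pos := hN
  size_le := encodeInput_size_le deg H ρ t ε
  inj i hi j hj j' hj' h := by
    have hi' : i < H.numTerms := hi
    simp only [encodeInput, hi', dif_pos] at hj hj' h
    simp only [hj, hj', dif_pos, Fin.val_inj] at h
    simpa using h
  rank_le i hi j hj := by
    classical
    have hi' : i < H.numTerms := hi
    have hS : (Setup.mk (encodeInput deg H ρ t ε) 0 id
      (encodeInput_size_le deg H ρ t ε)).Encodes H ρ := encodes_of_inp_eq deg H ρ t ε rfl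
    obtain ⟨u, hu, huj⟩ := (hS.mem_subsystem_iff ⟨i, hi'⟩ _).1
      ⟨j, hj.trans_eq (hS.size_eq ⟨i, hi'⟩), rfl⟩
    have hcard := hdeg ⟨i, hi'⟩ (Finset.univ.filter fun i' : Fin H.numTerms =>
      (i' : ℕ) < i ∧ u ∈ H.subsystem i') fun i' h => by
        rw [Finset.mem_filter] at h
        refine ⟨fun h' => ?_, Finset.not_disjoint_iff.2 ⟨u, hu, h.2.2⟩⟩
        rw [← h'] at h
        exact lt_irrefl _ h.2.1
    refine le_trans (le_of_eq ?_) hcard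
    rw [spinRank, ← Finset.card_filter]
    symm
    refine Finset.card_bij (fun (i' : Fin H.numTerms) _ => (i' : ℕ)) (fun i' h => ?_)
      (fun i₁ _ i₂ _ h => ?_) fun i' h => ?_
    · rw [Finset.mem_filter] at h
      refine Finset.mem_filter.2 ⟨Finset.mem_range.2 h.2.1, ?_⟩
      obtain ⟨a, ha, hau⟩ := (hS.mem_subsystem_iff i' u).2 ⟨u, h.2.2, rfl⟩
      exact ⟨a, ha.trans_eq (hS.size_eq i').symm, hau.trans huj⟩
    · exact Fin.ext h
    · rw [Finset.mem_filter, Finset.mem_range] at h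
      obtain ⟨hlt, a, ha, hau⟩ := h
      have hi'' : i' < H.numTerms := hlt.trans hi'
      obtain ⟨v, hv, hva⟩ := (hS.mem_subsystem_iff ⟨i', hi''⟩ _).1
        ⟨a, ha.trans_eq (hS.size_eq ⟨i', hi''⟩), rfl⟩
      obtain rfl : v = u := Fin.ext (hva.trans (hau.trans huj.symm))
      exact ⟨⟨i', hi''⟩, Finset.mem_filter.2 ⟨Finset.mem_univ _, hlt, hv⟩, rfl⟩

/-- The least order for which the error bound is at most `ε` is logarithmic in the parameters of
the error bound: powers of it are bounded by polynomials. -/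
theorem pow_order_le {K r ε : ℝ} {M : ℕ} (hK : 0 ≤ K) (hr : 0 ≤ r) (hr1 : r < 1) (hε : 0 < ε)
    (hM : ∀ m < M, ε < K * r ^ m) (Q : ℕ) :
    (Q : ℝ) ^ (M + 1) ≤ (Q : ℝ) + (Q : ℝ) ^ 2 + Real.exp 2 ^ Q *
      ((K * (1 / ε)) ^ (1 / Real.log (1 / r))) ^ Q := by
  set X := (K * (1 / ε)) ^ (1 / Real.log (1 / r)) with hX
  have hX0 : 0 ≤ X := Real.rpow_nonneg (by positivity) _
  have hQ : 0 ≤ (Q : ℝ) := Nat.cast_nonneg Q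
  have h3 : 0 ≤ Real.exp 2 ^ Q * X ^ Q := by positivity
  rcases M with _ | _ | M
  · rw [zero_add, pow_one]
    nlinarith
  · rw [zero_add]
    norm_num
    linarith
  · have h1 := hM (M + 1) (Nat.lt_succ_self _)
    have hr0 : 0 < r := by
      rcases hr.eq_or_lt with h | h
      · rw [← h, zero_pow (Nat.succ_ne_zero _), mul_zero] at h1
        exact absurd h1 hε.not_gt
      · exact h
    have hK0 : 0 < K := by
      rcases hK.eq_or_lt with h | h
      · rw [← h, zero_mul] at h1
        exact absurd h1 hε.not_gt
      · exact h
    have hlog : 0 < Real.log (1 / r) := Real.log_pos (by rw [lt_div_iff₀ hr0]; linarith)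
    have hY : 0 < K * (1 / ε) := by positivity
    have h2 : (1 / r) ^ (M + 1) ≤ K * (1 / ε) := by
      rw [div_pow, one_pow, div_le_iff₀ (by positivity), mul_right_comm, mul_one_div,
        le_div_iff₀ hε, one_mul]
      exact h1.le
    -- taking logarithms shows that the order is at most the logarithm of `X`, up to a constant
    have h4 : Real.exp (M + 1 : ℕ) ≤ X := by
      rw [hX, Real.rpow_def_of_pos hY, Real.exp_le_exp, mul_one_div, le_div_iff₀ hlog]
      have h5 := Real.log_le_log (by positivity) h2
      rwa [Real.log_pow] at h5
    have h6 : (Q : ℝ) ≤ Real.exp Q := by linarith [Real.add_one_le_exp (Q : ℝ)]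
    calc (Q : ℝ) ^ (M + 1 + 1 + 1) ≤ Real.exp Q ^ (M + 1 + 1 + 1) := pow_le_pow_left₀ hQ h6 _
      _ = (Real.exp 2 * Real.exp (M + 1 : ℕ)) ^ Q := by
        rw [← Real.exp_add, ← Real.exp_nat_mul, ← Real.exp_nat_mul]
        congr 1
        push_cast
        ring
      _ ≤ (Real.exp 2 * X) ^ Q := by gcongr
      _ = Real.exp 2 ^ Q * X ^ Q := mul_pow _ _ _
      _ ≤ _ := by nlinarith

theorem timeRatio_encodeInput : timeRatio (encodeInput deg H ρ t ε) = ‖t‖ / thresholdTime deg := by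
  rw [timeRatio, thresholdTime]
  simp only [encodeInput]
  rw [div_div_eq_mul_div, div_one]
  ring

theorem errorBound_encodeInput (m : ℕ) : errorBound (encodeInput deg H ρ t ε) m =
    H.numTerms / (1 - ‖t‖ / thresholdTime deg) * (‖t‖ / thresholdTime deg) ^ m := by
  rw [errorBound, timeRatio_encodeInput]
  rfl

theorem exists_order (ht : ‖t‖ < thresholdTime deg) (hε : 0 < ε) :
    ∃ M, errorBound (encodeInput deg H ρ t ε) M ≤ ε ∧
      ∀ m < M, ε < errorBound (encodeInput deg H ρ t ε) m := by
  classical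
  have hR : 0 < thresholdTime deg := (norm_nonneg t).trans_lt ht
  have h1 : Filter.Tendsto (errorBound (encodeInput deg H ρ t ε)) Filter.atTop (nhds 0) := by
    have h := (tendsto_pow_atTop_nhds_zero_of_lt_one (div_nonneg (norm_nonneg t) hR.le)
      ((div_lt_one hR).2 ht)).const_mul ((H.numTerms : ℝ) / (1 - ‖t‖ / thresholdTime deg))
    rw [mul_zero] at h
    exact h.congr fun m => (errorBound_encodeInput m).symm
  have hex : ∃ m, errorBound (encodeInput deg H ρ t ε) m ≤ ε :=
    (h1.eventually (Iio_mem_nhds hε)).exists.imp fun m hm => le_of_lt hm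
  exact ⟨Nat.find hex, Nat.find_spec hex, fun m hm => not_le.1 (Nat.find_min hex hm)⟩

end Steps

theorem mainTheorem1 :
    ∃ P : Program, ∀ d k deg : ℕ, 1 ≤ deg →
      ∃ p : Polynomial ℝ,
        ∀ (n : ℕ) (H : LocalHamiltonian n d k) (ρ : ProductState n d),
          1 ≤ H.numTerms → H.interactionGraph.maxDegree ≤ deg →
          ∃ logL : ℂ → ℂ,
            AnalyticOnNhd ℂ logL (Metric.ball 0 (thresholdTime deg)) ∧
            logL 0 = 0 ∧
            (∀ z ∈ Metric.ball (0 : ℂ) (thresholdTime deg),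
              Complex.exp (logL z) = loschmidtEcho H ρ z) ∧
            ∀ (t : ℂ) (ε : ℝ), ‖t‖ < thresholdTime deg → 0 < ε →
              ∃ (s : Store) (T : ℕ),
                Runs (encodeInput deg H ρ t ε) P Store.blank s T ∧
                (T : ℝ) ≤ H.numTerms * p.eval
                  (((H.numTerms : ℝ) / (1 - ‖t‖ / thresholdTime deg) * (1 / ε)) ^
                    (1 / Real.log (thresholdTime deg / ‖t‖))) ∧
                ‖logL t - s.cpxReg 0‖ ≤ ε := by
  obtain ⟨P, C, D, hP⟩ := exists_program
  refine ⟨P, fun d k deg hdeg => ?_⟩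
  -- the cost of the program is polynomial in `Q ^ (order + 1)`
  set Q : ℕ := (max d 1 + (k * (deg + 1) + 1) + k + deg + 2) ^ (2 * (k + 1) * D) with hQ
  refine ⟨Polynomial.C (C : ℝ) * (Polynomial.C ((Q : ℝ) + (Q : ℝ) ^ 2) +
    Polynomial.C (Real.exp 2 ^ Q) * Polynomial.X ^ Q), fun n H ρ hN hmax => ?_⟩
  have hG := degreeLE_of_maxDegree_le H.interactionGraph hmax
  obtain ⟨F, hF, hF0, hexp, happrox⟩ :=
    (H.isClusterSeries_echoSeries ρ).exists_log_taylor hG hdeg Finset.univ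
  refine ⟨F, hF, hF0, fun z hz => (hexp z hz).trans (H.loschmidtEcho_eq ρ z).symm,
    fun t ε ht hε => ?_⟩
  have hR : 0 < thresholdTime deg := (norm_nonneg t).trans_lt ht
  have hr1 : ‖t‖ / thresholdTime deg < 1 := (div_lt_one hR).2 ht
  obtain ⟨M, hM, hM'⟩ := exists_order (H := H) (ρ := ρ) ht hε
  have hlist : ListSpec (encodeInput deg H ρ t ε) := listSpec_encodeInput hN hG
  obtain ⟨slot, hslot, s, T, hrun, hT, hs⟩ := hP _ M hlist fun m hm => by
    have hre : ((encodeInput deg H ρ t ε).cpx 1 0 0 0).re = ε := by simp [encodeInput]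
    rw [hre]
    rcases hm.lt_or_eq with h | rfl
    · exact iff_of_true (hM' m h) h
    · exact iff_of_false hM.not_gt (lt_irrefl _)
  set S := Setup.mk (encodeInput deg H ρ t ε) M slot hlist.size_le with hSdef
  have hS : S.Encodes H ρ := encodes_of_inp_eq deg H ρ t ε rfl
  refine ⟨s, T, hrun, ?_, ?_⟩
  · have hbound : S.bound ^ D = Q ^ (M + 1) := by
      have h1 : S.bound = (max d 1 + (k * (deg + 1) + 1) + k + deg + 2) ^
          ((2 * M + 1 + 1) * (k + 1)) := rfl
      rw [h1, hQ, ← pow_mul, ← pow_mul]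
      congr 1
      ring
    have h2 : (T : ℝ) ≤ H.numTerms * (C * (Q : ℝ) ^ (M + 1)) := by
      rw [hbound] at hT
      exact_mod_cast hT
    refine h2.trans ?_
    have h3 := pow_order_le (K := (H.numTerms : ℝ) / (1 - ‖t‖ / thresholdTime deg))
      (div_nonneg (Nat.cast_nonneg _) (sub_nonneg.2 hr1.le)) (by positivity) hr1 hε
      (fun m hm => by rw [← errorBound_encodeInput (ρ := ρ) (ε := ε)]; exact hM' m hm) Q
    rw [one_div_div] at h3
    simp only [Polynomial.eval_mul, Polynomial.eval_add, Polynomial.eval_C, Polynomial.eval_pow,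
      Polynomial.eval_X]
    gcongr
  · rw [hs, output_eq_logTaylor hS hlist hslot]
    refine (happrox t ht M).trans ?_
    rw [Finset.card_univ, Fintype.card_fin, ← errorBound_encodeInput (ρ := ρ) (ε := ε)]
    exact hM
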